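/- Boolean circuits are over the basis of constants, negation, and binary AND and OR, and a circuit with values in $\{1,\dots,m\}$ outputs the binary representation of a number in this set. All circuits are given explicitly as lists of gates together with their numbers of inputs and outputs, these numbers being written in unary. Subsets of $[n]=\{1,\dots,n\}$ are identified with their characteristic vectors in $\{0,1\}^n$. **Colorability defect.** For $r\ge 2$ and a family $\mathcal F$ of non-empty subsets of $[n]$, $\mathrm{cd}_r(\mathcal F)$ is the smallest size of a set $Y\subseteq[n]$ such that the elements of $[n]\setminus Y$ can be colored with $r$ colors so that no $e\in\mathcal F$ with $e\cap Y=\emptyset$ is monochromatic. **Sequences of families.** Let $\mathcal A$ be a set whose elements are represented by binary strings, and let $\mathcal F=(\mathcal F_\alpha)_{\alpha\in\mathcal A}$, where $\mathcal F_\alpha$ is a family of non-empty subsets of $[n_\alpha]$. The sequence $\mathcal F$ is *strongly polynomially computable* if there are a linear order $\le$ on each $\mathcal F_\alpha$ and polynomials $q_1,q_2,q_3$ such that 1. some algorithm, given $\alpha$, returns within time $q_1(n_\alpha)$ a circuit $C_1:\{0,1\}^{2n_\alpha}\to\{0,1\}$ such that for all $B_1,B_2\in\mathcal F_\alpha$,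 $C_1(B_1,B_2)=1$ if and only if $B_1\le B_2$; 2. some algorithm, given $\alpha$, returns within time $q_2(n_\alpha)$ a circuit $C_2:\{0,1\}^{n_\alpha}\to\{0,1\}^{n_\alpha}$ such that for every $D\subseteq[n_\alpha]$, $C_2(D)$ is the $\le$-minimal member of $\mathcal F_\alpha$ contained in $D$ if there is one, and $\emptyset$ otherwise; 3. for every prime $p$, some algorithm, given $\alpha$, returns within time $q_3(n_\alpha)$ the value $\mathrm{cd}_p(\mathcal F_\alpha)$. **The problem $\mathrm{Kneser}^r(\mathcal F,m)$**, for $m:\mathcal A\to\mathbb Z$. Input: $\alpha\in\mathcal A$ and a Boolean circuit $C:\{0,1\}^{n_\alpha}\to\{1,\dots,m(\alpha)\}$ (so there is no input with $m(\alpha)\le 0$). Goal: find $r$ pairwise disjoint sets $B_1,\dots,B_r\in\mathcal F_\alpha$ with $C(B_1)=\dots=C(B_r)$. **The problem $\mathbb Z_p$-Tucker**, for a prime $p$. Write $\mathbb Z_p=\{\omega^1,\dots,\omega^p\}$ for the cyclic group of order $p$ in multiplicative notation; for $X,Y\in(\mathbb Z_p\cup\{0\})^n$ write $X\preceq Y$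 if $X_j=Y_j$ whenever $X_j\ne 0$. Input: integers $n,s\ge 0$ with $s\le\lfloor\frac{n-1}{p-1}\rfloor$, and a Boolean circuit that computes a map $\lambda:(\mathbb Z_p\cup\{0\})^n\setminus\{0\}^n\to\mathbb Z_p\times\{1,\dots,s\}$, $\lambda=(\lambda_1,\lambda_2)$, with $\lambda(\omega^tX)=(\omega^t\lambda_1(X),\lambda_2(X))$ for all $X$ and $t$. Goal: find $X_1\preceq X_2\preceq\dots\preceq X_p$ in $(\mathbb Z_p\cup\{0\})^n\setminus\{0\}^n$, a permutation $\pi$ of $\{1,\dots,p\}$ and $\ell\in\{1,\dots,s\}$ with $\lambda(X_t)=(\omega^{\pi(t)},\ell)$ for all $t$. **Reductions.** A search problem $P$ is polynomial-time reducible to a search problem $Q$ if there are polynomial-time algorithms $f,g$ such that $f$ maps every instance $x$ of $P$ to an instance $f(x)$ of $Q$, and $g(x,w)$ is a solution of $x$ for every solution $w$ of $f(x)$. **Theorem.** Let $p$ be a prime and let $\mathcal F=(\mathcal F_\alpha)_{\alpha\in\mathcal A}$ be a strongly polynomially computable sequence of set families. Then the problem $\mathrm{Kneser}^p(\mathcal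 F,m)$ with $m(\alpha)=\big\lfloor\frac{\mathrm{cd}_p(\mathcal F_\alpha)-1}{p-1}\big\rfloor$ is polynomial-time reducible to $\mathbb Z_p$-Tucker. -/

import Mathlib

namespace KneserTucker

/-! ### Strings, machines, polynomial time, search problems -/

/-- Self-delimiting unary encoding of a natural number. -/
def encNat (k : ℕ) : List Bool := List.replicate k true ++ [false]

/-- Self-delimiting pairing of two strings: every bit `b` of `x` is written as `1b`, then a `0`
marks the end of `x`, and `y` follows. -/
def encPair (x y : List Bool) : List Bool := (x.flatMap fun b => [true, b]) ++ false :: y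

/-- The machine `M` (a Turing machine with finitely many stacks, whose input and output alphabets
are identified with `{0,1}`), started on the string `x`, halts after at most `t` steps with the
string `y` on its output stack. Nothing is required of the other stacks at that time. -/
def OutputsWithin (M : Turing.TM2ComputableAux Bool Bool) (x y : List Bool) (t : ℕ) : Prop :=
  ∃ c : Turing.TM2.Cfg M.tm.Γ M.tm.Λ M.tm.σ,
    Nonempty (StateTransition.EvalsToInTime M.tm.step
      (Turing.initList M.tm (x.map M.inputAlphabet.symm)) (some c) t) ∧
    c.l = none ∧ (c.stk M.tm.k₁).map M.outputAlphabet = y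

/-- A search problem: instances with their encoding as strings, and for every instance the set of
strings that encode a solution. -/
structure SearchProblem where
  Inst : Type*
  enc : Inst → List Bool
  IsSol : Inst → List Bool → Prop

/-- Polynomial-time (many-one) reducibility of search problems: a polynomial-time algorithm turns
every instance `x` of `P` into an instance `y` of `Q`, and another polynomial-time algorithm turns
`x` together with any solution `w` of `y` into a solution `v` of `x`. -/
def SearchProblem.PolyTimeReducible (P Q : SearchProblem) : Prop :=
  ∃ (f g : Turing.TM2ComputableAux Bool Bool) (qf qg : Polynomial ℕ),
    ∀ x : P.Inst, ∃ y : Q.Inst,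
      OutputsWithin f (P.enc x) (Q.enc y) (qf.eval (P.enc x).length) ∧
      ∀ w : List Bool, Q.IsSol y w →
        ∃ v : List Bool, P.IsSol x v ∧
          OutputsWithin g (encPair (P.enc x) w) v (qg.eval (encPair (P.enc x) w).length)

/-! ### Boolean circuits -/

/-- Gates of fan-in at most two; the arguments are numbers of wires. -/
inductive Gate where
  | const (b : Bool)
  | neg (i : ℕ)
  | conj (i j : ℕ)
  | disj (i j : ℕ)

/-- The wires read by a gate. -/
def Gate.args : Gate → List ℕ
  | .const _ => []
  | .neg i => [i]
  | .conj i j => [i, j]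
  | .disj i j => [i, j]

/-- Value of a gate, given the list `w` of the values of the earlier wires. -/
def Gate.eval (w : List Bool) : Gate → Bool
  | .const b => b
  | .neg i => !(w.getD i false)
  | .conj i j => w.getD i false && w.getD j false
  | .disj i j => w.getD i false || w.getD j false

def Gate.enc : Gate → List Bool
  | .const false => encNat 0
  | .const true => encNat 1
  | .neg i => encNat 2 ++ encNat i
  | .conj i j => encNat 3 ++ encNat i ++ encNat j
  | .disj i j => encNat 4 ++ encNat i ++ encNat j

/-- A Boolean circuit `{0,1}^n → {0,1}^m`: wires `0, …, n-1` are the inputs, wire `n + k` is the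
output of the `k`-th gate, which reads earlier wires only, and `outputs` selects `m` wires. -/
structure Circuit (n m : ℕ) where
  gates : List Gate
  gates_wf : ∀ (k : ℕ) (hk : k < gates.length), ∀ i ∈ (gates[k]).args, i < n + k
  outputs : Fin m → ℕ
  outputs_wf : ∀ i, outputs i < n + gates.length

/-- The values of all wires on input `x`. -/
def Circuit.wires {n m : ℕ} (C : Circuit n m) (x : Fin n → Bool) : List Bool :=
  C.gates.foldl (fun w g => w ++ [g.eval w]) (List.ofFn x)

/-- The function computed by a circuit. -/
def Circuit.eval {n m : ℕ} (C : Circuit n m) (x : Fin n → Bool) : Fin m → Bool :=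
  fun i => (C.wires x).getD (C.outputs i) false

/-- Encoding of a circuit. All numbers in it are at most the number of wires and outputs, so writing
them in unary changes the length only polynomially. -/
def Circuit.enc {n m : ℕ} (C : Circuit n m) : List Bool :=
  encNat n ++ encNat C.gates.length ++ C.gates.flatMap Gate.enc ++
    encNat m ++ (List.ofFn C.outputs).flatMap encNat

/-- The natural number with binary digits `b`, least significant digit first. -/
def binValue {k : ℕ} (b : Fin k → Bool) : ℕ := ∑ i, if b i then 2 ^ (i : ℕ) else 0

/-- Characteristic vector of a subset of an `n`-element ground set. -/
def charVec {n : ℕ} (B : Finset (Fin n)) : Fin n → Bool := fun j => decide (j ∈ B)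

/-! ### Set families, colorability defect, the Kneser problem -/

/-- The sub-hypergraph of `(X, E)` induced by `X ∖ Y` is `r`-colorable. (A coloring of `X ∖ Y` is
given here by any extension of it to the whole ground set `X`.) -/
def ColorableOff {X : Type*} (r : ℕ) (E : Finset (Finset X)) (Y : Finset X) : Prop :=
  ∃ c : X → Fin r, ∀ e ∈ E, Disjoint e Y → ¬ ∃ i : Fin r, ∀ x ∈ e, c x = i

/-- The `r`-colorability defect of a family of non-empty subsets of `X`. -/
noncomputable def colorabilityDefect {X : Type*} (r : ℕ) (E : Finset (Finset X)) : ℕ :=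
  sInf {k : ℕ | ∃ Y : Finset X, Y.card = k ∧ ColorableOff r E Y}

/-- A sequence of set families indexed by a set `A` whose elements are represented by strings;
`fam α` is a family of non-empty subsets of an `n α`-element ground set. -/
structure SetFamilySequence (A : Type*) where
  enc : A → List Bool
  enc_injective : Function.Injective enc
  n : A → ℕ
  fam : ∀ α, Finset (Finset (Fin (n α)))
  nonempty_of_mem : ∀ α, ∀ B ∈ fam α, B.Nonempty

/-- Strong polynomial computability of a sequence of set families. The value of the colorability
defect, which is at most `n α`, is returned in unary. -/
def SetFamilySequence.StronglyPolyComputable {A : Type*} (F : SetFamilySequence A) : Prop :=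
  ∃ (ord : ∀ α, LinearOrder {B : Finset (Fin (F.n α)) // B ∈ F.fam α}) (q₁ q₂ q₃ : Polynomial ℕ),
    (∃ M : Turing.TM2ComputableAux Bool Bool, ∀ α, ∃ C₁ : Circuit (F.n α + F.n α) 1,
      OutputsWithin M (F.enc α) C₁.enc (q₁.eval (F.n α)) ∧
      ∀ B₁ B₂ : {B : Finset (Fin (F.n α)) // B ∈ F.fam α},
        C₁.eval (Fin.append (charVec B₁.1) (charVec B₂.1)) 0 = true ↔ (ord α).le B₁ B₂) ∧
    (∃ M : Turing.TM2ComputableAux Bool Bool, ∀ α, ∃ C₂ : Circuit (F.n α) (F.n α),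
      OutputsWithin M (F.enc α) C₂.enc (q₂.eval (F.n α)) ∧
      ∀ D : Finset (Fin (F.n α)),
        (∀ B : {B : Finset (Fin (F.n α)) // B ∈ F.fam α}, B.1 ⊆ D →
          (∀ B' : {B : Finset (Fin (F.n α)) // B ∈ F.fam α}, B'.1 ⊆ D → (ord α).le B B') →
          C₂.eval (charVec D) = charVec B.1) ∧
        ((∀ B ∈ F.fam α, ¬ B ⊆ D) → C₂.eval (charVec D) = charVec ∅)) ∧
    (∀ p : ℕ, p.Prime → ∃ M : Turing.TM2ComputableAux Bool Bool, ∀ α,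
      OutputsWithin M (F.enc α) (encNat (colorabilityDefect p (F.fam α))) (q₃.eval (F.n α)))

/-- An instance of the Kneser problem: an index `α` and a circuit `{0,1}^(n α) → {1, …, m α}`, whose
output is a number written in binary. -/
structure KneserInstance {A : Type*} (F : SetFamilySequence A) (m : A → ℕ) where
  α : A
  k : ℕ
  C : Circuit (F.n α) k
  color_mem : ∀ x, binValue (C.eval x) ∈ Finset.Icc 1 (m α)

/-- The problem of finding a monochromatic hyperedge in the `r`-uniform Kneser hypergraph of
`F.fam α`; a solution is given by the characteristic vectors of its `r` sets. -/
def kneserProblem (r : ℕ) {A : Type*} (F : SetFamilySequence A) (m : A → ℕ) : SearchProblem where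
  Inst := KneserInstance F m
  enc I := encPair (F.enc I.α) I.C.enc
  IsSol I w := ∃ B : Fin r → Finset (Fin (F.n I.α)),
    (∀ i, B i ∈ F.fam I.α) ∧
    (∀ i j, i ≠ j → Disjoint (B i) (B j)) ∧
    (∀ i j, binValue (I.C.eval (charVec (B i))) = binValue (I.C.eval (charVec (B j)))) ∧
    w = (List.ofFn fun i => List.ofFn (charVec (B i))).flatten

/-! ### The Tucker problem -/

/-- Signed subsets of an `n`-element set over the cyclic group of order `p`: the entry `some t`
stands for the group element `ω ^ t`, and the entry `none` for `0`. -/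
abbrev SignedSet (p n : ℕ) : Type := Fin n → Option (ZMod p)

/-- The zero vector. -/
def SignedSet.zero (p n : ℕ) : SignedSet p n := fun _ => none

/-- The product `ω ^ t • X`. -/
def SignedSet.rotate {p n : ℕ} (t : ZMod p) (X : SignedSet p n) : SignedSet p n :=
  fun j => (X j).map (t + ·)

/-- The relation `X ≼ Y`. -/
def SignedSet.Below {p n : ℕ} (X Y : SignedSet p n) : Prop := ∀ j, X j ≠ none → X j = Y j

/-- `p` bits representing an element of the group with a zero adjoined: the bit number `t` is `1` for
`ω ^ t`, and all bits are `0` for `0`. -/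
def signBits {p : ℕ} (a : Option (ZMod p)) : Fin p → Bool :=
  fun t => decide (a = some ((t : ℕ) : ZMod p))

/-- A signed set as a string of `n * p` bits, `p` consecutive bits for each entry. -/
def SignedSet.bits {p n : ℕ} (X : SignedSet p n) : Fin (n * p) → Bool :=
  fun i => signBits (X (finProdFinEquiv.symm i).1) (finProdFinEquiv.symm i).2

/-- On input `X` the circuit `C` returns the pair `(ω ^ a, ℓ)`: the first `p` output bits represent
the sign, the others are the binary digits of the absolute value. -/
def Labels {p n k : ℕ} (C : Circuit (n * p) (p + k)) (X : SignedSet p n) (y : ZMod p × ℕ) : Prop :=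
  (∀ t : Fin p, C.eval X.bits (Fin.castAdd k t) = signBits (some y.1) t) ∧
    binValue (fun i : Fin k => C.eval X.bits (Fin.natAdd p i)) = y.2

/-- An instance of the Tucker problem: `n`, `s`, and a circuit that represents an equivariant map
from the nonzero signed sets to `Z_p × {1, …, s}`. -/
structure TuckerInstance (p : ℕ) where
  n : ℕ
  s : ℕ
  s_le : (s : ℤ) ≤ ((n : ℤ) - 1) / ((p : ℤ) - 1)
  k : ℕ
  C : Circuit (n * p) (p + k)
  equivariant : ∃ lam : SignedSet p n → ZMod p × ℕ,
    ∀ X, X ≠ SignedSet.zero p n →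
      Labels C X (lam X) ∧ (lam X).2 ∈ Finset.Icc 1 s ∧
      ∀ t : ZMod p, lam (X.rotate t) = (t + (lam X).1, (lam X).2)

/-- The Tucker problem over the cyclic group of order `p`; a solution is given by the bits of the
`p` signed sets of the chain. -/
def tuckerProblem (p : ℕ) : SearchProblem where
  Inst := TuckerInstance p
  enc I := encNat I.n ++ encNat I.s ++ I.C.enc
  IsSol I w := ∃ (X : Fin p → SignedSet p I.n) (π : Fin p ≃ ZMod p) (ℓ : ℕ),
    (∀ i, X i ≠ SignedSet.zero p I.n) ∧
    (∀ i j, i ≤ j → (X i).Below (X j)) ∧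
    ℓ ∈ Finset.Icc 1 I.s ∧
    (∀ i, Labels I.C (X i) (π i, ℓ)) ∧
    w = (List.ofFn fun i => List.ofFn (X i).bits).flatten

end KneserTucker

open Turing

namespace KneserTucker

/-! ### A structured stack language -/

/-! Let `n` be the size of the ground set, `m = ⌊(cd_p - 1)/(p - 1)⌋`, and let `φ` be the function
computed by the circuit `C₂`, which picks a member of the family inside a given set, or the empty
set if there is none. A signed set `X` splits its non-zero positions into one class per sign, and
`φ` is applied to the part of each class that lies in the ground set. If some sign yields a member,
the leading sign is that of the first entry of `X` whose sign does so, and `X` is labelled by this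
sign and the color of its member. If no sign yields a member, `X` is labelled by the sign of its
first non-zero entry and by `⌈z/(p - 1)⌉`, where `z` is the number of zero entries. Rotation only
permutes the classes, so the labelling is equivariant.

In the second case, coloring the non-zero positions by their signs makes no member monochromatic, so
`z ≥ cd_p > m(p - 1)` and the absolute value exceeds `m` (`IsSelector.defect_le`, `lt_absLabel`).
Thus the two cases use disjoint sets of absolute values. Consider a chain of `p` signed sets with
distinct signs and a common absolute value `ℓ`. If `ℓ > m`, their numbers of zeros lie among `p - 1`
consecutive integers, so two of them agree; comparable signed sets with equally many zeros are
equal, which contradicts the distinct signs (`hasPart_of_chain`). Hence `ℓ ≤ m`, and each signed set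
of the chain supplies a member of color `ℓ`. All these members survive in the top signed set, with
distinct signs, and so are disjoint (`exists_sets_of_chain`).

The signed sets have length `N = (p - 1)n + 1`; the positions beyond `n` belong to no member. A
non-zero signed set has `z ≤ (p - 1)n`, so absolute values are at most `n = (N - 1)/(p - 1)`,
exactly the range allowed in the Tucker problem.

What remains is effectiveness. The labelling is computed by an explicit list of gates, built from
blocks whose specifications are equations between wire values (`holds_reductionGates`). That this
list can be written down in polynomial time is proved in a small stack language: `PT` is closed
under composition, pairing, case distinction and size-bounded folds, so that `fun_prop` can handle
most functions, and `exists_machine` wraps such functions around one call of the given machine that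
outputs `C₂`. The same call lets the second algorithm recompute the selected members from a chain.
-/

/-- Binary trees, the universal data type of the stack language. -/
inductive DTree where
  | leaf
  | node (x y : DTree)

/-- Preorder serialization. -/
def DTree.ser : DTree → List (Option Bool)
  | .leaf => [some false]
  | .node x y => some true :: (x.ser ++ y.ser)

def DTree.size (x : DTree) : ℕ := x.ser.length

@[simp] theorem DTree.size_leaf : DTree.leaf.size = 1 := rfl

@[simp] theorem DTree.size_node (x y : DTree) : (DTree.node x y).size = x.size + y.size + 1 := by
  simp [DTree.size, DTree.ser]

/-- The four stacks of the language. -/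
inductive Stk | a | b | c | d

instance : DecidableEq Stk := fun x y => by
  cases x <;> cases y <;> first | exact isTrue rfl | exact isFalse (by simp)

instance : Fintype Stk := ⟨{.a, .b, .c, .d}, fun x => by cases x <;> decide⟩

/-- A memory state: four stacks and a register. -/
structure Mem where
  a : List (Option Bool)
  b : List (Option Bool)
  c : List (Option Bool)
  d : List (Option Bool)
  r : Option Bool

def Mem.get (s : Mem) : Stk → List (Option Bool)
  | .a => s.a
  | .b => s.b
  | .c => s.c
  | .d => s.d

def Mem.set (s : Mem) (l : List (Option Bool)) : Stk → Mem
  | .a => { s with a := l }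
  | .b => { s with b := l }
  | .c => { s with c := l }
  | .d => { s with d := l }

/-- Remove the top symbol of a stack and store it in the register. -/
def Mem.pop (s : Mem) (k : Stk) : Mem :=
  { s.set (s.get k).tail k with r := (s.get k).head?.join }

/-- A conditional tests whether the register is `some true`. A loop pops its stack before each pass
and stops when the register becomes `none`, which happens both at a marker `none` and on an empty
stack; markers therefore delimit the trees parked on the side stacks. -/
inductive Cmd where
  | push (k : Stk) (x : Option Bool)
  | pushReg (k : Stk)
  | pop (k : Stk)
  | skip
  | seq (x y : Cmd)
  | ite (x y : Cmd)
  | loop (k : Stk) (x : Cmd)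

/-- Execution of a command, with the number of steps. -/
inductive Run : Cmd → Mem → Mem → ℕ → Prop
  | push (k x s) : Run (.push k x) s (s.set (x :: s.get k) k) 1
  | pushReg (k s) : Run (.pushReg k) s (s.set (s.r :: s.get k) k) 1
  | pop (k s) : Run (.pop k) s (s.pop k) 1
  | skip (s) : Run .skip s s 1
  | seq {x y s s' s'' t t'} (h : Run x s s' t) (h' : Run y s' s'' t') :
      Run (.seq x y) s s'' (t + t')
  | iteTrue {x y s s' t} (hr : s.r = some true) (h : Run x s s' t) : Run (.ite x y) s s' (1 + t)
  | iteFalse {x y s s' t} (hr : s.r ≠ some true) (h : Run y s s' t) : Run (.ite x y) s s' (1 + t)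
  | loopExit {k x s} (hr : (s.pop k).r = none) : Run (.loop k x) s (s.pop k) 1
  | loopStep {k x s s' s'' t t'} (hr : (s.pop k).r ≠ none) (h : Run x (s.pop k) s' t)
      (h' : Run (.loop k x) s' s'' t') : Run (.loop k x) s s'' (1 + t + t')

/-- Program points of a command. -/
def Cmd.Lab : Cmd → Type
  | .push _ _ => Unit
  | .pushReg _ => Unit
  | .pop _ => Unit
  | .skip => Unit
  | .seq x y => x.Lab ⊕ y.Lab
  | .ite x y => Option (x.Lab ⊕ y.Lab)
  | .loop _ x => Option x.Lab

def Cmd.entry : (c : Cmd) → c.Lab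
  | .push _ _ => ()
  | .pushReg _ => ()
  | .pop _ => ()
  | .skip => ()
  | .seq x _ => Sum.inl x.entry
  | .ite _ _ => none
  | .loop _ _ => none

@[reducible]
def Cmd.labFintype : (c : Cmd) → Fintype c.Lab
  | .push _ _ => inferInstanceAs (Fintype Unit)
  | .pushReg _ => inferInstanceAs (Fintype Unit)
  | .pop _ => inferInstanceAs (Fintype Unit)
  | .skip => inferInstanceAs (Fintype Unit)
  | .seq x y => by
      have := x.labFintype; have := y.labFintype
      exact inferInstanceAs (Fintype (x.Lab ⊕ y.Lab))
  | .ite x y => by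
      have := x.labFintype; have := y.labFintype
      exact inferInstanceAs (Fintype (Option (x.Lab ⊕ y.Lab)))
  | .loop _ x => by
      have := x.labFintype
      exact inferInstanceAs (Fintype (Option x.Lab))

instance (c : Cmd) : Fintype c.Lab := c.labFintype

/-! ### Compilation to stack machines -/

/-- Stack alphabets after adding the four stacks of the language. -/
def ExtΓ {K : Type} (Γ : K → Type) : K ⊕ Stk → Type
  | .inl k => Γ k
  | .inr _ => Option Bool

/-- The stacks of the extended machine. -/
def extStk {K : Type} {Γ : K → Type} (S : ∀ k, List (Γ k)) (s : Mem) : ∀ k, List (ExtΓ Γ k)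
  | .inl k => S k
  | .inr k => s.get k

section
variable {K : Type} [DecidableEq K] {Γ : K → Type} {σ Λ : Type}

theorem update_extStk_inl (S : ∀ k, List (Γ k)) (s : Mem) (k : K) (l : List (ExtΓ Γ (.inl k))) :
    Function.update (extStk S s) (.inl k) l = extStk (Function.update S k l) s := by
  funext j
  by_cases h : j = .inl k
  · subst h
    rw [Function.update_self]
    exact (Function.update_self (β := fun k => List (Γ k)) k l S).symm
  · rw [Function.update_of_ne h]
    rcases j with j | j
    · exact (Function.update_of_ne (β := fun k => List (Γ k)) (fun e => h (congrArg Sum.inl e)) l S).symm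
    · rfl

theorem update_extStk_inr (S : ∀ k, List (Γ k)) (s : Mem) (k : Stk) (l : List (ExtΓ Γ (.inr k))) :
    Function.update (extStk S s) (.inr k) l = extStk S (s.set l k) := by
  funext j
  by_cases h : j = .inr k
  · subst h
    rw [Function.update_self]
    cases k <;> rfl
  · rw [Function.update_of_ne h]
    rcases j with j | j
    · rfl
    · cases j <;> cases k <;> first | rfl | exact absurd rfl h

theorem Mem.set_r (s : Mem) (l : List (Option Bool)) (k : Stk) : (s.set l k).r = s.r := by
  cases k <;> rfl

theorem update_extStk_pop (S : ∀ k, List (Γ k)) (s : Mem) (k : Stk) :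
    Function.update (extStk S s) (.inr k) (extStk S s (.inr k)).tail = extStk S (s.pop k) := by
  rw [update_extStk_inr]
  funext j
  rcases j with j | j
  · rfl
  · cases j <;> rfl

/-- Code of a command, with the labels of its program points and the label where it exits. -/
def Cmd.code : (c : Cmd) → (c.Lab → Λ) → Λ → c.Lab → TM2.Stmt (ExtΓ Γ) Λ (σ × Option Bool)
  | .push k x, _, e, _ => .push (.inr k) (fun _ => x) (.goto fun _ => e)
  | .pushReg k, _, e, _ => .push (.inr k) (fun v => v.2) (.goto fun _ => e)
  | .pop k, _, e, _ => .pop (.inr k) (fun v x => (v.1, Option.join x)) (.goto fun _ => e)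
  | .skip, _, e, _ => .goto fun _ => e
  | .seq x y, i, e, l => Sum.rec (x.code (fun l => i (.inl l)) (i (.inr y.entry)))
      (y.code (fun l => i (.inr l)) e) l
  | .ite x y, i, e, l => Option.rec
      (.branch (fun v => v.2 == some true) (.goto fun _ => i (some (.inl x.entry)))
        (.goto fun _ => i (some (.inr y.entry))))
      (fun l => Sum.rec (x.code (fun l => i (some (.inl l))) e)
        (y.code (fun l => i (some (.inr l))) e) l) l
  | .loop k x, i, e, l => Option.rec
      (.pop (.inr k) (fun v x => (v.1, Option.join x))
        (.branch (fun v => v.2.isSome) (.goto fun _ => i (some x.entry)) (.goto fun _ => e)))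
      (x.code (fun l => i (some l)) (i none)) l

/-- `m` leads from `c` to `c'` in `t` steps. -/
def Reach {Γ : K → Type} (m : Λ → TM2.Stmt Γ Λ σ) (c c' : TM2.Cfg Γ Λ σ) (t : ℕ) : Prop :=
  (flip bind (TM2.step m))^[t] (some c) = some c'

theorem Reach.trans {m : Λ → TM2.Stmt Γ Λ σ} {c c' c'' : TM2.Cfg Γ Λ σ} {t t' : ℕ}
    (h : Reach m c c' t) (h' : Reach m c' c'' t') : Reach m c c'' (t + t') := by
  unfold Reach at *
  rw [add_comm, Function.iterate_add_apply, h, h']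

theorem Reach.one {m : Λ → TM2.Stmt Γ Λ σ} {l : Λ} {v : σ} {S : ∀ k, List (Γ k)}
    {c : TM2.Cfg Γ Λ σ} (h : TM2.stepAux (m l) v S = c) : Reach m ⟨some l, v, S⟩ c 1 := by
  subst h; rfl

/-- Every counted step of the language is one machine step, since each program point carries one
statement ending in a jump. The value `v` and the stacks `S` are a frame left untouched. The exit
label must vary in the induction, because the body of a loop exits to the head of the loop. -/
theorem Run.reach {c : Cmd} {s s' : Mem} {t : ℕ} (h : Run c s s' t)
    {m : Λ → TM2.Stmt (ExtΓ Γ) Λ (σ × Option Bool)} (i : c.Lab → Λ) (e : Λ)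
    (hm : ∀ l, m (i l) = c.code i e l) (v : σ) (S : ∀ k, List (Γ k)) :
    Reach m ⟨some (i c.entry), (v, s.r), extStk S s⟩ ⟨some e, (v, s'.r), extStk S s'⟩ t := by
  induction h generalizing e with
  | push k x s =>
    refine Reach.one ?_
    rw [hm]
    simp only [Cmd.code, TM2.stepAux, update_extStk_inr, Mem.set_r]
    rfl
  | pushReg k s =>
    refine Reach.one ?_
    rw [hm]
    simp only [Cmd.code, TM2.stepAux, update_extStk_inr, Mem.set_r]
    rfl
  | pop k s =>
    refine Reach.one ?_
    rw [hm]
    simp only [Cmd.code, TM2.stepAux, update_extStk_pop]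
    rfl
  | skip s =>
    refine Reach.one ?_
    rw [hm]
    rfl
  | seq h h' ih ih' =>
    exact (ih (fun l => i (.inl l)) _ fun l => hm (.inl l)).trans
      (ih' (fun l => i (.inr l)) e fun l => hm (.inr l))
  | iteTrue hr h ih =>
    refine Reach.trans (Reach.one ?_) (ih (fun l => i (some (.inl l))) e fun l => hm (some (.inl l)))
    rw [hm]
    simp only [Cmd.code, Cmd.entry, TM2.stepAux, hr]
    rfl
  | iteFalse hr h ih =>
    refine Reach.trans (Reach.one ?_) (ih (fun l => i (some (.inr l))) e fun l => hm (some (.inr l)))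
    rw [hm]
    simp only [Cmd.code, Cmd.entry, TM2.stepAux, beq_eq_false_iff_ne.mpr hr]
    rfl
  | @loopExit k x s hr =>
    refine Reach.one ?_
    rw [hm]
    have : ((s.get k).head?.join).isSome = false := by
      have : (s.get k).head?.join = none := hr
      rw [this]; rfl
    simp only [Cmd.code, Cmd.entry, TM2.stepAux, update_extStk_pop]
    change cond ((s.get k).head?.join).isSome _ _ = _
    rw [this]
    rfl
  | @loopStep k x s s' s'' t t' hr h h' ih ih' =>
    refine Reach.trans (Reach.trans (Reach.one ?_)
      (ih (fun l => i (some l)) (i none) fun l => hm (some l))) (ih' i e hm)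
    rw [hm]
    have : ((s.get k).head?.join).isSome = true := Option.isSome_iff_ne_none.mpr hr
    simp only [Cmd.code, Cmd.entry, TM2.stepAux, update_extStk_pop]
    change cond ((s.get k).head?.join).isSome _ _ = _
    rw [this]
    rfl

end

end KneserTucker

namespace KneserTucker

/-! ### Running time bounds -/

def RunLe (c : Cmd) (s s' : Mem) (n : ℕ) : Prop := ∃ t ≤ n, Run c s s' t

theorem RunLe.mono {c : Cmd} {s s' : Mem} {n n' : ℕ} (h : RunLe c s s' n) (hn : n ≤ n') :
    RunLe c s s' n' :=
  let ⟨t, ht, hr⟩ := h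
  ⟨t, ht.trans hn, hr⟩

theorem Run.le {c : Cmd} {s s' : Mem} {n : ℕ} (h : Run c s s' n) : RunLe c s s' n := ⟨n, le_rfl, h⟩

theorem RunLe.seq {c c' : Cmd} {s s' s'' : Mem} {n n' : ℕ} (h : RunLe c s s' n)
    (h' : RunLe c' s' s'' n') : RunLe (.seq c c') s s'' (n + n') :=
  let ⟨_, ht, hr⟩ := h
  let ⟨_, ht', hr'⟩ := h'
  ⟨_, add_le_add ht ht', .seq hr hr'⟩

theorem RunLe.iteTrue {c c' : Cmd} {s s' : Mem} {n : ℕ} (hr : s.r = some true)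
    (h : RunLe c s s' n) : RunLe (.ite c c') s s' (1 + n) :=
  let ⟨_, ht, h⟩ := h
  ⟨_, Nat.add_le_add_left ht 1, .iteTrue hr h⟩

theorem RunLe.iteFalse {c c' : Cmd} {s s' : Mem} {n : ℕ} (hr : s.r ≠ some true)
    (h : RunLe c' s s' n) : RunLe (.ite c c') s s' (1 + n) :=
  let ⟨_, ht, h⟩ := h
  ⟨_, Nat.add_le_add_left ht 1, .iteFalse hr h⟩

theorem RunLe.loopStep {k : Stk} {c : Cmd} {s s₁ s' s'' : Mem} {n n' : ℕ} (he : s.pop k = s₁)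
    (hr : s₁.r ≠ none) (h : RunLe c s₁ s' n) (h' : RunLe (.loop k c) s' s'' n') :
    RunLe (.loop k c) s s'' (1 + n + n') := by
  subst he
  obtain ⟨_, ht, h⟩ := h
  obtain ⟨_, ht', h'⟩ := h'
  exact ⟨_, add_le_add (Nat.add_le_add_left ht 1) ht', .loopStep hr h h'⟩

/-! ### Moving trees between stacks -/

theorem DTree.ne_none_of_mem_ser {x : DTree} : ∀ e ∈ x.ser, e ≠ none := by
  induction x with
  | leaf => simp [ser]
  | node x y hx hy =>
    intro e he
    simp only [ser, List.mem_cons, List.mem_append] at he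
    rcases he with rfl | he | he
    · simp
    · exact hx e he
    · exact hy e he

/-- One of the two stacks that hold moved trees. -/
def Stk.side (β : Bool) : Stk := bif β then .b else .c

/-- A memory state in which the side stack `β` holds `l` and the other one `o`. -/
def Mem.side (β : Bool) (a l o d : List (Option Bool)) (r : Option Bool) : Mem :=
  bif β then ⟨a, l, o, d, r⟩ else ⟨a, o, l, d, r⟩

/-- Repeatedly move one symbol of the main stack to a side stack, counting unread subtrees. -/
def Cmd.unloadLoop (β : Bool) : Cmd :=
  .loop .d (.seq (.pop .a) (.seq (.pushReg (.side β))
    (.ite (.seq (.push .d (some true)) (.push .d (some true))) .skip)))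

/-- Move a tree from the main stack to a side stack, on top of a marker. -/
def Cmd.unload (β : Bool) : Cmd :=
  .seq (.push (.side β) none) (.seq (.push .d (some true)) (.unloadLoop β))

/-- Stack `d` counts in unary the subtrees still to be read: a leaf symbol uses up one, a node
symbol replaces one by two. The rest of the run is a hypothesis, so that the loop can be continued
through both subtrees by induction. One pass takes at most six steps. -/
theorem runLe_unloadLoop (β : Bool) (x : DTree) {s : Mem} {n : ℕ} {a l o d : List (Option Bool)}
    (r : Option Bool)
    (h : RunLe (.unloadLoop β) (.side β a (x.ser.reverse ++ l) o d (some false)) s n) :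
    RunLe (.unloadLoop β) (.side β (x.ser ++ a) l o (some true :: d) r) s (6 * x.size + n) := by
  induction x generalizing a l d n r with
  | leaf =>
    refine (RunLe.loopStep (s₁ := .side β (DTree.leaf.ser ++ a) l o d (some true)) ?_ ?_
      (RunLe.seq (n := 1) (s' := .side β a l o d (some false)) ?_ (RunLe.seq (n := 1)
        (s' := .side β a (some false :: l) o d (some false)) ?_
        (RunLe.iteFalse ?_ (Run.skip _).le))) h).mono (n' := 6 * DTree.leaf.size + n) ?_
    any_goals cases β
    any_goals first | rfl | exact (Run.pop _ _).le | exact (Run.pushReg _ _).le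
    all_goals simp [Mem.side]
  | node x y hx hy =>
    have h1 := hy (a := a) (l := x.ser.reverse ++ some true :: l) (d := d) (some false)
      (by simpa [DTree.ser] using h)
    have h2 := hx (a := y.ser ++ a) (d := some true :: d) (some true) h1
    refine (RunLe.loopStep (s₁ := .side β ((DTree.node x y).ser ++ a) l o d (some true)) ?_ ?_
      (RunLe.seq (n := 1) (s' := .side β (x.ser ++ (y.ser ++ a)) l o d (some true)) ?_ (RunLe.seq
        (n := 1)
        (s' := .side β (x.ser ++ (y.ser ++ a)) (some true :: l) o d (some true)) ?_
        (RunLe.iteTrue ?_ ((Run.push _ _ _).le.seq (Run.push _ _ _).le))))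
      (by cases β <;> exact h2)).mono ?_
    any_goals cases β
    any_goals first | rfl | exact (Run.pushReg _ _).le
    any_goals simp only [DTree.size_node]; omega
    any_goals simp [Mem.side]
    all_goals
      rw [DTree.ser, List.cons_append, List.append_assoc]
      exact (Run.pop _ _).le

theorem runLe_unload (β : Bool) (x : DTree) (a l o : List (Option Bool)) (r : Option Bool) :
    RunLe (.unload β) (.side β (x.ser ++ a) l o [] r)
      (.side β a (x.ser.reverse ++ none :: l) o [] none) (6 * x.size + 3) := by
  refine (RunLe.seq (n := 1) (s' := .side β (x.ser ++ a) (none :: l) o [] r) ?_ (RunLe.seq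
    (n := 1) (s' := .side β (x.ser ++ a) (none :: l) o [some true] r) ?_
    (runLe_unloadLoop β x r (n := 1) ?_))).mono (n' := 6 * x.size + 3) ?_
  any_goals cases β
  any_goals first | exact (Run.push _ _ _).le | exact (Run.loopExit rfl).le
  all_goals omega

/-- Move the topmost tree of a side stack back. -/
def Cmd.load (β : Bool) : Cmd := .loop (.side β) (.pushReg .a)

theorem runLe_load_of_ne_none (β : Bool) (m : List (Option Bool)) (hm : ∀ e ∈ m, e ≠ none)
    (a l o d : List (Option Bool)) (r : Option Bool) :
    RunLe (.load β) (.side β a (m ++ none :: l) o d r) (.side β (m.reverse ++ a) l o d none)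
      (2 * m.length + 1) := by
  induction m generalizing a r with
  | nil => cases β <;> exact (Run.loopExit rfl).le
  | cons e m ih =>
    have := ih (fun e he => hm e (List.mem_cons_of_mem _ he)) (e :: a) e
    have hs := RunLe.loopStep (s := .side β a (e :: (m ++ none :: l)) o d r)
      (s₁ := .side β a (m ++ none :: l) o d e) (by cases β <;> rfl)
      (by cases β <;> exact hm e List.mem_cons_self)
      (s' := .side β (e :: a) (m ++ none :: l) o d e) (n := 1)
      (by cases β <;> exact (Run.pushReg _ _).le) this
    rw [List.reverse_cons, List.append_assoc]
    exact hs.mono (by rw [List.length_cons]; omega)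

theorem runLe_load (β : Bool) (x : DTree) (a l o d : List (Option Bool)) (r : Option Bool) :
    RunLe (.load β) (.side β a (x.ser.reverse ++ none :: l) o d r) (.side β (x.ser ++ a) l o d none)
      (2 * x.size + 1) := by
  have := runLe_load_of_ne_none β x.ser.reverse
    (fun e he => x.ne_none_of_mem_ser e (List.mem_reverse.mp he)) a l o d r
  simpa [DTree.size] using this

/-- A command that turns the contents of the main stack into `l'`, the other stacks being empty. -/
def RunA (c : Cmd) (l l' : List (Option Bool)) (n : ℕ) : Prop :=
  ∀ r, ∃ r', RunLe c ⟨l, [], [], [], r⟩ ⟨l', [], [], [], r'⟩ n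

theorem RunA.mono {c : Cmd} {l l' : List (Option Bool)} {n n' : ℕ} (h : RunA c l l' n)
    (hn : n ≤ n') : RunA c l l' n' := fun r =>
  let ⟨r', h⟩ := h r
  ⟨r', h.mono hn⟩

theorem RunA.seq {c c' : Cmd} {l l' l'' : List (Option Bool)} {n n' : ℕ} (h : RunA c l l' n)
    (h' : RunA c' l' l'' n') : RunA (.seq c c') l l'' (n + n') := fun r =>
  let ⟨r', h⟩ := h r
  let ⟨r'', h'⟩ := h' r'
  ⟨r'', h.seq h'⟩

theorem RunA.push (e : Option Bool) (l : List (Option Bool)) : RunA (.push .a e) l (e :: l) 1 :=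
  fun r => ⟨r, (Run.push _ _ _).le⟩

theorem RunA.pop (e : Option Bool) (l : List (Option Bool)) : RunA (.pop .a) (e :: l) l 1 :=
  fun _ => ⟨_, (Run.pop _ _).le⟩

theorem RunA.skip (l : List (Option Bool)) : RunA .skip l l 1 := fun r => ⟨r, (Run.skip _).le⟩

/-- Exchange the two topmost trees. -/
def Cmd.swap : Cmd := .seq (.unload true) (.seq (.unload false) (.seq (.load true) (.load false)))

theorem runA_swap (x y : DTree) (l : List (Option Bool)) :
    RunA .swap (x.ser ++ (y.ser ++ l)) (y.ser ++ (x.ser ++ l)) (8 * x.size + 8 * y.size + 8) := by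
  intro r
  have h1 := runLe_unload true x (y.ser ++ l) [] [] r
  have h2 := runLe_unload false y l [] (x.ser.reverse ++ [none]) none
  have h3 := runLe_load true x l [] (y.ser.reverse ++ [none]) [] none
  have h4 := runLe_load false y (x.ser ++ l) [] [] [] none
  exact ⟨_, (h1.seq (h2.seq (h3.seq h4))).mono (by omega)⟩

/-- Delete the topmost tree. -/
def Cmd.drop : Cmd := .seq (.unload true) (.loop .b .skip)

theorem runA_drop (x : DTree) (l : List (Option Bool)) :
    RunA .drop (x.ser ++ l) l (8 * x.size + 4) := by
  intro r
  have h1 := runLe_unload true x l [] [] r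
  have h2 : ∀ (m : List (Option Bool)) (_ : ∀ e ∈ m, e ≠ none) (r : Option Bool),
      RunLe (.loop .b .skip) ⟨l, m ++ [none], [], [], r⟩ ⟨l, [], [], [], none⟩
        (2 * m.length + 1) := by
    intro m
    induction m with
    | nil => exact fun _ r => (Run.loopExit rfl).le
    | cons e m ih =>
      intro hm r
      refine (RunLe.loopStep (s₁ := ⟨l, m ++ [none], [], [], e⟩) rfl
        (hm e List.mem_cons_self) (Run.skip _).le
        (ih (fun e he => hm e (List.mem_cons_of_mem _ he)) e)).mono ?_
      simp only [List.length_cons]; omega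
  have h3 := h2 x.ser.reverse (fun e he => x.ne_none_of_mem_ser e (List.mem_reverse.mp he)) none
  rw [List.length_reverse] at h3
  exact ⟨_, (h1.seq h3).mono (by unfold DTree.size; omega)⟩

/-- Duplicate the topmost tree. -/
def Cmd.dup : Cmd :=
  .seq (.unload true) (.seq (.seq (.push .c none) (.loop .b (.seq (.pushReg .a) (.pushReg .c))))
    (.seq (.seq (.push .b none) (.loop .c (.pushReg .b))) (.load true)))

/-- Emptying the reversed tree from `b` onto both `a` and `c` restores its order on each; pouring
`c` back to `b` reverses it once more, which is the form that `load` expects. -/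
theorem runA_dup (x : DTree) (l : List (Option Bool)) :
    RunA .dup (x.ser ++ l) (x.ser ++ (x.ser ++ l)) (14 * x.size + 9) := by
  intro r
  have h1 := runLe_unload true x l [] [] r
  have h2 : ∀ (m : List (Option Bool)) (_ : ∀ e ∈ m, e ≠ none) (a c : List (Option Bool))
      (r : Option Bool),
      RunLe (.loop .b (.seq (.pushReg .a) (.pushReg .c))) ⟨a, m ++ [none], c, [], r⟩
        ⟨m.reverse ++ a, [], m.reverse ++ c, [], none⟩ (3 * m.length + 1) := by
    intro m
    induction m with
    | nil => exact fun _ a c r => (Run.loopExit rfl).le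
    | cons e m ih =>
      intro hm a c r
      have hs := RunLe.loopStep (s := ⟨a, e :: (m ++ [none]), c, [], r⟩)
        (s₁ := ⟨a, m ++ [none], c, [], e⟩) rfl
        (hm e List.mem_cons_self) ((Run.pushReg _ _).le.seq (Run.pushReg _ _).le)
        (ih (fun e he => hm e (List.mem_cons_of_mem _ he)) (e :: a) (e :: c) e)
      rw [List.reverse_cons, List.append_assoc, List.append_assoc]
      exact hs.mono (by rw [List.length_cons]; omega)
  have h3 : ∀ (m : List (Option Bool)) (_ : ∀ e ∈ m, e ≠ none) (a b : List (Option Bool))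
      (r : Option Bool),
      RunLe (.loop .c (.pushReg .b)) ⟨a, b, m ++ [none], [], r⟩
        ⟨a, m.reverse ++ b, [], [], none⟩ (2 * m.length + 1) := by
    intro m
    induction m with
    | nil => exact fun _ a c r => (Run.loopExit rfl).le
    | cons e m ih =>
      intro hm a b r
      have hs := RunLe.loopStep (s := ⟨a, b, e :: (m ++ [none]), [], r⟩)
        (s₁ := ⟨a, b, m ++ [none], [], e⟩) rfl
        (hm e List.mem_cons_self) (Run.pushReg _ _).le
        (ih (fun e he => hm e (List.mem_cons_of_mem _ he)) a (e :: b) e)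
      rw [List.reverse_cons, List.append_assoc]
      exact hs.mono (by rw [List.length_cons]; omega)
  have h2' := h2 x.ser.reverse (fun e he => x.ne_none_of_mem_ser e (List.mem_reverse.mp he)) l
    [none] none
  have h3' := h3 x.ser x.ne_none_of_mem_ser (x.ser ++ l) [none] none
  have h4 := runLe_load true x (x.ser ++ l) [] [] [] none
  rw [List.length_reverse, List.reverse_reverse] at h2'
  exact ⟨_, (h1.seq (((Run.push _ _ _).le.seq h2').seq
    (((Run.push _ _ _).le.seq h3').seq h4))).mono (by unfold DTree.size; omega)⟩

end KneserTucker

namespace KneserTucker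

/-! ### Polynomial-time functions between encoded types -/

theorem eval_mono (q : Polynomial ℕ) {m n : ℕ} (h : m ≤ n) : q.eval m ≤ q.eval n := by
  induction q using Polynomial.induction_on' with
  | add p q hp hq => simpa using add_le_add hp hq
  | monomial k a => simpa using Nat.mul_le_mul_left a (Nat.pow_le_pow_left h k)

/-- Types whose elements are encoded by trees. -/
class Code (α : Type) where
  enc : α → DTree

open Code

def csize {α : Type} [Code α] (a : α) : ℕ := (enc a).size

instance : Code Unit := ⟨fun _ => .leaf⟩

instance : Code Bool := ⟨fun b => bif b then .node .leaf .leaf else .leaf⟩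

instance {α β : Type} [Code α] [Code β] : Code (α × β) := ⟨fun x => .node (enc x.1) (enc x.2)⟩

def encList {α : Type} [Code α] : List α → DTree
  | [] => .leaf
  | x :: l => .node (enc x) (encList l)

instance {α : Type} [Code α] : Code (List α) := ⟨encList⟩

def encNatTree : ℕ → DTree
  | 0 => .leaf
  | n + 1 => .node .leaf (encNatTree n)

instance : Code ℕ := ⟨encNatTree⟩

section
variable {α β γ δ : Type} [Code α] [Code β] [Code γ] [Code δ]

theorem csize_pos (a : α) : 1 ≤ csize a := by
  unfold csize; cases enc a <;> simp

theorem csize_prod (x : α × β) : csize x = csize x.1 + csize x.2 + 1 := DTree.size_node _ _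

theorem csize_pair (a : α) (b : β) : csize (a, b) = csize a + csize b + 1 := csize_prod (a, b)

theorem csize_nil : csize ([] : List α) = 1 := rfl

theorem csize_cons (a : α) (l : List α) : csize (a :: l) = csize a + csize l + 1 :=
  DTree.size_node _ _

theorem csize_nat (n : ℕ) : csize n = 2 * n + 1 := by
  induction n with
  | zero => rfl
  | succ n ih =>
    change (DTree.node .leaf (encNatTree n)).size = _
    rw [DTree.size_node]
    change 1 + csize n + 1 = _
    omega

theorem csize_bool (b : Bool) : csize b ≤ 3 := by cases b <;> decide

theorem csize_append (l l' : List α) : csize (l ++ l') + 1 = csize l + csize l' := by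
  induction l with
  | nil => rw [List.nil_append, csize_nil, add_comm]
  | cons a l ih => rw [List.cons_append, csize_cons, csize_cons]; omega

theorem csize_drop_le (l : List α) (k : ℕ) : csize (l.drop k) ≤ csize l := by
  have := csize_append (l.take k) (l.drop k)
  rw [List.take_append_drop] at this
  have := csize_pos (l.take k)
  omega

theorem csize_take_le (l : List α) (k : ℕ) : csize (l.take k) ≤ csize l := by
  have := csize_append (l.take k) (l.drop k)
  rw [List.take_append_drop] at this
  have := csize_pos (l.drop k)
  omega

theorem csize_reverse (l : List α) : csize l.reverse = csize l := by
  induction l with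
  | nil => rfl
  | cons a l ih =>
    have := csize_append l.reverse [a]
    rw [csize_cons, csize_nil] at this
    rw [List.reverse_cons, csize_cons]
    omega

theorem csize_le_of_mem {l : List α} {a : α} (h : a ∈ l) : csize a ≤ csize l := by
  induction l with
  | nil => cases h
  | cons b l ih =>
    rw [csize_cons]
    rcases List.mem_cons.mp h with rfl | h
    · omega
    · have := ih h; omega

theorem length_le_csize (l : List α) : l.length + 1 ≤ csize l := by
  induction l with
  | nil => rfl
  | cons a l ih => rw [csize_cons, List.length_cons]; omega

/-- `f` is computed by a command that rewrites the topmost tree of the main stack in polynomial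
time. -/
@[fun_prop]
def PT (f : α → β) : Prop :=
  ∃ (c : Cmd) (q : Polynomial ℕ), ∀ a l,
    RunA c ((enc a).ser ++ l) ((enc (f a)).ser ++ l) (q.eval (csize a))

theorem Run.length_le {c : Cmd} {s s' : Mem} {t : ℕ} (h : Run c s s' t) :
    s'.a.length ≤ s.a.length + t := by
  induction h with
  | push k x s => cases k <;> simp [Mem.set, Mem.get]
  | pushReg k s => cases k <;> simp [Mem.set, Mem.get]
  | pop k s => cases k <;> simp [Mem.pop, Mem.set, Mem.get]; omega
  | skip s => omega
  | seq h h' ih ih' => omega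
  | iteTrue hr h ih => omega
  | iteFalse hr h ih => omega
  | @loopExit k x s hr => cases k <;> simp [Mem.pop, Mem.set, Mem.get]; omega
  | @loopStep k x s s' s'' t t' hr h h' ih ih' =>
    have : (s.pop k).a.length ≤ s.a.length := by
      cases k <;> simp [Mem.pop, Mem.set, Mem.get]
    omega

/-- A step adds at most one symbol to the main stack, so a time bound is also a bound on the size of
the result. This is what makes polynomial time closed under composition. -/
theorem PT.size_le {f : α → β} (hf : PT f) :
    ∃ q : Polynomial ℕ, ∀ a, csize (f a) ≤ q.eval (csize a) := by
  obtain ⟨c, q, h⟩ := hf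
  refine ⟨q + Polynomial.X, fun a => ?_⟩
  obtain ⟨_, t, ht, hr⟩ := h a [] none
  have := hr.length_le
  simp only [List.append_nil] at this
  rw [Polynomial.eval_add, Polynomial.eval_X]
  change csize (f a) ≤ csize a + t at this
  omega

/-- Only the tree of a value matters, so a value may be retyped at no cost: a pair as a non-empty
list, a list of units as a number. -/
theorem PT.of_enc_eq {f : α → β} {g : α → γ} (hg : PT g) (h : ∀ a, enc (f a) = enc (g a)) :
    PT f := by
  obtain ⟨c, q, hc⟩ := hg
  exact ⟨c, q, fun a l => by rw [h]; exact hc a l⟩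

@[fun_prop]
theorem PT.id' : PT fun a : α => a := ⟨.skip, 1, fun a l => by simpa using RunA.skip _⟩

theorem PT.comp {g : β → γ} {f : α → β} (hg : PT g) (hf : PT f) : PT fun a => g (f a) := by
  obtain ⟨r, hr⟩ := hf.size_le
  obtain ⟨c, q, hc⟩ := hf
  obtain ⟨c', q', hc'⟩ := hg
  refine ⟨.seq c c', q + q'.comp r, fun a l => ((hc a l).seq (hc' (f a) l)).mono ?_⟩
  rw [Polynomial.eval_add, Polynomial.eval_comp]
  exact Nat.add_le_add_left (eval_mono q' (hr a)) _

theorem runA_pushList (m : List (Option Bool)) : ∃ (c : Cmd) (n : ℕ), ∀ l, RunA c l (m ++ l) n := by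
  induction m with
  | nil => exact ⟨.skip, 1, RunA.skip⟩
  | cons e m ih =>
    obtain ⟨c, n, h⟩ := ih
    exact ⟨.seq c (.push .a e), n + 1, fun l => (h l).seq (RunA.push _ _)⟩

@[fun_prop]
theorem PT.const (b : β) : PT fun _ : α => b := by
  obtain ⟨c, n, h⟩ := runA_pushList (enc b).ser
  refine ⟨.seq .drop c, 8 * Polynomial.X + 4 + Polynomial.C n, fun a l =>
    ((runA_drop _ _).seq (h l)).mono ?_⟩
  simp [csize]

@[fun_prop]
theorem PT.pair {f : α → β} {g : α → γ} (hf : PT f) (hg : PT g) : PT fun a => (f a, g a) := by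
  obtain ⟨r, hr⟩ := hg.size_le
  obtain ⟨c, q, hc⟩ := hf
  obtain ⟨c', q', hc'⟩ := hg
  refine ⟨.seq .dup (.seq c' (.seq .swap (.seq c (.push .a (some true))))),
    14 * Polynomial.X + 9 + (q' + ((8 * r + 8 * Polynomial.X + 8) + (q + 1))), fun a l => ?_⟩
  have h1 := runA_dup (enc a) l
  have h2 := hc' a ((enc a).ser ++ l)
  have h3 := runA_swap (enc (g a)) (enc a) l
  have h4 := hc a ((enc (g a)).ser ++ l)
  have h5 := RunA.push (some true) ((enc (f a)).ser ++ ((enc (g a)).ser ++ l))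
  have := (h1.seq (h2.seq (h3.seq (h4.seq h5)))).mono
    (n' := Polynomial.eval (csize a)
      (14 * Polynomial.X + 9 + (q' + ((8 * r + 8 * Polynomial.X + 8) + (q + 1))))) (by
    simp only [Polynomial.eval_add, Polynomial.eval_mul, Polynomial.eval_X, Polynomial.eval_ofNat,
      Polynomial.eval_one]
    have := hr a
    simp only [csize] at this ⊢
    omega)
  simpa [enc, DTree.ser] using this

@[fun_prop]
theorem PT.snd : PT fun x : α × β => x.2 := by
  refine ⟨.seq (.pop .a) .drop, 8 * Polynomial.X + 5, fun x l => ?_⟩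
  have h1 := RunA.pop (some true) ((enc x.1).ser ++ ((enc x.2).ser ++ l))
  have h2 := runA_drop (enc x.1) ((enc x.2).ser ++ l)
  have := (h1.seq h2).mono (n' := Polynomial.eval (csize x) (8 * Polynomial.X + 5)) (by
    simp [csize_prod]; simp [csize]; omega)
  simpa [enc, DTree.ser] using this

@[fun_prop]
theorem PT.fst : PT fun x : α × β => x.1 := by
  refine ⟨.seq (.pop .a) (.seq .swap .drop), 32 * Polynomial.X + 20, fun x l => ?_⟩
  have h1 := RunA.pop (some true) ((enc x.1).ser ++ ((enc x.2).ser ++ l))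
  have h2 := runA_swap (enc x.1) (enc x.2) l
  have h3 := runA_drop (enc x.2) ((enc x.1).ser ++ l)
  have := (h1.seq (h2.seq h3)).mono (n' := Polynomial.eval (csize x) (32 * Polynomial.X + 20)) (by
    simp [csize_prod]; simp [csize]; omega)
  simpa [enc, DTree.ser] using this

@[fun_prop]
theorem PT.fst' {f : α → β × γ} (hf : PT f) : PT fun a => (f a).1 := PT.fst.comp hf

@[fun_prop]
theorem PT.snd' {f : α → β × γ} (hf : PT f) : PT fun a => (f a).2 := PT.snd.comp hf

theorem DTree.ser_eq_cons (x : DTree) : ∃ (b : Bool) (l : List (Option Bool)),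
    x.ser = some b :: l ∧ (b = true ↔ x ≠ .leaf) ∧ (x = .leaf → l = []) := by
  cases x with
  | leaf => exact ⟨false, [], rfl, by simp, by simp⟩
  | node x y => exact ⟨true, _, rfl, by simp, by simp⟩

/-- Case distinction on the shape of an encoded value. -/
theorem PT.branch {f : α → β} {g k : α → γ} {h : α × δ → γ} (hf : PT f) (hg : PT g) (hh : PT h)
    (hleaf : ∀ a, enc (f a) = .leaf → k a = g a)
    (hnode : ∀ a, enc (f a) ≠ .leaf → ∃ d : δ, enc d = enc (f a) ∧ k a = h (a, d)) : PT k := by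
  obtain ⟨c₀, q₀, hc₀⟩ := hf.pair PT.id'
  obtain ⟨r, hr⟩ := hf.size_le
  obtain ⟨c, q, hc⟩ := hg
  obtain ⟨c', q', hc'⟩ := hh
  refine ⟨.seq c₀ (.seq (.pop .a) (.seq (.pop .a) (.ite
      (.seq (.push .a (some true)) (.seq .swap (.seq (.push .a (some true)) c'))) c))),
    q₀ + (1 + (1 + (1 + ((1 + ((8 * r + 8 * Polynomial.X + 8) +
      (1 + q'.comp (Polynomial.X + r + 1)))) + q)))), fun a l => ?_⟩
  simp only [Polynomial.eval_add, Polynomial.eval_mul, Polynomial.eval_X, Polynomial.eval_ofNat,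
      Polynomial.eval_one, Polynomial.eval_comp]
  intro r₀
  obtain ⟨r₁, h₁⟩ := hc₀ a l r₀
  obtain ⟨b, m, hm, hb, hm'⟩ := (enc (f a)).ser_eq_cons
  have e1 : (enc (f a, a)).ser ++ l = some true :: some b :: (m ++ ((enc a).ser ++ l)) := by
    simp [enc, DTree.ser, hm]
  rw [e1] at h₁
  have h₂ : RunLe (.pop .a) ⟨some true :: some b :: (m ++ ((enc a).ser ++ l)), [], [], [], r₁⟩
    ⟨some b :: (m ++ ((enc a).ser ++ l)), [], [], [], some true⟩ 1 := (Run.pop _ _).le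
  have h₃ : RunLe (.pop .a) ⟨some b :: (m ++ ((enc a).ser ++ l)), [], [], [], some true⟩
    ⟨m ++ ((enc a).ser ++ l), [], [], [], some b⟩ 1 := (Run.pop _ _).le
  cases b with
  | false =>
    have hl : enc (f a) = .leaf := by
      by_contra hne; exact absurd (hb.mpr hne) (by simp)
    rw [hm' hl] at h₁ h₂ h₃
    obtain ⟨r₂, h₄⟩ := hc a l (some false)
    refine ⟨r₂, (h₁.seq (h₂.seq (h₃.seq (RunLe.iteFalse (by simp)
      (by rw [hleaf a hl]; exact h₄))))).mono (by omega)⟩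
  | true =>
    obtain ⟨d, hd, hk⟩ := hnode a (hb.mp rfl)
    have h₄ := RunA.push (some true) (m ++ ((enc a).ser ++ l))
    have h₅ := runA_swap (enc (f a)) (enc a) l
    rw [hm] at h₅
    have h₆ := RunA.push (some true) ((enc a).ser ++ ((enc (f a)).ser ++ l))
    rw [hm] at h₆
    have h₇ := hc' (a, d) l
    have e2 : (enc (a, d)).ser ++ l =
        some true :: ((enc a).ser ++ ((some true :: m) ++ l)) := by
      rw [← hm, ← hd]; simp [enc, DTree.ser]
    rw [e2] at h₇
    obtain ⟨r₂, h₈⟩ := (h₄.seq (h₅.seq (h₆.seq h₇))) (some true)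
    rw [hk]
    refine ⟨r₂, (h₁.seq (h₂.seq (h₃.seq (RunLe.iteTrue rfl h₈)))).mono ?_⟩
    have e3 : csize (a, d) ≤ csize a + Polynomial.eval (csize a) r + 1 := by
      rw [csize_pair]
      have : csize d = csize (f a) := by simp only [csize, hd]
      have := hr a
      omega
    have e4 := eval_mono q' e3
    have := hr a
    simp only [csize] at this e4 ⊢
    omega

@[fun_prop]
theorem PT.cond {c : α → Bool} {f g : α → β} (hc : PT c) (hf : PT f) (hg : PT g) :
    PT fun a => bif c a then f a else g a := by
  refine PT.branch (h := fun x : α × Bool => f x.1) hc hg (hf.comp PT.fst) (fun a h => ?_)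
    (fun a h => ⟨c a, rfl, ?_⟩)
  · cases hca : c a
    · rfl
    · rw [hca] at h; cases h
  · cases hca : c a
    · rw [hca] at h; exact absurd rfl h
    · rfl

theorem PT.listCases {l : α → List β} {f : α → γ} {g : α → β → List β → γ} (hl : PT l) (hf : PT f)
    (hg : PT fun x : α × (β × List β) => g x.1 x.2.1 x.2.2) :
    PT fun a => match l a with
      | [] => f a
      | b :: t => g a b t := by
  refine PT.branch hl hf hg (fun a h => ?_) (fun a h => ?_)
  · cases hla : l a
    · rfl
    · rw [hla] at h; cases h
  · cases hla : l a with
    | nil => rw [hla] at h; exact absurd rfl h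
    | cons b t => exact ⟨(b, t), rfl, rfl⟩

@[fun_prop]
theorem PT.cons {f : α → β} {g : α → List β} (hf : PT f) (hg : PT g) : PT fun a => f a :: g a :=
  (hf.pair hg).of_enc_eq fun _ => rfl

@[fun_prop]
theorem PT.succ {f : α → ℕ} (hf : PT f) : PT fun a => f a + 1 :=
  ((PT.const ()).pair hf).of_enc_eq fun _ => rfl

/-- Numbers are unary trees, the same as lists of units; arithmetic is thereby reduced to operations
on lists. -/
theorem enc_replicate_unit (n : ℕ) : enc (List.replicate n ()) = enc n := by
  induction n with
  | zero => rfl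
  | succ n ih => exact congrArg (DTree.node .leaf) ih

theorem PT.replicate_unit {f : α → ℕ} (hf : PT f) : PT fun a => List.replicate (f a) () :=
  hf.of_enc_eq fun _ => enc_replicate_unit _

/-! ### Folds -/

/-- Put a flag on stack `d` if the first component of the topmost pair is not a leaf. -/
def Cmd.test : Cmd :=
  .seq (.pop .a) (.seq (.pop .a) (.seq (.pushReg .a) (.seq (.push .a (some true))
    (.ite (.push .d (some true)) .skip))))

theorem runLe_test (x y : DTree) (l : List (Option Bool)) (r : Option Bool) :
    ∃ r', RunLe .test ⟨(DTree.node x y).ser ++ l, [], [], [], r⟩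
      ⟨(DTree.node x y).ser ++ l, [], [], match x with | .leaf => [] | _ => [some true], r'⟩ 6 := by
  cases x with
  | leaf =>
    exact ⟨some false, (Run.pop _ _).le.seq ((Run.pop _ _).le.seq ((Run.pushReg _ _).le.seq
      ((Run.push _ _ _).le.seq (RunLe.iteFalse (by simp [Mem.pop, Mem.set, Mem.get, DTree.ser])
        (Run.skip _).le))))⟩
  | node x x' =>
    exact ⟨some true, (Run.pop _ _).le.seq ((Run.pop _ _).le.seq ((Run.pushReg _ _).le.seq
      ((Run.push _ _ _).le.seq (RunLe.iteTrue rfl (Run.push _ _ _).le))))⟩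

/-- The flag on stack `d` says whether the remaining list is non-empty. Each pass costs at most `B`
for the body, six for renewing the flag, and one for the loop itself; `B` has to cover all
intermediate accumulators. -/
theorem runLe_foldLoop {c : Cmd} {q : Polynomial ℕ} {s : γ → β → γ}
    (hc : ∀ (b : β) (t : List β) (x : γ) (l : List (Option Bool)),
      RunA c ((enc (b :: t, x)).ser ++ l) ((enc (t, s x b)).ser ++ l) (q.eval (csize (b :: t, x))))
    (m : List β) (x : γ) (B : ℕ)
    (hB : ∀ k, q.eval (csize (m.drop k, (m.take k).foldl s x)) ≤ B)
    (l : List (Option Bool)) (r : Option Bool) :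
    ∃ r', RunLe (.loop .d (.seq c .test))
      ⟨(enc (m, x)).ser ++ l, [], [], match enc m with | .leaf => [] | _ => [some true], r⟩
      ⟨(enc (([] : List β), m.foldl s x)).ser ++ l, [], [], [], r'⟩ (m.length * (B + 7) + 1) := by
  induction m generalizing x r with
  | nil => exact ⟨none, (Run.loopExit rfl).le.mono (by simp)⟩
  | cons b t ih =>
    obtain ⟨r₁, h₁⟩ := hc b t x l (some true)
    obtain ⟨r₂, h₂⟩ := runLe_test (enc t) (enc (s x b)) l r₁
    obtain ⟨r₃, h₃⟩ := ih (s x b) (fun k => by simpa using hB (k + 1)) r₂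
    refine ⟨r₃, (RunLe.loopStep (s₁ := ⟨(enc (b :: t, x)).ser ++ l, [], [], [], some true⟩)
      rfl (by simp) (h₁.seq h₂) h₃).mono ?_⟩
    have := hB 0
    simp only [List.drop_zero, List.take_zero, List.foldl_nil] at this
    rw [List.length_cons]
    nlinarith

/-- The bound `hb` on the intermediate accumulators is essential: a step that is polynomial by
itself could double the size each time. -/
theorem PT.foldl {l : α → List β} {i : α → γ} {s : α → γ → β → γ} (hl : PT l) (hi : PT i)
    (hs : PT fun x : (α × γ) × β => s x.1.1 x.1.2 x.2)
    (hb : ∃ r : Polynomial ℕ, ∀ a k,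
      csize (((l a).take k).foldl (s a) (i a)) ≤ r.eval (csize a)) :
    PT fun a => (l a).foldl (s a) (i a) := by
  obtain ⟨r, hr⟩ := hb
  obtain ⟨rl, hrl⟩ := hl.size_le
  have hbody : PT fun x : (β × List β) × (α × γ) => (x.1.2, (x.2.1, s x.2.1 x.2.2 x.1.1)) := by
    have h1 : PT fun x : (β × List β) × (α × γ) => s x.2.1 x.2.2 x.1.1 :=
      hs.comp (f := fun x : (β × List β) × (α × γ) => (x.2, x.1.1)) (by fun_prop)
    exact (PT.snd.comp PT.fst).pair ((PT.fst.comp PT.snd).pair h1)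
  obtain ⟨c, q, hc⟩ := hbody
  have hinit : PT fun a => (l a, (a, i a)) := by fun_prop
  obtain ⟨c₀, q₀, hc₀⟩ := hinit
  have hmid : PT fun a => (([] : List β), (a, (l a).foldl (s a) (i a))) := by
    refine ⟨.seq c₀ (.seq .test (.loop .d (.seq c .test))),
      q₀ + (6 + (rl * (q.comp (rl + (Polynomial.X + r + 1) + 1) + 7) + 1)), fun a l' r₀ => ?_⟩
    obtain ⟨r₁, h₁⟩ := hc₀ a l' r₀
    obtain ⟨r₂, h₂⟩ := runLe_test (enc (l a)) (enc (a, i a)) l' r₁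
    -- The parameter `a` travels inside the accumulator, because the loop body sees nothing but the
    -- top tree.
    have hfold : ∀ (m : List β) (y : γ), m.foldl (fun (x : α × γ) b => (x.1, s x.1 x.2 b)) (a, y) =
        (a, m.foldl (s a) y) := by
      intro m
      induction m with
      | nil => exact fun y => rfl
      | cons b m ih => exact fun y => ih _
    obtain ⟨r₃, h₃⟩ := runLe_foldLoop (s := fun (x : α × γ) b => (x.1, s x.1 x.2 b))
      (fun b t x l => hc ((b, t), x) l) (l a) (a, i a)
      (q.eval (rl.eval (csize a) + (csize a + r.eval (csize a) + 1) + 1)) (fun k => by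
        refine eval_mono q ?_
        rw [hfold, csize_pair, csize_pair]
        have := hr a k
        have := hrl a
        have := csize_drop_le (l a) k
        omega) l' r₂
    rw [hfold] at h₃
    refine ⟨r₃, (h₁.seq (h₂.seq h₃)).mono ?_⟩
    simp only [Polynomial.eval_add, Polynomial.eval_mul, Polynomial.eval_X, Polynomial.eval_ofNat,
      Polynomial.eval_one, Polynomial.eval_comp]
    have h4 : (l a).length ≤ rl.eval (csize a) :=
      (Nat.le_succ _).trans ((length_le_csize _).trans (hrl a))
    have := Nat.mul_le_mul_right
      (q.eval (rl.eval (csize a) + (csize a + r.eval (csize a) + 1) + 1) + 7) h4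
    omega
  exact (PT.snd.comp PT.snd).comp hmid

end

end KneserTucker

namespace KneserTucker

open Code

/-! ### Reading and writing strings -/

/-- Turn a reversed string on stack `b` into a tree on the main stack. -/
def Cmd.readBits : Cmd :=
  .seq (.push .a (some false)) (.loop .b (.seq
    (.ite (.seq (.push .a (some false)) (.seq (.push .a (some false)) (.push .a (some true))))
      (.push .a (some false)))
    (.push .a (some true))))

theorem ser_enc_cons (x : Bool) (z : List Bool) :
    (enc (x :: z)).ser = some true :: ((enc x).ser ++ (enc z).ser) := rfl

/-- With the string reversed on `b`, its last bit comes first, so the list is built from its end by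
prepending. The symbols of each tree are pushed in the opposite order. -/
theorem runLe_readBits (z : List Bool) (l : List (Option Bool)) (r : Option Bool) :
    RunLe .readBits ⟨l, z.reverse.map some, [], [], r⟩ ⟨(enc z).ser ++ l, [], [], [], none⟩
      (6 * z.length + 2) := by
  have key : ∀ (m acc : List Bool) (r : Option Bool), RunLe (.loop .b (.seq
    (.ite (.seq (.push .a (some false)) (.seq (.push .a (some false)) (.push .a (some true))))
      (.push .a (some false)))
    (.push .a (some true)))) ⟨(enc acc).ser ++ l, m.map some, [], [], r⟩
      ⟨(enc (m.reverse ++ acc)).ser ++ l, [], [], [], none⟩ (6 * m.length + 1) := by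
    intro m
    induction m with
    | nil => exact fun acc r => (Run.loopExit rfl).le
    | cons x m ih =>
      intro acc r
      have h := ih (x :: acc) (some x)
      rw [List.reverse_cons, List.append_assoc]
      rw [ser_enc_cons] at h
      have hs : RunLe (.ite (.seq (.push .a (some false)) (.seq (.push .a (some false))
          (.push .a (some true)))) (.push .a (some false)))
          ⟨(enc acc).ser ++ l, m.map some, [], [], some x⟩
          ⟨(enc x).ser ++ ((enc acc).ser ++ l), m.map some, [], [], some x⟩ 4 := by
        cases x with
        | false => exact (RunLe.iteFalse (by simp) (Run.push _ _ _).le).mono (by omega)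
        | true =>
          exact RunLe.iteTrue rfl ((Run.push _ _ _).le.seq ((Run.push _ _ _).le.seq
            (Run.push _ _ _).le))
      have hp : RunLe (.push .a (some true))
          ⟨(enc x).ser ++ ((enc acc).ser ++ l), m.map some, [], [], some x⟩
          ⟨some true :: ((enc x).ser ++ (enc acc).ser) ++ l, m.map some, [], [], some x⟩ 1 := by
        rw [List.cons_append, List.append_assoc]
        exact (Run.push _ _ _).le
      exact (RunLe.loopStep (s := ⟨(enc acc).ser ++ l, some x :: m.map some, [], [], r⟩) rfl
        (by simp [Mem.pop, Mem.get]) (hs.seq hp) h).mono (by rw [List.length_cons]; omega)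
  have h := key z.reverse [] r
  rw [List.reverse_reverse, List.append_nil, List.length_reverse] at h
  exact ((Run.push _ _ _).le.seq h).mono (by omega)

/-- The loop of `Cmd.writeBits`. -/
def Cmd.writeLoop : Cmd :=
  .loop .d (.seq (.pop .a) (.seq
    (.ite (.seq (.pop .a) (.seq (.pop .a) (.push .b (some true)))) (.push .b (some false)))
    (.seq (.pop .a) (.ite (.push .d (some true)) .skip))))

/-- Turn a tree on the main stack that encodes a string into the reversed string on stack `b`. -/
def Cmd.writeBits : Cmd :=
  .seq (.seq (.pop .a) (.ite (.push .d (some true)) .skip)) .writeLoop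

theorem runLe_writeStart (z : List Bool) (l b : List (Option Bool)) (r : Option Bool) :
    ∃ r', RunLe (.seq (.pop .a) (.ite (.push .d (some true)) .skip))
      ⟨(enc z).ser ++ l, b, [], [], r⟩
      ⟨(enc z).ser.tail ++ l, b, [], match z with | [] => [] | _ => [some true], r'⟩ 3 := by
  cases z with
  | nil =>
    exact ⟨_, (Run.pop _ _).le.seq (RunLe.iteFalse (by simp [Mem.pop, Mem.get, enc, encList,
      DTree.ser]) (Run.skip _).le)⟩
  | cons x z => exact ⟨_, (Run.pop _ _).le.seq (RunLe.iteTrue rfl (Run.push _ _ _).le)⟩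

/-- The first symbol of the list has been consumed before each test, hence the `tail`; it decides
whether `d` carries a flag for another pass. -/
theorem runLe_writeLoop (z : List Bool) (l b : List (Option Bool)) (r : Option Bool) :
    RunLe .writeLoop
      ⟨(enc z).ser.tail ++ l, b, [], match z with | [] => [] | _ => [some true], r⟩
      ⟨l, z.reverse.map some ++ b, [], [], none⟩ (9 * z.length + 1) := by
  induction z generalizing b r with
  | nil => exact (Run.loopExit rfl).le
  | cons x z ih =>
    have e : (enc (x :: z)).ser.tail ++ l = (enc x).ser ++ ((enc z).ser ++ l) := by
      simp [ser_enc_cons]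
    rw [e, List.reverse_cons, List.map_append, List.append_assoc]
    have hs : RunLe (.pop .a) ⟨(enc x).ser ++ ((enc z).ser ++ l), b, [], [], some true⟩
        ⟨(enc x).ser.tail ++ ((enc z).ser ++ l), b, [], [], some x⟩ 1 := by
      cases x <;> exact (Run.pop _ _).le
    have hs' : ∃ r, RunLe (.ite (.seq (.pop .a) (.seq (.pop .a) (.push .b (some true))))
        (.push .b (some false)))
        ⟨(enc x).ser.tail ++ ((enc z).ser ++ l), b, [], [], some x⟩
        ⟨(enc z).ser ++ l, some x :: b, [], [], r⟩ 4 := by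
      cases x with
      | false => exact ⟨_, (RunLe.iteFalse (by simp) (Run.push _ _ _).le).mono (by omega)⟩
      | true =>
        exact ⟨_, RunLe.iteTrue rfl ((Run.pop _ _).le.seq ((Run.pop _ _).le.seq
          (Run.push _ _ _).le))⟩
    obtain ⟨r₁, hs'⟩ := hs'
    obtain ⟨r', h⟩ := runLe_writeStart z l (some x :: b) r₁
    exact (RunLe.loopStep rfl (by simp [Mem.pop, Mem.get]) (hs.seq (hs'.seq h))
      (ih (some x :: b) r')).mono (by rw [List.length_cons]; omega)

theorem runLe_writeBits (z : List Bool) (l : List (Option Bool)) (r : Option Bool) :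
    RunLe .writeBits ⟨(enc z).ser ++ l, [], [], [], r⟩ ⟨l, z.reverse.map some, [], [], none⟩
      (9 * z.length + 4) := by
  obtain ⟨r', h⟩ := runLe_writeStart z l [] r
  have := runLe_writeLoop z l [] r'
  rw [List.append_nil] at this
  exact (h.seq this).mono (by omega)

/-! ### Calling a machine once -/

section
variable {K : Type} {Γ : K → Type}

/-- Stack alphabets after adding an input and an output stack. -/
def IOΓ (Γ : K → Type) : K ⊕ Bool → Type
  | .inl k => Γ k
  | .inr _ => Bool

/-- The stacks of a machine together with an input and an output stack. -/
def ioStk (S : ∀ k, List (Γ k)) (I : Bool → List Bool) : ∀ k, List (IOΓ Γ k)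
  | .inl k => S k
  | .inr b => I b

theorem update_ioStk_inl [DecidableEq K] (S : ∀ k, List (Γ k)) (I : Bool → List Bool) (k : K)
    (l : List (IOΓ Γ (.inl k))) :
    Function.update (ioStk S I) (.inl k) l = ioStk (Function.update S k l) I := by
  funext j
  by_cases h : j = .inl k
  · subst h
    rw [Function.update_self]
    exact (Function.update_self (β := fun k => List (Γ k)) k l S).symm
  · rw [Function.update_of_ne h]
    rcases j with j | j
    · exact (Function.update_of_ne (β := fun k => List (Γ k)) (fun e => h (congrArg Sum.inl e))
        l S).symm
    · rfl

theorem update_ioStk_inr [DecidableEq K] (S : ∀ k, List (Γ k)) (I : Bool → List Bool) (b : Bool)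
    (l : List (IOΓ Γ (.inr b))) :
    Function.update (ioStk S I) (.inr b) l = ioStk S (Function.update I b l) := by
  funext j
  by_cases h : j = .inr b
  · subst h
    rw [Function.update_self]
    exact (Function.update_self (β := fun _ => List Bool) b l I).symm
  · rw [Function.update_of_ne h]
    rcases j with j | j
    · rfl
    · exact (Function.update_of_ne (β := fun _ => List Bool) (fun e => h (congrArg Sum.inr e))
        l I).symm

variable {σ Λ Λ' : Type}

/-- A statement of a machine, read as a statement of the extended machine that jumps to `e` instead
of halting. -/
def liftStmt (i : Λ → Λ') (e : Λ') :
    TM2.Stmt Γ Λ σ → TM2.Stmt (ExtΓ (IOΓ Γ)) Λ' (σ × Option Bool)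
  | .push k f q => .push (.inl (.inl k)) (fun v => f v.1) (liftStmt i e q)
  | .peek k f q => .peek (.inl (.inl k)) (fun v x => (f v.1 x, v.2)) (liftStmt i e q)
  | .pop k f q => .pop (.inl (.inl k)) (fun v x => (f v.1 x, v.2)) (liftStmt i e q)
  | .load f q => .load (fun v => (f v.1, v.2)) (liftStmt i e q)
  | .branch f q q' => .branch (fun v => f v.1) (liftStmt i e q) (liftStmt i e q')
  | .goto f => .goto fun v => i (f v.1)
  | .halt => .goto fun _ => e

/-- A configuration of a machine, read as a configuration of the extended machine. -/
def liftCfg (i : Λ → Λ') (e : Λ') (I : Bool → List Bool) (s : Mem) (c : TM2.Cfg Γ Λ σ) :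
    TM2.Cfg (ExtΓ (IOΓ Γ)) Λ' (σ × Option Bool) :=
  ⟨some (c.l.elim e i), (c.var, s.r), extStk (ioStk c.stk I) s⟩

variable [DecidableEq K]

theorem stepAux_liftStmt (i : Λ → Λ') (e : Λ') (I : Bool → List Bool) (s : Mem)
    (q : TM2.Stmt Γ Λ σ) (v : σ) (S : ∀ k, List (Γ k)) :
    TM2.stepAux (liftStmt i e q) (v, s.r) (extStk (ioStk S I) s) =
      liftCfg i e I s (TM2.stepAux q v S) := by
  induction q generalizing v S with
  | push k f q ih =>
    exact (congrArg (TM2.stepAux (liftStmt i e q) (v, s.r))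
      ((update_extStk_inl (ioStk S I) s (.inl k) (f v :: S k)).trans
        (congrArg (extStk · s) (update_ioStk_inl S I k (f v :: S k))))).trans (ih _ _)
  | peek k f q ih => exact ih _ _
  | pop k f q ih =>
    exact (congrArg (TM2.stepAux (liftStmt i e q) (f v (S k).head?, s.r))
      ((update_extStk_inl (ioStk S I) s (.inl k) (S k).tail).trans
        (congrArg (extStk · s) (update_ioStk_inl S I k (S k).tail)))).trans (ih _ _)
  | load f q ih => exact ih _ _
  | branch f q q' ih ih' =>
    rw [liftStmt, TM2.stepAux, TM2.stepAux]
    change cond (f v) _ _ = _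
    cases f v
    · exact ih' _ _
    · exact ih _ _
  | goto f => rfl
  | halt => rfl

theorem iterate_bind_none {α : Type} (f : α → Option α) (t : ℕ) :
    (flip bind f)^[t] none = none := by
  induction t with
  | zero => rfl
  | succ t ih => exact ih

/-- The simulation is in lockstep: halting becomes a jump to `e`, and every other statement is
copied with the additional stacks and the register as a frame. A halted configuration has no
successor, which excludes it before the last step. -/
theorem Reach.lift {m : Λ → TM2.Stmt Γ Λ σ} {m' : Λ' → TM2.Stmt (ExtΓ (IOΓ Γ)) Λ' (σ × Option Bool)}
    (i : Λ → Λ') (e : Λ') (hm : ∀ l, m' (i l) = liftStmt i e (m l)) (I : Bool → List Bool) (s : Mem)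
    {c c' : TM2.Cfg Γ Λ σ} {t : ℕ} (h : Reach m c c' t) :
    Reach m' (liftCfg i e I s c) (liftCfg i e I s c') t := by
  induction t generalizing c with
  | zero => cases h; rfl
  | succ t ih =>
    obtain ⟨l, v, S⟩ := c
    cases l with
    | none =>
      have : (flip bind (TM2.step m))^[t] none = some c' := h
      rw [iterate_bind_none] at this
      cases this
    | some l =>
      have h' : Reach m (TM2.stepAux (m l) v S) c' t := h
      rw [add_comm]
      refine Reach.trans (Reach.one ?_) (ih h')
      change TM2.stepAux (m' (i l)) _ _ = _
      rw [hm, stepAux_liftStmt]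

/-- Move a string from a stack to stack `b`, reversing it. -/
def fetchStmt (k : K ⊕ Bool) (e : IOΓ Γ k ≃ Bool) (self next : Λ') :
    TM2.Stmt (ExtΓ (IOΓ Γ)) Λ' (σ × Option Bool) :=
  .pop (.inl k) (fun v x => (v.1, Option.map e x)) (.branch (fun v => v.2.isSome)
    (.push (.inr .b) (fun v => v.2) (.goto fun _ => self)) (.goto fun _ => next))

/-- Move a string from stack `b` to another stack, reversing it. -/
def sendStmt (k : K ⊕ Bool) (e : IOΓ Γ k ≃ Bool) (self next : Λ') :
    TM2.Stmt (ExtΓ (IOΓ Γ)) Λ' (σ × Option Bool) :=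
  .pop (.inr .b) (fun v x => (v.1, Option.join x)) (.branch (fun v => v.2.isSome)
    (.push (.inl k) (fun v => e.symm (v.2.getD false)) (.goto fun _ => self)) (.goto fun _ => next))

variable {m : Λ' → TM2.Stmt (ExtΓ (IOΓ Γ)) Λ' (σ × Option Bool)}

theorem stepAux_fetchStmt (k : K ⊕ Bool) (e : IOΓ Γ k ≃ Bool) (self next : Λ')
    (T : ∀ k, List (ExtΓ (IOΓ Γ) k)) (v : σ) (r : Option Bool) (z : List (IOΓ Γ k))
    (hz : T (.inl k) = z) :
    TM2.stepAux (fetchStmt k e self next) (v, r) T = cond (z.head?.map e).isSome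
      ⟨some self, (v, z.head?.map e), Function.update (Function.update T (.inl k) z.tail) (.inr .b)
        (z.head?.map e :: T (.inr .b))⟩
      ⟨some next, (v, z.head?.map e), Function.update T (.inl k) z.tail⟩ := by
  subst hz
  have h : (Function.update T (.inl k) (T (.inl k)).tail) (.inr .b) = T (.inr .b) :=
    Function.update_of_ne (by simp) _ _
  rw [← h]
  rfl

theorem reach_fetch (k : K ⊕ Bool) (e : IOΓ Γ k ≃ Bool) (self next : Λ')
    (hm : m self = fetchStmt k e self next) (S : ∀ k, List (IOΓ Γ k)) (a b : List (Option Bool))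
    (v : σ) (r : Option Bool) (z : List (IOΓ Γ k)) (hz : S k = z) :
    Reach m ⟨some self, (v, r), extStk S ⟨a, b, [], [], r⟩⟩
      ⟨some next, (v, none), extStk (Function.update S k [])
        ⟨a, (z.map e).reverse.map some ++ b, [], [], none⟩⟩ (z.length + 1) := by
  induction z generalizing S b r with
  | nil =>
    refine Reach.one ?_
    rw [hm, stepAux_fetchStmt k e self next _ v r [] hz]
    exact congrArg (TM2.Cfg.mk _ _) (update_extStk_inl S _ k [])
  | cons x z ih =>
    have h := ih (Function.update S k z) (some (e x) :: b) (some (e x)) (Function.update_self ..)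
    rw [Function.update_idem] at h
    rw [List.length_cons, add_comm, List.map_cons, List.reverse_cons, List.map_append,
      List.append_assoc]
    refine Reach.trans (Reach.one ?_) h
    rw [hm, stepAux_fetchStmt k e self next _ v r (x :: z) hz]
    exact congrArg (TM2.Cfg.mk _ _) ((congrArg (Function.update · _ _)
      (update_extStk_inl S _ k z)).trans (update_extStk_inr _ _ .b _))

theorem stepAux_sendStmt (k : K ⊕ Bool) (e : IOΓ Γ k ≃ Bool) (self next : Λ')
    (T : ∀ k, List (ExtΓ (IOΓ Γ) k)) (v : σ) (r : Option Bool) (z : List (Option Bool))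
    (hz : T (.inr .b) = z) :
    TM2.stepAux (sendStmt k e self next) (v, r) T = cond z.head?.join.isSome
      ⟨some self, (v, z.head?.join), Function.update (Function.update T (.inr .b) z.tail) (.inl k)
        (e.symm (z.head?.join.getD false) :: T (.inl k))⟩
      ⟨some next, (v, z.head?.join), Function.update T (.inr .b) z.tail⟩ := by
  subst hz
  have h : (Function.update T (.inr .b) (T (.inr .b)).tail) (.inl k) = T (.inl k) :=
    Function.update_of_ne (by simp) _ _
  rw [← h]
  rfl

theorem reach_send (k : K ⊕ Bool) (e : IOΓ Γ k ≃ Bool) (self next : Λ')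
    (hm : m self = sendStmt k e self next) (S : ∀ k, List (IOΓ Γ k)) (a : List (Option Bool))
    (v : σ) (r : Option Bool) (z : List Bool) :
    Reach m ⟨some self, (v, r), extStk S ⟨a, z.map some, [], [], r⟩⟩
      ⟨some next, (v, none), extStk (Function.update S k ((z.map e.symm).reverse ++ S k))
        ⟨a, [], [], [], none⟩⟩ (z.length + 1) := by
  induction z generalizing S r with
  | nil =>
    refine Reach.one ?_
    rw [hm, stepAux_sendStmt k e self next _ v r [] rfl]
    simp only [List.map_nil, List.reverse_nil, List.nil_append, Function.update_eq_self]
    exact congrArg (TM2.Cfg.mk _ _) (update_extStk_inr S _ .b [])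
  | cons x z ih =>
    have h := ih (Function.update S k (e.symm x :: S k)) (some x)
    rw [Function.update_idem, Function.update_self] at h
    have e1 : ((x :: z).map e.symm).reverse ++ S k = (z.map e.symm).reverse ++ e.symm x :: S k := by
      simp
    rw [List.length_cons, add_comm, e1]
    refine Reach.trans (Reach.one ?_) h
    rw [hm, stepAux_sendStmt k e self next _ v r ((x :: z).map some) rfl]
    exact congrArg (TM2.Cfg.mk _ _) ((congrArg (Function.update · _ _)
      (update_extStk_inr S _ .b _)).trans (update_extStk_inl _ _ k _))

/-- Number of instructions of a statement. -/
def stmtSize : TM2.Stmt Γ Λ σ → ℕ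
  | .push _ _ q => stmtSize q + 1
  | .peek _ _ q => stmtSize q
  | .pop _ _ q => stmtSize q
  | .load _ q => stmtSize q
  | .branch _ q q' => stmtSize q + stmtSize q'
  | .goto _ => 0
  | .halt => 0

theorem length_stepAux_le (q : TM2.Stmt Γ Λ σ) (v : σ) (S : ∀ k, List (Γ k)) (k : K) :
    ((TM2.stepAux q v S).stk k).length ≤ (S k).length + stmtSize q := by
  induction q generalizing v S with
  | push j f q ih =>
    refine (ih _ _).trans ?_
    by_cases h : k = j
    · subst h; simp only [Function.update_self, List.length_cons, stmtSize]; omega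
    · simp only [Function.update_of_ne h, stmtSize]; omega
  | peek j f q ih => exact ih _ _
  | pop j f q ih =>
    refine (ih _ _).trans ?_
    by_cases h : k = j
    · subst h; simp only [Function.update_self, List.length_tail, stmtSize]; omega
    · simp only [Function.update_of_ne h, stmtSize]; omega
  | load f q ih => exact ih _ _
  | branch f q q' ih ih' =>
    rw [TM2.stepAux, stmtSize]
    cases f v
    · exact (ih' v S).trans (by omega)
    · exact (ih v S).trans (by omega)
  | goto f => simp [stmtSize]
  | halt => simp [stmtSize]

/-- One machine step executes a whole statement and may push several symbols, but no more than a
constant of the machine. The sum over all labels is such a constant. -/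
theorem Reach.length_le [Fintype Λ] {m : Λ → TM2.Stmt Γ Λ σ} {c c' : TM2.Cfg Γ Λ σ} {t : ℕ}
    (h : Reach m c c' t) (k : K) :
    (c'.stk k).length ≤ (c.stk k).length + (∑ l, stmtSize (m l)) * t := by
  induction t generalizing c with
  | zero => cases h; simp
  | succ t ih =>
    obtain ⟨l, v, S⟩ := c
    cases l with
    | none =>
      have : (flip bind (TM2.step m))^[t] none = some c' := h
      rw [iterate_bind_none] at this
      cases this
    | some l =>
      have h1 := ih (c := TM2.stepAux (m l) v S) h
      have h2 := length_stepAux_le (m l) v S k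
      have h3 := Finset.single_le_sum (f := fun l => stmtSize (m l)) (fun _ _ => Nat.zero_le _)
        (Finset.mem_univ l)
      rw [mul_add, mul_one]
      simp only at h3 ⊢
      omega

end

end KneserTucker

namespace KneserTucker

open Code

/-! ### Wrapping polynomial-time functions around one call of a machine -/

theorem csize_bits_le (z : List Bool) : csize z ≤ 4 * z.length + 1 := by
  induction z with
  | nil => exact le_rfl
  | cons x z ih =>
    have := csize_bool x
    rw [csize_cons, List.length_cons]
    omega

/-- Labels of the machine that calls `M` between the commands `c₁` and `c₂`. -/
abbrev CallLab (Λ : Type) (c₁ c₂ : Cmd) : Type := (c₁.Lab ⊕ c₂.Lab) ⊕ (Λ ⊕ Fin 5)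

/-- The machine that runs `c₁`, then `M`, then `c₂`. -/
def callCode (M : TM2ComputableAux Bool Bool) (c₁ c₂ : Cmd) :
    CallLab M.tm.Λ c₁ c₂ → TM2.Stmt (ExtΓ (IOΓ M.tm.Γ)) (CallLab M.tm.Λ c₁ c₂)
      (M.tm.σ × Option Bool)
  | .inl (.inl l) => c₁.code (fun l => .inl (.inl l)) (.inr (.inr 1)) l
  | .inl (.inr l) => c₂.code (fun l => .inl (.inr l)) (.inr (.inr 3)) l
  | .inr (.inl l) => liftStmt (fun l => .inr (.inl l)) (.inr (.inr 2)) (M.tm.m l)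
  | .inr (.inr 0) => fetchStmt (.inr false) (Equiv.refl Bool) (.inr (.inr 0))
      (.inl (.inl c₁.entry))
  | .inr (.inr 1) => sendStmt (.inl M.tm.k₀) M.inputAlphabet (.inr (.inr 1))
      (.inr (.inl M.tm.main))
  | .inr (.inr 2) => fetchStmt (.inl M.tm.k₁) M.outputAlphabet (.inr (.inr 2))
      (.inl (.inr c₂.entry))
  | .inr (.inr 3) => sendStmt (.inr true) (Equiv.refl Bool) (.inr (.inr 3)) (.inr (.inr 4))
  | .inr (.inr 4) => .halt

def callMachine (M : TM2ComputableAux Bool Bool) (c₁ c₂ : Cmd) : TM2ComputableAux Bool Bool where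
  tm :=
    { K := (M.tm.K ⊕ Bool) ⊕ Stk
      kDecidableEq := inferInstance
      kFin := by have := M.tm.kFin; infer_instance
      k₀ := .inl (.inr false)
      k₁ := .inl (.inr true)
      Γ := ExtΓ (IOΓ M.tm.Γ)
      Λ := CallLab M.tm.Λ c₁ c₂
      main := .inr (.inr 0)
      ΛFin := by have := M.tm.ΛFin; infer_instance
      σ := M.tm.σ × Option Bool
      initialState := (M.tm.initialState, none)
      σFin := by have := M.tm.σFin; infer_instance
      Γk₀Fin := inferInstanceAs (Fintype Bool)
      m := callCode M c₁ c₂ }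
  inputAlphabet := Equiv.refl Bool
  outputAlphabet := Equiv.refl Bool

theorem initList_callMachine (M : TM2ComputableAux Bool Bool) (c₁ c₂ : Cmd) (z : List Bool) :
    initList (callMachine M c₁ c₂).tm (z.map (callMachine M c₁ c₂).inputAlphabet.symm) =
      ⟨some (.inr (.inr 0)), (M.tm.initialState, none), extStk
        (ioStk (fun _ => []) fun b => bif b then [] else z) ⟨[], [], [], [], none⟩⟩ := by
  refine congrArg (TM2.Cfg.mk _ _) (funext fun k => ?_)
  rcases k with (k | b) | k
  · rfl
  · cases b
    · exact List.map_id _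
    · rfl
  · cases k <;> rfl

theorem initList_stk (M : FinTM2) (z : List (M.Γ M.k₀)) :
    initList M z = ⟨some M.main, M.initialState, Function.update (fun _ => []) M.k₀ z⟩ := by
  refine congrArg (TM2.Cfg.mk _ _) (funext fun k => ?_)
  by_cases h : k = M.k₀
  · subst h
    rw [Function.update_self, dif_pos rfl]
    rfl
  · rw [Function.update_of_ne h, dif_neg h]

theorem Reach.of_eq {K : Type} [DecidableEq K] {Γ : K → Type} {Λ σ : Type}
    {m : Λ → TM2.Stmt Γ Λ σ} {c c' c'' : TM2.Cfg Γ Λ σ} {t : ℕ} (h : Reach m c c' t)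
    (e : c' = c'') : Reach m c c'' t := e ▸ h

/-- The contents `a` of the main stack survive the call and pass data from the first command to the
second. Whatever `M` leaves on its own stacks is harmless, since the second command does not touch
them. The constant is one for each of the four transfers plus the final halt. -/
theorem reach_callMachine (M : TM2ComputableAux Bool Bool) (c₁ c₂ : Cmd) {z z' y y' : List Bool}
    {a : List (Option Bool)} {r₁ r₂ : Option Bool} {t n₁ n₂ : ℕ}
    (h₁ : RunLe c₁ ⟨[], z.reverse.map some, [], [], none⟩ ⟨a, z'.reverse.map some, [], [], r₁⟩ n₁)
    (h₂ : RunLe c₂ ⟨a, y.reverse.map some, [], [], none⟩ ⟨[], y'.reverse.map some, [], [], r₂⟩ n₂)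
    (h : OutputsWithin M z' y t) :
    OutputsWithin (callMachine M c₁ c₂) z y'
      (z.length + n₁ + z'.length + t + y.length + n₂ + y'.length + 5) := by
  obtain ⟨c, ⟨⟨⟨s, hs⟩, hle⟩⟩, hl, hy⟩ := h
  obtain ⟨t₁, ht₁, h₁⟩ := h₁
  obtain ⟨t₂, ht₂, h₂⟩ := h₂
  simp only at hle
  have hI : Function.update (fun b => bif b then [] else z) false [] = fun _ => [] := by
    funext b; cases b <;> rfl
  have e₁ : Reach (callCode M c₁ c₂) _ _ (z.length + 1) := (reach_fetch (m := callCode M c₁ c₂) (.inr false) (Equiv.refl Bool) (.inr (.inr 0))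
    (.inl (.inl c₁.entry)) rfl (ioStk (fun _ => []) fun b => bif b then [] else z) [] []
    M.tm.initialState none z rfl).of_eq (c'' := ⟨some (.inl (.inl c₁.entry)),
      (M.tm.initialState, none), extStk (ioStk (fun _ => []) fun _ => [])
      ⟨[], z.reverse.map some, [], [], none⟩⟩) (by
    refine congrArg (TM2.Cfg.mk _ _) (congr (congrArg extStk ?_) ?_)
    · exact (update_ioStk_inr _ _ _ _).trans (congrArg (ioStk fun _ => []) hI)
    · exact congrArg (fun l => Mem.mk [] l [] [] none) ((List.append_nil _).trans
        (congrArg (fun w : List Bool => w.reverse.map some) (List.map_id z))))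
  have e₂ := h₁.reach (m := callCode M c₁ c₂) (fun l => .inl (.inl l)) (.inr (.inr 1))
    (fun _ => rfl) M.tm.initialState (ioStk (fun _ => []) fun _ => [])
  have e₃ := (reach_send (m := callCode M c₁ c₂) (.inl M.tm.k₀) M.inputAlphabet (.inr (.inr 1))
    (.inr (.inl M.tm.main)) rfl (ioStk (fun _ => []) fun _ => []) a M.tm.initialState r₁
    z'.reverse).of_eq (c'' := ⟨some (.inr (.inl M.tm.main)), (M.tm.initialState, none),
      extStk (ioStk (Function.update (fun _ => []) M.tm.k₀ (z'.map M.inputAlphabet.symm))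
        fun _ => []) ⟨a, [], [], [], none⟩⟩) (by
    have hz' : (z'.reverse.map M.inputAlphabet.symm).reverse ++ [] =
      z'.map M.inputAlphabet.symm := by simp
    refine congrArg (TM2.Cfg.mk _ _) (congrArg (extStk · _) ?_)
    exact (update_ioStk_inl _ _ _ _).trans
      (congrArg (fun w => ioStk (Function.update (fun _ => []) M.tm.k₀ w) fun _ => []) hz'))
  have hs' : Reach M.tm.m (initList M.tm (z'.map M.inputAlphabet.symm)) c s := hs
  rw [initList_stk] at hs'
  have e₄ := hs'.lift (m' := callCode M c₁ c₂) (fun l => .inr (.inl l)) (.inr (.inr 2))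
    (fun _ => rfl) (fun _ => []) ⟨a, [], [], [], none⟩
  have hc : liftCfg (fun l => .inr (.inl l)) (.inr (.inr 2)) (fun _ => []) ⟨a, [], [], [], none⟩ c =
      (⟨some (.inr (.inr 2)), (c.var, none), extStk (ioStk c.stk fun _ => [])
        ⟨a, [], [], [], none⟩⟩ : TM2.Cfg (ExtΓ (IOΓ M.tm.Γ)) (CallLab M.tm.Λ c₁ c₂)
          (M.tm.σ × Option Bool)) := by
    unfold liftCfg
    rw [hl]
    rfl
  rw [hc] at e₄
  have e₅ := reach_fetch (m := callCode M c₁ c₂) (.inl M.tm.k₁) M.outputAlphabet (.inr (.inr 2))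
    (.inl (.inr c₂.entry)) rfl (ioStk c.stk fun _ => []) a [] c.var none (c.stk M.tm.k₁) rfl
  have hy1 : List.map (⇑M.outputAlphabet) (c.stk M.tm.k₁) = y := hy
  have hy2 : List.length (α := IOΓ M.tm.Γ (.inl M.tm.k₁)) (c.stk M.tm.k₁) = y.length := by
    rw [← hy1]; exact (List.length_map _).symm
  rw [update_ioStk_inl, List.append_nil] at e₅
  have e₅' : ((c.stk M.tm.k₁).map M.outputAlphabet).reverse.map some = y.reverse.map some := by
    rw [hy1]
  have e₆ := h₂.reach (m := callCode M c₁ c₂) (fun l => .inl (.inr l)) (.inr (.inr 3))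
    (fun _ => rfl) c.var (ioStk (Function.update c.stk M.tm.k₁ []) fun _ => [])
  have e₇ := (reach_send (m := callCode M c₁ c₂) (.inr true) (Equiv.refl Bool) (.inr (.inr 3))
    (.inr (.inr 4)) rfl (ioStk (Function.update c.stk M.tm.k₁ []) fun _ => []) [] c.var r₂
    y'.reverse).of_eq (c'' := ⟨some (.inr (.inr 4)), (c.var, none),
      extStk (ioStk (Function.update c.stk M.tm.k₁ []) (Function.update (fun _ => []) true y'))
        ⟨[], [], [], [], none⟩⟩) (by
    have hy' : (y'.reverse.map (Equiv.refl Bool).symm).reverse ++ [] = y' := by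
      rw [Equiv.refl_symm, Equiv.coe_refl, List.map_id, List.reverse_reverse, List.append_nil]
    refine congrArg (TM2.Cfg.mk _ _) (congrArg (extStk · _) ?_)
    exact (update_ioStk_inr _ _ _ _).trans
      (congrArg (fun w => ioStk _ (Function.update (fun _ => []) true w)) hy'))
  have e₈ : ∀ T, Reach (callCode M c₁ c₂) ⟨some (.inr (.inr 4)), (c.var, none), T⟩
      ⟨none, (c.var, none), T⟩ 1 := fun _ => Reach.one rfl
  have e := (((e₁.trans e₂).trans e₃).trans (e₄.trans (e₅.trans (e₅' ▸ e₆)))).trans (e₇.trans (e₈ _))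
  rw [List.length_reverse, List.length_reverse, hy2] at e
  refine ⟨_, ⟨⟨⟨_, (congrArg (fun c => (flip bind (TM2.step (callCode M c₁ c₂)))^[_] (some c))
    (initList_callMachine M c₁ c₂ z)).trans e⟩, by dsimp only; omega⟩⟩, rfl, ?_⟩
  exact List.map_id y'

/-- The query `pre z` goes to `M`, and the answer together with the original input goes to `post`.
The time bound charges the call of `M` through `t`, so that `M` need not be polynomial in the length
of its own input. -/
theorem exists_machine (M : TM2ComputableAux Bool Bool) {pre : List Bool → List Bool}
    {post : List Bool × List Bool → List Bool} (hpre : PT pre) (hpost : PT post) :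
    ∃ (N : TM2ComputableAux Bool Bool) (Q : Polynomial ℕ), ∀ z y t,
      OutputsWithin M (pre z) y t →
        OutputsWithin N z (post (y, z)) (Q.eval (z.length + t)) := by
  obtain ⟨rp, hrp⟩ := hpre.size_le
  obtain ⟨ro, hro⟩ := hpost.size_le
  obtain ⟨cp, qp, hcp⟩ := hpre.pair PT.id'
  obtain ⟨co, qo, hco⟩ := hpost
  have := M.tm.ΛFin
  let C := ∑ l, stmtSize (M.tm.m l)
  let A : Polynomial ℕ := 4 * Polynomial.X + 1
  -- A bound for the length of the answer. The output stack of `M` may be its input stack, so it can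
  -- hold the whole query at the start; afterwards it grows by at most `C` per step.
  let Y : Polynomial ℕ := rp.comp A + Polynomial.C C * Polynomial.X
  let B : Polynomial ℕ := 4 * Y + A + 2
  -- Popping the node symbol of the pair `(pre z, z)` leaves two trees, of which only the first is
  -- written out. After the call, pushing a node symbol joins the answer to the waiting `z`.
  refine ⟨callMachine M (.seq .readBits (.seq cp (.seq (.pop .a) .writeBits)))
    (.seq .readBits (.seq (.push .a (some true)) (.seq co .writeBits))),
    (6 * Polynomial.X + 2 + (qp.comp A + (1 + (9 * rp.comp A + 4)))) +
    (6 * Y + 2 + (1 + (qo.comp B + (9 * ro.comp B + 4)))) +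
    (2 * Polynomial.X + rp.comp A + Y + ro.comp B + 5), fun z y t h => ?_⟩
  have hz : csize z ≤ A.eval (z.length + t) := by
    have := csize_bits_le z
    simp only [A, Polynomial.eval_add, Polynomial.eval_mul, Polynomial.eval_X,
      Polynomial.eval_ofNat, Polynomial.eval_one]
    omega
  have hpz : (pre z).length ≤ rp.eval (A.eval (z.length + t)) :=
    (Nat.le_succ _).trans ((length_le_csize _).trans ((hrp z).trans (eval_mono rp hz)))
  have hy : y.length ≤ Y.eval (z.length + t) := by
    obtain ⟨c, ⟨⟨⟨s, hs⟩, hle⟩⟩, hl, hy⟩ := h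
    have hs' : Reach M.tm.m (initList M.tm ((pre z).map M.inputAlphabet.symm)) c s := hs
    rw [initList_stk] at hs'
    have h1 := hs'.length_le M.tm.k₁
    have h2 : (Function.update (fun k => ([] : List (M.tm.Γ k))) M.tm.k₀
        ((pre z).map M.inputAlphabet.symm) M.tm.k₁).length ≤ (pre z).length := by
      by_cases hk : M.tm.k₁ = M.tm.k₀
      · rw [hk, Function.update_self, List.length_map]
      · rw [Function.update_of_ne hk]; exact Nat.zero_le _
    have h3 : (c.stk M.tm.k₁).length = y.length := by rw [← hy, List.length_map]
    have h4 : C * s ≤ C * (z.length + t) := Nat.mul_le_mul_left C (by simp only at hle; omega)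
    simp only [Y, Polynomial.eval_add, Polynomial.eval_mul, Polynomial.eval_X,
      Polynomial.eval_comp, Polynomial.eval_C]
    have h5 : (c.stk M.tm.k₁).length ≤ _ + C * s := h1
    simp only at h5
    omega
  have hyz : csize (y, z) ≤ B.eval (z.length + t) := by
    have := csize_bits_le y
    rw [csize_pair]
    simp only [B, Polynomial.eval_add, Polynomial.eval_mul, Polynomial.eval_ofNat]
    omega
  have hpo : (post (y, z)).length ≤ ro.eval (B.eval (z.length + t)) :=
    (Nat.le_succ _).trans ((length_le_csize _).trans ((hro _).trans (eval_mono ro hyz)))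
  obtain ⟨r₁, h₁⟩ := hcp z [] none
  have k₁ := (runLe_readBits z [] none).seq (h₁.seq
    ((show RunLe (.pop .a) ⟨(enc (pre z, z)).ser ++ [], [], [], [], r₁⟩
      ⟨(enc (pre z)).ser ++ (enc z).ser, [], [], [], some true⟩ 1 by
        rw [List.append_nil]; exact (Run.pop _ _).le).seq
      (runLe_writeBits (pre z) (enc z).ser (some true))))
  obtain ⟨r₂, h₂⟩ := hco (y, z) [] none
  have k₂ := (runLe_readBits y (enc z).ser none).seq
    ((show RunLe (.push .a (some true)) ⟨(enc y).ser ++ (enc z).ser, [], [], [], none⟩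
      ⟨(enc (y, z)).ser ++ [], [], [], [], none⟩ 1 by
        rw [List.append_nil]; exact (Run.push _ _ _).le).seq
      (h₂.seq (runLe_writeBits (post (y, z)) [] r₂)))
  obtain ⟨c, ⟨⟨e, hle⟩⟩, hl, hc⟩ := reach_callMachine M _ _ k₁ k₂ h
  refine ⟨c, ⟨⟨e, hle.trans ?_⟩⟩, hl, hc⟩
  have hqp := eval_mono qp hz
  have hqo := eval_mono qo hyz
  simp only [Polynomial.eval_add, Polynomial.eval_mul, Polynomial.eval_X,
      Polynomial.eval_comp, Polynomial.eval_ofNat, Polynomial.eval_one]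
  omega

end KneserTucker

namespace KneserTucker

open Code

/-! ### Polynomial-time functions on lists and numbers -/

section
variable {α β γ δ : Type} [Code α] [Code β] [Code γ] [Code δ]

@[fun_prop]
theorem PT.tail {l : α → List β} (hl : PT l) : PT fun a => (l a).tail := by
  refine (PT.listCases (f := fun _ : α => ([] : List β)) (g := fun _ _ t => t) hl (by fun_prop)
    (by fun_prop)).of_enc_eq fun a => ?_
  cases l a <;> rfl

@[fun_prop]
theorem PT.headD {l : α → List β} {d : α → β} (hl : PT l) (hd : PT d) :
    PT fun a => (l a).headD (d a) := by
  refine (PT.listCases (f := d) (g := fun _ b _ => b) hl hd (by fun_prop)).of_enc_eq fun a => ?_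
  cases l a <;> rfl

theorem PT.natCases {n : α → ℕ} {f : α → γ} {g : α → ℕ → γ} (hn : PT n) (hf : PT f)
    (hg : PT fun x : α × ℕ => g x.1 x.2) :
    PT fun a => match n a with
      | 0 => f a
      | k + 1 => g a k := by
  refine PT.branch (h := fun x : α × (Unit × ℕ) => g x.1 x.2.2) hn hf
    (hg.comp (f := fun x : α × (Unit × ℕ) => (x.1, x.2.2)) (by fun_prop)) (fun a h => ?_)
    (fun a h => ?_)
  · cases hna : n a
    · rfl
    · rw [hna] at h; cases h
  · cases hna : n a with
    | zero => rw [hna] at h; exact absurd rfl h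
    | succ k => exact ⟨((), k), rfl, rfl⟩

-- Later definitions phrase their case distinctions as tests for zero, with truncated subtraction
-- where needed, so that this rule covers them.
@[fun_prop]
theorem PT.ite_eq_zero {n : α → ℕ} {f g : α → γ} (hn : PT n) (hf : PT f) (hg : PT g) :
    PT fun a => if n a = 0 then f a else g a := by
  refine (PT.natCases (g := fun a _ => g a) hn hf (hg.comp PT.fst)).of_enc_eq fun a => ?_
  cases n a <;> rfl

@[fun_prop]
theorem PT.pred {n : α → ℕ} (hn : PT n) : PT fun a => n a - 1 := by
  refine (PT.natCases (f := fun _ => 0) (g := fun _ k => k) hn (by fun_prop)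
    (by fun_prop)).of_enc_eq fun a => ?_
  cases n a <;> rfl

theorem foldl_cons_eq {X : Type} (l m : List X) : l.foldl (fun acc x => x :: acc) m = l.reverse ++ m := by
  induction l generalizing m with
  | nil => rfl
  | cons x l ih => rw [List.foldl_cons, ih]; simp

theorem PT.reverseAppend {f g : α → List β} (hf : PT f) (hg : PT g) :
    PT fun a => (f a).reverse ++ g a := by
  obtain ⟨q, hq⟩ := hf.size_le
  obtain ⟨r, hr⟩ := hg.size_le
  refine (PT.foldl (s := fun _ acc x => x :: acc) hf hg (by fun_prop)
    ⟨q + r, fun a k => ?_⟩).of_enc_eq fun a => by rw [foldl_cons_eq]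
  rw [foldl_cons_eq, Polynomial.eval_add]
  have h1 := csize_append ((f a).take k).reverse (g a)
  rw [csize_reverse] at h1
  have := csize_take_le (f a) k
  have := hq a
  have := hr a
  omega

@[fun_prop]
theorem PT.reverse {f : α → List β} (hf : PT f) : PT fun a => (f a).reverse :=
  (PT.reverseAppend hf (PT.const [])).of_enc_eq fun a => by rw [List.append_nil]

@[fun_prop]
theorem PT.append {f g : α → List β} (hf : PT f) (hg : PT g) : PT fun a => f a ++ g a :=
  (PT.reverseAppend hf.reverse hg).of_enc_eq fun a => by rw [List.reverse_reverse]

theorem csize_le_of_forall {l : List α} {B : ℕ} (h : ∀ a ∈ l, csize a ≤ B) :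
    csize l ≤ l.length * (B + 1) + 1 := by
  induction l with
  | nil => simp [csize_nil]
  | cons a l ih =>
    have h1 := h a List.mem_cons_self
    have h2 := ih fun a ha => h a (List.mem_cons_of_mem _ ha)
    rw [csize_cons, List.length_cons, add_mul]
    omega

theorem foldl_map_cons_eq {X Y : Type} (f : X → Y) (l : List X) (m : List Y) :
    l.foldl (fun acc x => f x :: acc) m = (l.map f).reverse ++ m := by
  induction l generalizing m with
  | nil => rfl
  | cons x l ih => rw [List.foldl_cons, ih]; simp

@[fun_prop]
theorem PT.map {l : α → List β} {f : α → β → γ} (hl : PT l) (hf : PT fun x : α × β => f x.1 x.2) :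
    PT fun a => (l a).map (f a) := by
  obtain ⟨q, hq⟩ := hl.size_le
  obtain ⟨r, hr⟩ := hf.size_le
  have h : PT fun a => (l a).foldl (fun acc x => f a x :: acc) [] := by
    refine PT.foldl (s := fun a acc x => f a x :: acc) hl (PT.const []) ?_
      ⟨q * (r.comp (Polynomial.X + q + 1) + 1) + 1, fun a k => ?_⟩
    · exact (hf.comp (f := fun x : (α × List γ) × β => (x.1.1, x.2)) (by fun_prop)).cons
        (by fun_prop)
    · rw [foldl_map_cons_eq, List.append_nil, csize_reverse]
      have hB : ∀ y ∈ ((l a).take k).map (f a),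
          csize y ≤ r.eval (csize a + q.eval (csize a) + 1) := by
        intro y hy
        obtain ⟨x, hx, rfl⟩ := List.mem_map.mp hy
        refine (hr (a, x)).trans (eval_mono r ?_)
        rw [csize_pair]
        have := csize_le_of_mem (List.mem_of_mem_take hx)
        have := hq a
        omega
      refine (csize_le_of_forall hB).trans ?_
      simp only [Polynomial.eval_add, Polynomial.eval_mul, Polynomial.eval_X,
        Polynomial.eval_comp, Polynomial.eval_one]
      refine Nat.succ_le_succ (Nat.mul_le_mul_right _ ?_)
      rw [List.length_map]
      have := length_le_csize ((l a).take k)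
      have := csize_take_le (l a) k
      have := hq a
      omega
  exact h.reverse.of_enc_eq fun a => by
    rw [foldl_map_cons_eq, List.append_nil, List.reverse_reverse]

theorem csize_flatten_le (l : List (List α)) : csize l.flatten ≤ csize l := by
  induction l with
  | nil => exact le_rfl
  | cons a l ih =>
    have := csize_append a l.flatten
    rw [List.flatten_cons, csize_cons]
    omega

theorem foldl_append_eq {X : Type} (l : List (List X)) (m : List X) :
    l.foldl (fun acc x => acc ++ x) m = m ++ l.flatten := by
  induction l generalizing m with
  | nil => simp
  | cons x l ih => rw [List.foldl_cons, ih]; simp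

@[fun_prop]
theorem PT.flatten {l : α → List (List β)} (hl : PT l) : PT fun a => (l a).flatten := by
  obtain ⟨q, hq⟩ := hl.size_le
  refine (PT.foldl (i := fun _ => []) (s := fun _ acc x => acc ++ x) hl (PT.const [])
    (by fun_prop) ⟨q, fun a k => ?_⟩).of_enc_eq fun a => by rw [foldl_append_eq, List.nil_append]
  rw [foldl_append_eq, List.nil_append]
  exact (csize_flatten_le _).trans ((csize_take_le _ _).trans (hq a))

@[fun_prop]
theorem PT.flatMap {l : α → List β} {f : α → β → List γ} (hl : PT l)
    (hf : PT fun x : α × β => f x.1 x.2) : PT fun a => (l a).flatMap (f a) :=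
  (hl.map hf).flatten

@[fun_prop]
theorem PT.length {l : α → List β} (hl : PT l) : PT fun a => (l a).length := by
  refine (hl.map (f := fun _ _ => ()) (by fun_prop)).of_enc_eq fun a => ?_
  rw [← enc_replicate_unit, List.map_const']

@[fun_prop]
theorem PT.add {m n : α → ℕ} (hm : PT m) (hn : PT n) : PT fun a => m a + n a :=
  (hm.replicate_unit.append hn.replicate_unit).of_enc_eq fun a => by
    rw [← enc_replicate_unit, List.replicate_add]

@[fun_prop]
theorem PT.mul {m n : α → ℕ} (hm : PT m) (hn : PT n) : PT fun a => m a * n a := by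
  refine (hm.replicate_unit.flatMap (f := fun a _ => List.replicate (n a) ())
    (hn.replicate_unit.comp PT.fst)).of_enc_eq fun a => ?_
  rw [← enc_replicate_unit]
  congr 1
  generalize m a = k
  induction k with
  | zero => simp
  | succ k ih =>
    rw [add_mul, one_mul, add_comm, List.replicate_add, ih, List.replicate_succ, List.flatMap_cons]

/-- The length of the accumulator is always the next number to be listed. -/
theorem foldl_range_eq (n : ℕ) :
    (List.replicate n ()).foldl (fun (acc : List ℕ) _ => acc.length :: acc) [] =
      (List.range n).reverse := by
  induction n with
  | zero => rfl
  | succ n ih =>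
    rw [List.replicate_succ', List.foldl_append, ih, List.range_succ]
    simp

@[fun_prop]
theorem PT.range {n : α → ℕ} (hn : PT n) : PT fun a => List.range (n a) := by
  obtain ⟨q, hq⟩ := hn.size_le
  have h : PT fun a => (List.replicate (n a) ()).foldl
      (fun (acc : List ℕ) _ => acc.length :: acc) [] := by
    refine PT.foldl (s := fun _ acc _ => acc.length :: acc) hn.replicate_unit (PT.const [])
      (by fun_prop) ⟨q * (q + 1) + 1, fun a k => ?_⟩
    rw [List.take_replicate, foldl_range_eq, csize_reverse]
    have hq' := hq a
    rw [csize_nat] at hq'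
    have hB : ∀ i ∈ List.range (min k (n a)), csize i ≤ q.eval (csize a) := by
      intro i hi
      rw [csize_nat]
      have := List.mem_range.mp hi
      omega
    refine (csize_le_of_forall hB).trans ?_
    simp only [Polynomial.eval_add, Polynomial.eval_mul, Polynomial.eval_one, List.length_range]
    exact Nat.succ_le_succ (Nat.mul_le_mul_right _ (by omega))
  exact h.reverse.of_enc_eq fun a => by rw [foldl_range_eq, List.reverse_reverse]

theorem foldl_tail_eq {X : Type} (l : List X) (n : ℕ) :
    (List.replicate n ()).foldl (fun (acc : List X) _ => acc.tail) l = l.drop n := by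
  induction n with
  | zero => rfl
  | succ n ih =>
    rw [List.replicate_succ', List.foldl_append, ih]
    simp

@[fun_prop]
theorem PT.drop {n : α → ℕ} {l : α → List β} (hn : PT n) (hl : PT l) :
    PT fun a => (l a).drop (n a) := by
  obtain ⟨q, hq⟩ := hl.size_le
  refine (PT.foldl (s := fun _ acc _ => acc.tail) hn.replicate_unit hl (by fun_prop)
    ⟨q, fun a k => ?_⟩).of_enc_eq fun a => by rw [foldl_tail_eq]
  rw [List.take_replicate, foldl_tail_eq]
  exact (csize_drop_le _ _).trans (hq a)

@[fun_prop]
theorem PT.sub {m n : α → ℕ} (hm : PT m) (hn : PT n) : PT fun a => m a - n a :=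
  (PT.drop hn hm.replicate_unit).of_enc_eq fun a => by
    rw [← enc_replicate_unit, List.drop_replicate]

@[fun_prop]
theorem PT.take {n : α → ℕ} {l : α → List β} (hn : PT n) (hl : PT l) :
    PT fun a => (l a).take (n a) := by
  have h : PT fun a => ((l a).reverse.drop ((l a).length - n a)).reverse := by fun_prop
  refine h.of_enc_eq fun a => ?_
  rw [List.drop_reverse, List.reverse_reverse]
  congr 1
  rw [List.take_eq_take_iff]
  omega

@[fun_prop]
theorem PT.getD {n : α → ℕ} {l : α → List β} {d : α → β} (hn : PT n) (hl : PT l) (hd : PT d) :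
    PT fun a => (l a).getD (n a) (d a) := by
  refine (PT.headD (PT.drop hn hl) hd).of_enc_eq fun a => ?_
  rw [List.headD_eq_head?_getD, List.head?_drop, List.getD_eq_getElem?_getD]

@[fun_prop]
theorem PT.replicate {n : α → ℕ} {f : α → β} (hn : PT n) (hf : PT f) :
    PT fun a => List.replicate (n a) (f a) := by
  refine (hn.replicate_unit.map (f := fun a _ => f a) (hf.comp PT.fst)).of_enc_eq fun a => ?_
  rw [List.map_replicate]

theorem csize_foldl_le {X : Type} {s : γ → X → γ} {C : ℕ} (h : ∀ y x, csize (s y x) ≤ csize y + C)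
    (l : List X) (y : γ) : csize (l.foldl s y) ≤ csize y + l.length * C := by
  induction l generalizing y with
  | nil => simp
  | cons x l ih =>
    have := h y x
    have := ih (s y x)
    rw [List.foldl_cons, List.length_cons, add_mul]
    omega

/-- Folds with steps that increase the size by a bounded amount. -/
theorem PT.foldl_of_le {l : α → List β} {i : α → γ} {s : α → γ → β → γ} (hl : PT l) (hi : PT i)
    (hs : PT fun x : (α × γ) × β => s x.1.1 x.1.2 x.2) {C : ℕ}
    (hC : ∀ a y x, csize (s a y x) ≤ csize y + C) : PT fun a => (l a).foldl (s a) (i a) := by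
  obtain ⟨q, hq⟩ := hl.size_le
  obtain ⟨r, hr⟩ := hi.size_le
  refine PT.foldl hl hi hs ⟨r + q * Polynomial.C C, fun a k => ?_⟩
  refine (csize_foldl_le (hC a) _ _).trans ?_
  rw [Polynomial.eval_add, Polynomial.eval_mul, Polynomial.eval_C]
  refine add_le_add (hr a) (Nat.mul_le_mul_right _ ?_)
  have := length_le_csize ((l a).take k)
  have := csize_take_le (l a) k
  have := hq a
  omega

end

end KneserTucker

namespace KneserTucker

open Code

/-! ### Decoding strings -/

/-- The list of numbers whose unary encodings are concatenated in a string. -/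
def decodeNats (z : List Bool) : List ℕ :=
  z.reverse.foldl (fun acc b => bif b then (acc.headD 0 + 1) :: acc.tail else 0 :: acc) []

/-- Read from the right, a `false` opens a new number `0` at the head of the list, and each `true`
before it adds one. -/
theorem decodeNats_flatMap (l : List ℕ) : decodeNats (l.flatMap encNat) = l := by
  unfold decodeNats
  rw [List.foldl_reverse]
  have h : ∀ (k m : ℕ) (acc : List ℕ), (List.replicate k true).foldr
      (fun b (acc : List ℕ) => bif b then (acc.headD 0 + 1) :: acc.tail else 0 :: acc)
      (m :: acc) = (m + k) :: acc := by
    intro k m acc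
    induction k with
    | zero => rfl
    | succ k ih => rw [List.replicate_succ, List.foldr_cons, ih]; rfl
  induction l with
  | nil => rfl
  | cons k l ih =>
    rw [List.flatMap_cons, List.foldr_append, ih, encNat, List.foldr_append]
    refine (h k 0 l).trans ?_
    rw [zero_add]

@[fun_prop]
theorem PT.decodeNats {α : Type} [Code α] {z : α → List Bool} (hz : PT z) :
    PT fun a => decodeNats (z a) := by
  refine PT.foldl_of_le (C := 4) (i := fun _ => ([] : List ℕ))
    (s := fun _ acc b => bif b then (acc.headD 0 + 1) :: acc.tail else 0 :: acc)
    hz.reverse (PT.const []) (by fun_prop) fun a y x => ?_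
  cases x
  · simp only [cond_false, csize_cons, csize_nat]; omega
  · cases y <;> simp only [cond_true, csize_cons, csize_nat, List.headD_nil, List.headD_cons,
      List.tail_nil, List.tail_cons, csize_nil] <;> omega

@[fun_prop]
theorem PT.encNat {α : Type} [Code α] {n : α → ℕ} (hn : PT n) : PT fun a => encNat (n a) := by
  unfold KneserTucker.encNat
  fun_prop

/-- One step of `unpair`. -/
def unpairStep (s : ℕ × List Bool × List Bool) (b : Bool) : ℕ × List Bool × List Bool :=
  if s.1 = 0 then (bif b then (1, s.2) else (2, s.2))
  else if s.1 - 1 = 0 then (0, b :: s.2.1, s.2.2)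
  else (s.1, s.2.1, b :: s.2.2)

/-- The inverse of `encPair`. -/
def unpair (z : List Bool) : List Bool × List Bool :=
  ((z.foldl unpairStep (0, [], [])).2.1.reverse, (z.foldl unpairStep (0, [], [])).2.2.reverse)

/-- The control number is `0` where a marker bit is expected, `1` where a bit of the first string is
expected, and `2` after the end mark. -/
theorem unpair_encPair (x y : List Bool) : unpair (encPair x y) = (x, y) := by
  have h1 : ∀ (x acc : List Bool), (x.flatMap fun b => [true, b]).foldl unpairStep (0, acc, []) =
      (0, x.reverse ++ acc, []) := by
    intro x
    induction x with
    | nil => exact fun _ => rfl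
    | cons b x ih =>
      intro acc
      rw [List.flatMap_cons, List.foldl_append]
      refine (ih (b :: acc)).trans ?_
      simp
  have h2 : ∀ (y a b : List Bool), y.foldl unpairStep (2, a, b) = (2, a, y.reverse ++ b) := by
    intro y
    induction y with
    | nil => exact fun _ _ => rfl
    | cons c y ih =>
      intro a b
      refine (ih a (c :: b)).trans ?_
      simp
  have h3 : (encPair x y).foldl unpairStep (0, [], []) = (2, x.reverse ++ [], y.reverse ++ []) := by
    rw [encPair, List.foldl_append, h1]
    exact h2 y _ _
  rw [unpair, h3]
  simp

@[fun_prop]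
theorem PT.unpair {α : Type} [Code α] {z : α → List Bool} (hz : PT z) : PT fun a => unpair (z a) := by
  have h : PT fun a => (z a).foldl unpairStep (0, [], []) := by
    refine PT.foldl_of_le (C := 8) (i := fun _ => (0, [], [])) (s := fun _ => unpairStep) hz
      (PT.const _) (by unfold unpairStep; fun_prop) fun _ s b => ?_
    have := csize_bool b
    have h1 := csize_prod s
    have h2 := csize_prod s.2
    have := csize_pos s.1
    unfold unpairStep
    split_ifs
    · cases b <;> simp only [cond_true, cond_false, csize_pair, csize_nat] <;> omega
    · simp only [csize_pair, csize_cons, csize_nat] at *; omega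
    · simp only [csize_pair, csize_cons, csize_nat] at *; omega
  unfold KneserTucker.unpair
  fun_prop

/-! ### Gates as triples of numbers -/

/-- The gate described by a triple of numbers. -/
def toGate (g : ℕ × ℕ × ℕ) : Gate :=
  if g.1 = 0 then .const false else if g.1 - 1 = 0 then .const true
  else if g.1 - 2 = 0 then .neg g.2.1 else if g.1 - 3 = 0 then .conj g.2.1 g.2.2
  else .disj g.2.1 g.2.2

/-- A triple of numbers describing a gate. -/
def ofGate : Gate → ℕ × ℕ × ℕ
  | .const false => (0, 0, 0)
  | .const true => (1, 0, 0)
  | .neg i => (2, i, 0)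
  | .conj i j => (3, i, j)
  | .disj i j => (4, i, j)

theorem toGate_ofGate (g : Gate) : toGate (ofGate g) = g := by
  rcases g with (_ | _) | _ | _ | _ <;> rfl

theorem toGate_false (i j : ℕ) : toGate (0, i, j) = .const false := rfl
theorem toGate_true (i j : ℕ) : toGate (1, i, j) = .const true := rfl
theorem toGate_neg (i j : ℕ) : toGate (2, i, j) = .neg i := rfl
theorem toGate_conj (i j : ℕ) : toGate (3, i, j) = .conj i j := rfl
theorem toGate_disj (i j : ℕ) : toGate (4, i, j) = .disj i j := rfl

/-- The numbers in the encoding of a gate. -/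
def gateNats (g : ℕ × ℕ × ℕ) : List ℕ :=
  if g.1 = 0 then [0] else if g.1 - 1 = 0 then [1]
  else if g.1 - 2 = 0 then [2, g.2.1] else if g.1 - 3 = 0 then [3, g.2.1, g.2.2]
  else [4, g.2.1, g.2.2]

theorem flatMap_gateNats (g : ℕ × ℕ × ℕ) : (gateNats g).flatMap encNat = (toGate g).enc := by
  unfold gateNats toGate
  split_ifs <;> simp [Gate.enc]

@[fun_prop]
theorem PT.gateNats {α : Type} [Code α] {g : α → ℕ × ℕ × ℕ} (hg : PT g) :
    PT fun a => gateNats (g a) := by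
  unfold KneserTucker.gateNats
  fun_prop

/-- The numbers in the encoding of a circuit. -/
def circuitNats (n : ℕ) (gs : List (ℕ × ℕ × ℕ)) (outs : List ℕ) : List ℕ :=
  n :: gs.length :: (gs.flatMap gateNats ++ outs.length :: outs)

theorem flatMap_circuitNats {n m : ℕ} (C : Circuit n m) (gs : List (ℕ × ℕ × ℕ))
    (h : C.gates = gs.map toGate) :
    (circuitNats n gs (List.ofFn C.outputs)).flatMap encNat = C.enc := by
  simp only [circuitNats, Circuit.enc, h, List.flatMap_cons, List.flatMap_append, List.length_map,
    List.length_ofFn, List.flatMap_assoc, flatMap_gateNats, List.flatMap_map, List.append_assoc]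

@[fun_prop]
theorem PT.circuitNats {α : Type} [Code α] {n : α → ℕ} {gs : α → List (ℕ × ℕ × ℕ)}
    {outs : α → List ℕ} (hn : PT n) (hg : PT gs) (ho : PT outs) :
    PT fun a => circuitNats (n a) (gs a) (outs a) := by
  unfold KneserTucker.circuitNats
  fun_prop

/-- Read one gate from a list of numbers. -/
def gateStep (s : List ℕ × List (ℕ × ℕ × ℕ)) : List ℕ × List (ℕ × ℕ × ℕ) :=
  if s.1.headD 0 = 0 then (s.1.tail, (0, 0, 0) :: s.2)
  else if s.1.headD 0 - 1 = 0 then (s.1.tail, (1, 0, 0) :: s.2)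
  else if s.1.headD 0 - 2 = 0 then (s.1.tail.tail, (2, s.1.tail.headD 0, 0) :: s.2)
  else (s.1.tail.tail.tail, (s.1.headD 0, s.1.tail.headD 0, s.1.tail.tail.headD 0) :: s.2)

/-- Read a number of gates from a list of numbers. -/
def readGates (k : ℕ) (l : List ℕ) : List ℕ × List (ℕ × ℕ × ℕ) :=
  (List.replicate k ()).foldl (fun s _ => gateStep s) (l, [])

/-- The number of inputs, the gates, and the outputs of a circuit with the given numbers. -/
def parseCircuit (l : List ℕ) : ℕ × List (ℕ × ℕ × ℕ) × List ℕ :=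
  (l.headD 0, (readGates (l.tail.headD 0) l.tail.tail).2.reverse,
    (readGates (l.tail.headD 0) l.tail.tail).1.tail)

/-- The first number of a gate determines how many more belong to it, so gates are read without
lookahead. What follows them is the number of outputs, dropped by `tail`, and the outputs. -/
theorem parseCircuit_decodeNats {n m : ℕ} (C : Circuit n m) :
    parseCircuit (decodeNats C.enc) = (n, C.gates.map ofGate, List.ofFn C.outputs) := by
  have h1 : C.gates = (C.gates.map ofGate).map toGate := by
    rw [List.map_map]
    conv_lhs => rw [← List.map_id C.gates]
    exact List.map_congr_left fun g _ => (toGate_ofGate g).symm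
  have h2 : ∀ (gs : List Gate) (t : List ℕ) (acc : List (ℕ × ℕ × ℕ)),
      (List.replicate gs.length ()).foldl (fun s _ => gateStep s)
        ((gs.map ofGate).flatMap gateNats ++ t, acc) = (t, (gs.map ofGate).reverse ++ acc) := by
    intro gs
    induction gs with
    | nil => exact fun t acc => rfl
    | cons g gs ih =>
      intro t acc
      have hs : gateStep (gateNats (ofGate g) ++ ((gs.map ofGate).flatMap gateNats ++ t), acc) =
          ((gs.map ofGate).flatMap gateNats ++ t, ofGate g :: acc) := by
        rcases g with (_ | _) | _ | _ | _ <;> rfl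
      rw [List.length_cons, List.replicate_succ, List.foldl_cons, List.map_cons, List.flatMap_cons,
        List.append_assoc, hs, ih, List.reverse_cons, List.append_assoc]
      rfl
  rw [← flatMap_circuitNats C _ h1, decodeNats_flatMap]
  have h3 := h2 C.gates (m :: List.ofFn C.outputs) []
  simp only [parseCircuit, circuitNats, readGates, List.headD_cons, List.tail_cons,
    List.length_map, List.length_ofFn, h3, List.append_nil, List.reverse_reverse]

/-- Numbers are moved, not copied, from the input list to the gate, so a step adds only a constant;
this is the condition for folding it. -/
theorem csize_gateStep_le (s : List ℕ × List (ℕ × ℕ × ℕ)) :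
    csize (gateStep s) ≤ csize s + 12 := by
  obtain ⟨l, acc⟩ := s
  have key : ∀ l : List ℕ, csize (l.headD 0) + csize l.tail ≤ csize l + 1 := by
    intro l
    cases l with
    | nil => exact le_rfl
    | cons a l => rw [csize_cons]; simp only [List.headD_cons, List.tail_cons]; omega
  have h1 := key l
  have h2 := key l.tail
  have h3 := key l.tail.tail
  have := csize_pos (l.headD 0)
  have := csize_pos (l.tail.headD 0)
  have e0 : csize (0 : ℕ) = 1 := rfl
  have e1 : csize (1 : ℕ) = 3 := rfl
  have e2 : csize (2 : ℕ) = 5 := rfl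
  unfold gateStep
  split_ifs <;> simp only [csize_pair, csize_cons, e0, e1, e2] <;> omega

@[fun_prop]
theorem PT.readGates {α : Type} [Code α] {k : α → ℕ} {l : α → List ℕ} (hk : PT k) (hl : PT l) :
    PT fun a => readGates (k a) (l a) :=
  PT.foldl_of_le (C := 12) (s := fun _ s _ => gateStep s) hk.replicate_unit
    (hl.pair (PT.const [])) (by unfold gateStep; fun_prop) fun _ s _ => csize_gateStep_le s

@[fun_prop]
theorem PT.parseCircuit {α : Type} [Code α] {l : α → List ℕ} (hl : PT l) :
    PT fun a => parseCircuit (l a) := by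
  unfold KneserTucker.parseCircuit
  fun_prop

/-! ### Evaluation of circuits -/

/-- Value of a gate, given the values of all wires. -/
def evalAt (v : ℕ → Bool) : Gate → Bool
  | .const b => b
  | .neg i => !v i
  | .conj i j => v i && v j
  | .disj i j => v i || v j

theorem Gate.eval_eq_evalAt (w : List Bool) (g : Gate) :
    g.eval w = evalAt (fun i => w.getD i false) g := by
  cases g <;> rfl

/-- The values of all wires, given the values of the inputs. -/
def runGates (gs : List (ℕ × ℕ × ℕ)) (w : List Bool) : List Bool :=
  gs.foldl (fun w g => w ++ [(toGate g).eval w]) w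

@[fun_prop]
theorem PT.runGates {α : Type} [Code α] {gs : α → List (ℕ × ℕ × ℕ)} {w : α → List Bool}
    (hg : PT gs) (hw : PT w) : PT fun a => runGates (gs a) (w a) := by
  have h : ∀ (w : List Bool) (g : ℕ × ℕ × ℕ), (toGate g).eval w =
      if g.1 = 0 then false else if g.1 - 1 = 0 then true
      else if g.1 - 2 = 0 then bif w.getD g.2.1 false then false else true
      else if g.1 - 3 = 0 then bif w.getD g.2.1 false then w.getD g.2.2 false else false
      else bif w.getD g.2.1 false then true else w.getD g.2.2 false := by
    intro w g
    unfold toGate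
    split_ifs
    · rfl
    · rfl
    · simp only [Gate.eval]; cases w.getD g.2.1 false <;> rfl
    · simp only [Gate.eval]; cases w.getD g.2.1 false <;> rfl
    · simp only [Gate.eval]; cases w.getD g.2.1 false <;> rfl
  unfold KneserTucker.runGates
  simp only [h]
  have h2 : ∀ (y : List Bool) (b : Bool), csize (y ++ [b]) ≤ csize y + 5 := by
    intro y b
    have h3 := csize_append y [b]
    rw [csize_cons, csize_nil] at h3
    have := csize_bool b
    omega
  exact PT.foldl_of_le (C := 5) (s := fun _ w (g : ℕ × ℕ × ℕ) => w ++ [_]) hg hw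
    (by fun_prop) fun _ y x => h2 y _

end KneserTucker

namespace KneserTucker

open Code

/-! ### Lists of gates placed at an address -/

/-- The relation `R` holds between the gates of the list and their addresses, which start at `b`. -/
def At (R : ℕ → ℕ × ℕ × ℕ → Prop) (b : ℕ) (gs : List (ℕ × ℕ × ℕ)) : Prop :=
  ∀ k g, gs[k]? = some g → R (b + k) g

section At

variable {R : ℕ → ℕ × ℕ × ℕ → Prop} {b : ℕ} {gs gs' : List (ℕ × ℕ × ℕ)}

theorem at_nil : At R b [] := fun k g h => by simp at h

theorem at_append : At R b (gs ++ gs') ↔ At R b gs ∧ At R (b + gs.length) gs' := by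
  constructor
  · refine fun h => ⟨fun k g hk => h k g ?_, fun k g hk => ?_⟩
    · rw [List.getElem?_append_left (List.getElem?_eq_some_iff.mp hk).1, hk]
    · rw [add_assoc]
      refine h _ g ?_
      rw [List.getElem?_append_right (Nat.le_add_right _ _), Nat.add_sub_cancel_left, hk]
  · rintro ⟨h1, h2⟩ k g hk
    rcases lt_or_ge k gs.length with hl | hl
    · rw [List.getElem?_append_left hl] at hk
      exact h1 k g hk
    · rw [List.getElem?_append_right hl] at hk
      have := h2 _ g hk
      rwa [show b + gs.length + (k - gs.length) = b + k by omega] at this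

theorem at_cons {g : ℕ × ℕ × ℕ} : At R b (g :: gs) ↔ R b g ∧ At R (b + 1) gs := by
  rw [show g :: gs = [g] ++ gs from rfl, at_append]
  refine and_congr ⟨fun h => h 0 g rfl, fun h k g' hk => ?_⟩ Iff.rfl
  obtain ⟨h1, h2⟩ := List.getElem?_eq_some_iff.mp hk
  obtain rfl : k = 0 := by simpa using h1
  cases h2
  exact h

theorem at_singleton {g : ℕ × ℕ × ℕ} : At R b [g] ↔ R b g := by
  rw [at_cons]
  exact and_iff_left at_nil

theorem at_map {l : List (ℕ × ℕ × ℕ)} {f : ℕ × ℕ × ℕ → ℕ × ℕ × ℕ} :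
    At R b (l.map f) ↔ At (fun a g => R a (f g)) b l := by
  constructor
  · exact fun h k g hk => h k (f g) (by rw [List.getElem?_map, hk]; rfl)
  · intro h k g hk
    rw [List.getElem?_map, Option.map_eq_some_iff] at hk
    obtain ⟨g', h1, rfl⟩ := hk
    exact h k g' h1

theorem at_map_range {n : ℕ} {f : ℕ → ℕ × ℕ × ℕ} :
    At R b ((List.range n).map f) ↔ ∀ i < n, R (b + i) (f i) := by
  constructor
  · exact fun h i hi => h i (f i) (by simp [hi])
  · intro h k g hk
    obtain ⟨h1, h2⟩ := List.getElem?_eq_some_iff.mp hk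
    have h3 : k < n := by simpa using h1
    have h4 : f k = g := by simpa using h2
    exact h4 ▸ h k h3

theorem at_map_getD {l : List ℕ} {f : ℕ → ℕ × ℕ × ℕ} :
    At R b (l.map f) ↔ ∀ i < l.length, R (b + i) (f (l.getD i 0)) := by
  constructor
  · exact fun h i hi => h i _ (by simp [hi])
  · intro h k g hk
    obtain ⟨h1, h2⟩ := List.getElem?_eq_some_iff.mp hk
    have h3 : k < l.length := by simpa using h1
    have h4 := h k h3
    rw [List.getD_eq_getElem _ _ h3] at h4
    rw [List.getElem_map] at h2
    exact h2 ▸ h4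

theorem length_flatMap_range {n L : ℕ} {f : ℕ → List (ℕ × ℕ × ℕ)}
    (h : ∀ i < n, (f i).length = L) : ((List.range n).flatMap f).length = n * L := by
  induction n with
  | zero => simp
  | succ n ih =>
    rw [List.range_succ, List.flatMap_append, List.length_append, List.flatMap_singleton,
      ih fun i hi => h i (by omega), h n (by omega), Nat.succ_mul]

theorem at_flatMap_range {n L : ℕ} {f : ℕ → List (ℕ × ℕ × ℕ)} (h : ∀ i < n, (f i).length = L) :
    At R b ((List.range n).flatMap f) ↔ ∀ i < n, At R (b + i * L) (f i) := by
  induction n with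
  | zero => simpa using at_nil
  | succ n ih =>
    have h' : ∀ i < n, (f i).length = L := fun i hi => h i (by omega)
    rw [List.range_succ, List.flatMap_append, List.flatMap_singleton, at_append, ih h',
      length_flatMap_range h', Nat.forall_lt_succ_right]

end At

/-- The gate at address `a` has the right value. -/
def Holds (v : ℕ → Bool) (a : ℕ) (g : ℕ × ℕ × ℕ) : Prop := v a = evalAt v (toGate g)

/-- The gate at address `a` reads earlier wires only. -/
def WF (a : ℕ) (g : ℕ × ℕ × ℕ) : Prop := ∀ i ∈ (toGate g).args, i < a

section Gates

variable {v : ℕ → Bool} {a i j : ℕ}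

theorem holds_false : Holds v a (0, i, j) ↔ v a = false := Iff.rfl
theorem holds_neg : Holds v a (2, i, j) ↔ v a = !v i := Iff.rfl
theorem holds_conj : Holds v a (3, i, j) ↔ v a = (v i && v j) := Iff.rfl
theorem holds_disj : Holds v a (4, i, j) ↔ v a = (v i || v j) := Iff.rfl
theorem holds_copy : Holds v a (3, i, i) ↔ v a = v i := by rw [holds_conj, Bool.and_self]

theorem wf_false : WF a (0, i, j) := fun _ h => absurd h (by simp [toGate_false, Gate.args])
theorem wf_true : WF a (1, i, j) := fun _ h => absurd h (by simp [toGate_true, Gate.args])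
theorem wf_neg : WF a (2, i, j) ↔ i < a := by simp [WF, toGate_neg, Gate.args]
theorem wf_conj : WF a (3, i, j) ↔ i < a ∧ j < a := by simp [WF, toGate_conj, Gate.args]
theorem wf_disj : WF a (4, i, j) ↔ i < a ∧ j < a := by simp [WF, toGate_disj, Gate.args]

end Gates

theorem evalAt_congr {v v' : ℕ → Bool} {g : Gate} (h : ∀ i ∈ g.args, v i = v' i) :
    evalAt v g = evalAt v' g := by
  cases g with
  | const b => rfl
  | neg i => simp only [evalAt, h i (by simp [Gate.args])]
  | conj i j => simp only [evalAt, h i (by simp [Gate.args]), h j (by simp [Gate.args])]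
  | disj i j => simp only [evalAt, h i (by simp [Gate.args]), h j (by simp [Gate.args])]

theorem runGates_getD (gs : List (ℕ × ℕ × ℕ)) {w : List Bool} {i : ℕ} (hi : i < w.length) :
    (runGates gs w).getD i false = w.getD i false := by
  induction gs generalizing w with
  | nil => rfl
  | cons g gs ih =>
    refine (ih (by rw [List.length_append]; omega)).trans ?_
    rw [List.getD_append _ _ _ _ hi]

/-- Later gates never change earlier wires, so the final values satisfy all gate equations. Circuits
can thus be treated as systems of equations, which can be split into blocks and solved independently
of the order of evaluation. -/
theorem holds_runGates {gs : List (ℕ × ℕ × ℕ)} {w : List Bool} (h : At WF w.length gs) :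
    At (Holds fun i => (runGates gs w).getD i false) w.length gs := by
  induction gs generalizing w with
  | nil => exact at_nil
  | cons g gs ih =>
    rw [at_cons] at h
    have hl : (w ++ [(toGate g).eval w]).length = w.length + 1 := by simp
    have h2 := ih (w := w ++ [(toGate g).eval w]) (by rw [hl]; exact h.2)
    rw [hl] at h2
    refine at_cons.mpr ⟨?_, h2⟩
    have h3 : ∀ i < w.length + 1, (runGates (g :: gs) w).getD i false =
        (w ++ [(toGate g).eval w]).getD i false :=
      fun i hi => runGates_getD gs (w := w ++ [(toGate g).eval w]) (by rw [hl]; exact hi)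
    change (runGates (g :: gs) w).getD w.length false = _
    rw [h3 _ (Nat.lt_succ_self _), List.getD_append_right _ _ _ _ le_rfl, Nat.sub_self]
    refine (Gate.eval_eq_evalAt w _).trans (evalAt_congr fun i hi => ?_)
    have hi' := h.1 i hi
    rw [h3 i (by omega), List.getD_append _ _ _ _ hi']

/-- The values of the wires are determined by those of the inputs. -/
theorem holds_unique {gs : List (ℕ × ℕ × ℕ)} {n : ℕ} {u u' : ℕ → Bool} (hwf : At WF n gs)
    (h : At (Holds u) n gs) (h' : At (Holds u') n gs) (h0 : ∀ i < n, u i = u' i) {i : ℕ}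
    (hi : i < n + gs.length) : u i = u' i := by
  induction i using Nat.strong_induction_on with
  | _ i ih =>
    rcases lt_or_ge i n with hn | hn
    · exact h0 i hn
    · obtain ⟨k, rfl⟩ := Nat.exists_eq_add_of_le hn
      have hk : gs[k]? = some gs[k] := List.getElem?_eq_getElem (by omega)
      have h1 := h k _ hk
      have h2 := h' k _ hk
      unfold Holds at h1 h2
      rw [h1, h2]
      refine evalAt_congr fun j hj => ?_
      have := hwf k _ hk j hj
      exact ih j this (by omega)

section Circuit

variable {n m : ℕ}

theorem Circuit.map_toGate_ofGate (C : Circuit n m) : (C.gates.map ofGate).map toGate = C.gates := by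
  rw [List.map_map]
  conv_rhs => rw [← List.map_id C.gates]
  exact List.map_congr_left fun g _ => toGate_ofGate g

theorem Circuit.wires_eq (C : Circuit n m) {gs : List (ℕ × ℕ × ℕ)} (h : C.gates = gs.map toGate)
    (x : Fin n → Bool) : C.wires x = runGates gs (List.ofFn x) := by
  unfold Circuit.wires runGates
  rw [h, List.foldl_map]

theorem Circuit.at_wf (C : Circuit n m) {gs : List (ℕ × ℕ × ℕ)} (h : C.gates = gs.map toGate) :
    At WF n gs := by
  intro k g hk i hi
  obtain ⟨h1, h2⟩ := List.getElem?_eq_some_iff.mp hk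
  refine C.gates_wf k (by rw [h, List.length_map]; exact h1) i ?_
  simpa only [h, List.getElem_map, h2] using hi

/-- The wires of a circuit on a given input. -/
def Circuit.wire (C : Circuit n m) (x : Fin n → Bool) (i : ℕ) : Bool := (C.wires x).getD i false

theorem Circuit.wire_input (C : Circuit n m) (x : Fin n → Bool) (i : Fin n) :
    C.wire x i = x i := by
  unfold Circuit.wire
  rw [C.wires_eq C.map_toGate_ofGate.symm, runGates_getD _ (by simp), List.getD_eq_getElem _ _ (by simp)]
  simp

theorem Circuit.holds_wire (C : Circuit n m) {gs : List (ℕ × ℕ × ℕ)} (h : C.gates = gs.map toGate)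
    (x : Fin n → Bool) : At (Holds (C.wire x)) n gs := by
  have := holds_runGates (gs := gs) (w := List.ofFn x) (by simpa using C.at_wf h)
  rw [← C.wires_eq h x, List.length_ofFn] at this
  exact this

end Circuit

/-! ### Blocks of gates -/

/-- Translate the arguments of a gate. -/
def shiftGate (b : ℕ) (g : ℕ × ℕ × ℕ) : ℕ × ℕ × ℕ := (g.1, b + g.2.1, b + g.2.2)

theorem toGate_shiftGate (b : ℕ) (g : ℕ × ℕ × ℕ) (v : ℕ → Bool) :
    evalAt v (toGate (shiftGate b g)) = evalAt (fun i => v (b + i)) (toGate g) := by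
  unfold toGate shiftGate
  dsimp only
  split_ifs <;> rfl

theorem wf_shiftGate {a b : ℕ} {g : ℕ × ℕ × ℕ} (h : WF a g) : WF (b + a) (shiftGate b g) := by
  revert h
  unfold WF toGate shiftGate
  dsimp only
  split_ifs <;> simp [Gate.args]

/-- A disjunction of `n` wires; the result is the wire `b + n`. -/
def orBlock (b n : ℕ) (f : ℕ → ℕ) : List (ℕ × ℕ × ℕ) :=
  (0, 0, 0) :: (List.range n).map fun i => (4, b + i, f i)

theorem length_orBlock (b n : ℕ) (f : ℕ → ℕ) : (orBlock b n f).length = n + 1 := by simp [orBlock]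

theorem wf_orBlock {b n : ℕ} {f : ℕ → ℕ} (h : ∀ i < n, f i < b) : At WF b (orBlock b n f) := by
  refine at_cons.mpr ⟨wf_false, at_map_range.mpr fun i hi => wf_disj.mpr ⟨by omega, ?_⟩⟩
  have := h i hi
  omega

/-- Wire `b + k` is the disjunction of the first `k` inputs, starting from a constant `false`. -/
theorem holds_orBlock {v : ℕ → Bool} {b n : ℕ} {f : ℕ → ℕ} (h : At (Holds v) b (orBlock b n f)) :
    v (b + n) = true ↔ ∃ i < n, v (f i) = true := by
  obtain ⟨h0, h1⟩ := at_cons.mp h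
  rw [at_map_range] at h1
  rw [holds_false] at h0
  have : ∀ k ≤ n, (v (b + k) = true ↔ ∃ i < k, v (f i) = true) := by
    intro k
    induction k with
    | zero => simp [h0]
    | succ k ih =>
      intro hk
      have h2 := h1 k hk
      rw [holds_disj, add_right_comm, add_assoc] at h2
      rw [h2, Bool.or_eq_true, ih (by omega), Nat.exists_lt_succ_right]
  exact this n le_rfl

/-- A copy of a circuit with gates `gs` and outputs `os`, applied to the wires `f i`. -/
def callBlock (b n : ℕ) (f : ℕ → ℕ) (gs : List (ℕ × ℕ × ℕ)) (os : List ℕ) : List (ℕ × ℕ × ℕ) :=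
  (List.range n).map (fun i => (3, f i, f i)) ++
    (gs.map (shiftGate b) ++ os.map fun o => (3, b + o, b + o))

theorem length_callBlock (b n : ℕ) (f : ℕ → ℕ) (gs : List (ℕ × ℕ × ℕ)) (os : List ℕ) :
    (callBlock b n f gs os).length = n + (gs.length + os.length) := by
  simp [callBlock]

section

variable {n m : ℕ} (C : Circuit n m) {gs : List (ℕ × ℕ × ℕ)} {b : ℕ} {f : ℕ → ℕ}

theorem getD_ofFn_outputs (j : Fin m) : (List.ofFn C.outputs).getD j 0 = C.outputs j := by
  rw [List.getD_eq_getElem _ _ (by simp)]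
  simp

theorem wf_callBlock (hg : C.gates = gs.map toGate) (hf : ∀ i < n, f i < b) :
    At WF b (callBlock b n f gs (List.ofFn C.outputs)) := by
  refine at_append.mpr ⟨at_map_range.mpr fun i hi => wf_conj.mpr ?_, at_append.mpr ⟨?_, ?_⟩⟩
  · have := hf i hi
    omega
  · refine at_map.mpr fun k g hk => ?_
    rw [List.length_map, List.length_range, add_assoc]
    exact wf_shiftGate (C.at_wf hg k g hk)
  · refine at_map_getD.mpr fun i hi => ?_
    rw [List.length_ofFn] at hi
    have h1 := C.outputs_wf ⟨i, hi⟩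
    rw [hg, List.length_map] at h1
    rw [getD_ofFn_outputs C ⟨i, hi⟩, wf_conj]
    simp only [List.length_map, List.length_range]
    omega

/-- Copying the inputs to the front of the block makes the wires of the inner circuit contiguous, so
a uniform shift by `b` suffices. The shifted valuation then satisfies the equations of `C` and
agrees with its run by `holds_unique`. -/
theorem holds_callBlock (hg : C.gates = gs.map toGate) {v : ℕ → Bool}
    (h : At (Holds v) b (callBlock b n f gs (List.ofFn C.outputs))) (j : Fin m) :
    v (b + (n + gs.length) + j) = C.eval (fun i => v (f i)) j := by
  obtain ⟨h1, h2⟩ := at_append.mp h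
  obtain ⟨h2, h3⟩ := at_append.mp h2
  rw [at_map_range] at h1
  have h3 := at_map_getD.mp h3 j (by simp)
  rw [getD_ofFn_outputs, holds_copy] at h3
  simp only [List.length_map, List.length_range] at h2 h3
  rw [← add_assoc b, h3]
  refine holds_unique (u := fun i => v (b + i)) (C.at_wf hg) (fun k g hk => ?_) (C.holds_wire hg _)
    (fun i hi => ?_) ?_
  · have : Holds v _ (shiftGate b g) := at_map.mp h2 k g hk
    unfold Holds at this
    rw [toGate_shiftGate, add_assoc] at this
    exact this
  · rw [C.wire_input _ ⟨i, hi⟩]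
    exact holds_copy.mp (h1 i hi)
  · have := C.outputs_wf j
    rwa [hg, List.length_map] at this

end

end KneserTucker

namespace KneserTucker

open Code

/-! ### Blocks for repeated calls, eligibility, scanning, selection and choice -/

theorem add_mul_succ_le {b t p L : ℕ} (h : t < p) : b + t * L + L ≤ b + p * L := by
  have := Nat.mul_le_mul_right L (Nat.succ_le_of_lt h)
  rw [Nat.succ_mul] at this
  omega

theorem mul_add_lt {j N p t : ℕ} (hj : j < N) (ht : t < p) : j * p + t < N * p := by
  have := add_mul_succ_le (b := 0) (L := p) hj
  omega

/-- One copy of a circuit for each of `p` families of wires. -/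
def callsBlock (b p n : ℕ) (f : ℕ → ℕ → ℕ) (gs : List (ℕ × ℕ × ℕ)) (os : List ℕ) :
    List (ℕ × ℕ × ℕ) :=
  (List.range p).flatMap fun t => callBlock (b + t * (n + (gs.length + os.length))) n (f t) gs os

theorem length_callsBlock (b p n : ℕ) (f : ℕ → ℕ → ℕ) (gs : List (ℕ × ℕ × ℕ)) (os : List ℕ) :
    (callsBlock b p n f gs os).length = p * (n + (gs.length + os.length)) :=
  length_flatMap_range fun _ _ => length_callBlock _ _ _ _ _

/-- One disjunction for each of `p` families of wires. -/
def orsBlock (b p n : ℕ) (f : ℕ → ℕ → ℕ) : List (ℕ × ℕ × ℕ) :=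
  (List.range p).flatMap fun t => orBlock (b + t * (n + 1)) n (f t)

theorem length_orsBlock (b p n : ℕ) (f : ℕ → ℕ → ℕ) : (orsBlock b p n f).length = p * (n + 1) :=
  length_flatMap_range fun _ _ => length_orBlock _ _ _

theorem wf_orsBlock {b p n : ℕ} {f : ℕ → ℕ → ℕ} (h : ∀ t < p, ∀ i < n, f t i < b) :
    At WF b (orsBlock b p n f) := by
  refine (at_flatMap_range fun _ _ => length_orBlock _ _ _).mpr fun t ht => wf_orBlock fun i hi => ?_
  have := h t ht i hi
  omega

theorem holds_orsBlock {v : ℕ → Bool} {b p n : ℕ} {f : ℕ → ℕ → ℕ}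
    (h : At (Holds v) b (orsBlock b p n f)) {t : ℕ} (ht : t < p) :
    v (b + t * (n + 1) + n) = true ↔ ∃ i < n, v (f t i) = true :=
  holds_orBlock ((at_flatMap_range fun _ _ => length_orBlock _ _ _).mp h t ht)

section

variable {n m : ℕ} (C : Circuit n m) {gs : List (ℕ × ℕ × ℕ)} {b p : ℕ} {f : ℕ → ℕ → ℕ}

theorem wf_callsBlock (hg : C.gates = gs.map toGate) (hf : ∀ t < p, ∀ i < n, f t i < b) :
    At WF b (callsBlock b p n f gs (List.ofFn C.outputs)) := by
  refine (at_flatMap_range fun _ _ => length_callBlock _ _ _ _ _).mpr fun t ht =>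
    wf_callBlock C hg fun i hi => ?_
  have := hf t ht i hi
  omega

theorem holds_callsBlock (hg : C.gates = gs.map toGate) {v : ℕ → Bool}
    (h : At (Holds v) b (callsBlock b p n f gs (List.ofFn C.outputs))) {t : ℕ} (ht : t < p)
    (j : Fin m) : v (b + t * (n + (gs.length + (List.ofFn C.outputs).length)) + (n + gs.length) + j) =
      C.eval (fun i => v (f t i)) j :=
  holds_callBlock C hg ((at_flatMap_range fun _ _ => length_callBlock _ _ _ _ _).mp h t ht) j

end

/-- From wires `e t`, compute whether one of them is true (wire `b + p`), its negation (wire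
`b + p + 1`), and the disjunctions of `e t` with the latter (wires `b + p + 2 + t`). -/
def eligBlock (b p : ℕ) (e : ℕ → ℕ) : List (ℕ × ℕ × ℕ) :=
  orBlock b p e ++ (2, b + p, 0) :: (List.range p).map fun t => (4, e t, b + p + 1)

theorem length_eligBlock (b p : ℕ) (e : ℕ → ℕ) : (eligBlock b p e).length = 2 * p + 2 := by
  simp only [eligBlock, List.length_append, length_orBlock, List.length_cons, List.length_map,
    List.length_range]
  omega

theorem wf_eligBlock {b p : ℕ} {e : ℕ → ℕ} (h : ∀ t < p, e t < b) : At WF b (eligBlock b p e) := by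
  refine at_append.mpr ⟨wf_orBlock h, ?_⟩
  rw [length_orBlock]
  refine at_cons.mpr ⟨wf_neg.mpr (by omega), at_map_range.mpr fun t ht => wf_disj.mpr ?_⟩
  have := h t ht
  omega

/-- The last family is the implication "if some `e` holds, then `e t` holds": without any candidate
all signs are admitted. -/
theorem holds_eligBlock {v : ℕ → Bool} {b p : ℕ} {e : ℕ → ℕ} (h : At (Holds v) b (eligBlock b p e)) :
    (v (b + p) = true ↔ ∃ t < p, v (e t) = true) ∧ v (b + p + 1) = !v (b + p) ∧
      ∀ t < p, v (b + p + 2 + t) = (v (e t) || !v (b + p)) := by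
  obtain ⟨h1, h2⟩ := at_append.mp h
  rw [length_orBlock] at h2
  obtain ⟨h2, h3⟩ := at_cons.mp h2
  rw [at_map_range] at h3
  rw [holds_neg] at h2
  refine ⟨holds_orBlock h1, h2, fun t ht => ?_⟩
  rw [← h2]
  exact holds_disj.mp (h3 t ht)

/-- The entry of a sequence that comes first among the first `j` entries and satisfies `E`. -/
def scan {X : Type*} (E : X → Bool) (x : ℕ → Option X) : ℕ → Option X
  | 0 => none
  | j + 1 => (scan E x j).or ((x j).filter E)

/-- One step of `scanBlock`. -/
def scanStep (p q j : ℕ) (u : ℕ → ℕ) : List (ℕ × ℕ × ℕ) :=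
  orBlock (q + p) p (fun t => q + t) ++ ((2, q + 2 * p, 0) ::
    ((List.range p).map (fun t => (3, j * p + t, u t)) ++
      ((List.range p).map (fun t => (3, q + 2 * p + 2 + t, q + 2 * p + 1)) ++
        (List.range p).map fun t => (4, q + t, q + 3 * p + 2 + t))))

/-- Find the first element of a signed set whose sign is admissible. -/
def scanBlock (b p N : ℕ) (u : ℕ → ℕ) : List (ℕ × ℕ × ℕ) :=
  (List.range p).map (fun _ => (0, 0, 0)) ++
    (List.range N).flatMap fun j => scanStep p (b + j * (4 * p + 2)) j u

theorem length_scanStep (p q j : ℕ) (u : ℕ → ℕ) : (scanStep p q j u).length = 4 * p + 2 := by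
  simp only [scanStep, List.length_append, length_orBlock, List.length_cons, List.length_map,
    List.length_range]
  omega

theorem length_scanBlock (b p N : ℕ) (u : ℕ → ℕ) :
    (scanBlock b p N u).length = p + N * (4 * p + 2) := by
  rw [scanBlock, List.length_append, List.length_map, List.length_range,
    length_flatMap_range fun _ _ => length_scanStep _ _ _ _]

theorem at_scanBlock {R : ℕ → ℕ × ℕ × ℕ → Prop} {b p N : ℕ} {u : ℕ → ℕ} :
    At R b (scanBlock b p N u) ↔ (∀ t < p, R (b + t) (0, 0, 0)) ∧
      ∀ j < N, At R (b + j * (4 * p + 2) + p) (scanStep p (b + j * (4 * p + 2)) j u) := by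
  rw [scanBlock, at_append, at_map_range, at_flatMap_range fun _ _ => length_scanStep _ _ _ _,
    List.length_map, List.length_range]
  refine and_congr Iff.rfl (forall₂_congr fun j hj => ?_)
  rw [add_right_comm]

/-- The layout from `q` on: `p` wires of the old state, the disjunction of these ending at `q + 2 *
p`, its negation, then `p` wires for the admissible sign of the entry, `p` for the same gated by the
negation, and the new state at `q + (4 * p + 2)`. Consecutive steps overlap in the state. -/
theorem at_scanStep {R : ℕ → ℕ × ℕ × ℕ → Prop} {q p j : ℕ} {u : ℕ → ℕ} :
    At R (q + p) (scanStep p q j u) ↔ At R (q + p) (orBlock (q + p) p (fun t => q + t)) ∧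
      R (q + 2 * p + 1) (2, q + 2 * p, 0) ∧
      (∀ t < p, R (q + 2 * p + 2 + t) (3, j * p + t, u t)) ∧
      (∀ t < p, R (q + 3 * p + 2 + t) (3, q + 2 * p + 2 + t, q + 2 * p + 1)) ∧
      ∀ t < p, R (q + (4 * p + 2) + t) (4, q + t, q + 3 * p + 2 + t) := by
  rw [scanStep, at_append, at_cons, at_append, at_append, at_map_range, at_map_range, at_map_range,
    length_orBlock, List.length_map, List.length_map, List.length_range,
    show q + p + (p + 1) = q + 2 * p + 1 by omega,
    show q + 2 * p + 1 + 1 = q + 2 * p + 2 by omega,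
    show q + 2 * p + 2 + p = q + 3 * p + 2 by omega,
    show q + 3 * p + 2 + p = q + (4 * p + 2) by omega]

theorem wf_scanBlock {b p N : ℕ} {u : ℕ → ℕ} (hb : N * p ≤ b) (hu : ∀ t < p, u t < b) :
    At WF b (scanBlock b p N u) := by
  refine at_scanBlock.mpr ⟨fun _ _ => wf_false, fun j hj => at_scanStep.mpr ?_⟩
  refine ⟨wf_orBlock fun i hi => by omega, wf_neg.mpr (by omega), fun t ht => wf_conj.mpr ?_,
    fun t ht => wf_conj.mpr (by omega), fun t ht => wf_disj.mpr (by omega)⟩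
  have := hu t ht
  have := mul_add_lt hj ht
  omega

theorem exists_val_iff {p : ℕ} [NeZero p] {P : ZMod p → Prop} :
    (∃ t < p, P ((t : ℕ) : ZMod p)) ↔ ∃ t, P t := by
  constructor
  · rintro ⟨t, -, h⟩
    exact ⟨_, h⟩
  · rintro ⟨t, h⟩
    exact ⟨t.val, t.val_lt, by rwa [ZMod.natCast_zmod_val]⟩

/-- The state holds one wire per sign, of which at most one is true. A non-empty state blocks all
later entries; an empty one takes over the sign of the current entry if it is admissible. This is
the recursion of `scan`. -/
theorem holds_scanBlock {v : ℕ → Bool} {b p N : ℕ} [NeZero p] {u : ℕ → ℕ}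
    (h : At (Holds v) b (scanBlock b p N u)) {x : ℕ → Option (ZMod p)} {E : ZMod p → Bool}
    (hx : ∀ j < N, ∀ t < p, v (j * p + t) = decide (x j = some ((t : ℕ) : ZMod p)))
    (hu : ∀ t < p, v (u t) = E ((t : ℕ) : ZMod p)) {t : ℕ} (ht : t < p) :
    v (b + N * (4 * p + 2) + t) = decide (scan E x N = some ((t : ℕ) : ZMod p)) := by
  obtain ⟨h0, h1⟩ := at_scanBlock.mp h
  have : ∀ j ≤ N, ∀ t < p,
      v (b + j * (4 * p + 2) + t) = decide (scan E x j = some ((t : ℕ) : ZMod p)) := by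
    intro j
    induction j with
    | zero =>
      intro _ t ht
      rw [zero_mul, add_zero]
      exact (h0 t ht).trans (by simp [scan, toGate_false, evalAt])
    | succ j ih =>
      intro hj t ht
      have ih := ih (by omega)
      obtain ⟨g1, g2, g3, g4, g5⟩ := at_scanStep.mp (h1 j (by omega))
      have g1 := holds_orBlock g1
      rw [holds_neg] at g2
      have g3 := holds_conj.mp (g3 t ht)
      have g4 := holds_conj.mp (g4 t ht)
      have g5 := holds_disj.mp (g5 t ht)
      rw [show b + j * (4 * p + 2) + p + p = b + j * (4 * p + 2) + 2 * p by omega] at g1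
      rw [Nat.succ_mul, ← add_assoc, g5, g4, g3, g2, ih t ht, hx j (by omega) t ht, hu t ht, scan]
      cases hs : scan E x j with
      | some s =>
        have : v (b + j * (4 * p + 2) + 2 * p) = true :=
          g1.mpr ⟨s.val, s.val_lt, by rw [ih _ s.val_lt, hs]; simp⟩
        simp [this]
      | none =>
        have : v (b + j * (4 * p + 2) + 2 * p) = false := by
          rw [Bool.eq_false_iff, Ne, g1]
          rintro ⟨i, hi, h⟩
          simp [ih i hi, hs] at h
        rw [this]
        by_cases hE : E ((t : ℕ) : ZMod p) = true <;> simp [Option.filter_eq_some_iff, hE]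
  exact this N le_rfl t ht

/-- Select the family of wires given by the wires `s t`; the results are the wires
`b + j * (2 * p + 1) + 2 * p`. -/
def selectBlock (b p n : ℕ) (s : ℕ → ℕ) (f : ℕ → ℕ → ℕ) : List (ℕ × ℕ × ℕ) :=
  (List.range n).flatMap fun j => (List.range p).map (fun t => (3, s t, f t j)) ++
    orBlock (b + j * (2 * p + 1) + p) p fun t => b + j * (2 * p + 1) + t

theorem length_selectStep {p j : ℕ} (b' : ℕ) (s : ℕ → ℕ) (f : ℕ → ℕ → ℕ) (g : ℕ → ℕ) :
    ((List.range p).map (fun t => (3, s t, f t j)) ++ orBlock b' p g).length = 2 * p + 1 := by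
  rw [List.length_append, length_orBlock, List.length_map, List.length_range]
  omega

theorem length_selectBlock (b p n : ℕ) (s : ℕ → ℕ) (f : ℕ → ℕ → ℕ) :
    (selectBlock b p n s f).length = n * (2 * p + 1) :=
  length_flatMap_range fun _ _ => length_selectStep _ _ _ _

theorem at_selectBlock {R : ℕ → ℕ × ℕ × ℕ → Prop} {b p n : ℕ} {s : ℕ → ℕ} {f : ℕ → ℕ → ℕ} :
    At R b (selectBlock b p n s f) ↔ ∀ j < n,
      (∀ t < p, R (b + j * (2 * p + 1) + t) (3, s t, f t j)) ∧
      At R (b + j * (2 * p + 1) + p)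
        (orBlock (b + j * (2 * p + 1) + p) p fun t => b + j * (2 * p + 1) + t) := by
  rw [selectBlock, at_flatMap_range fun _ _ => length_selectStep _ _ _ _]
  refine forall₂_congr fun j hj => ?_
  rw [at_append, at_map_range, List.length_map, List.length_range]

theorem wf_selectBlock {b p n : ℕ} {s : ℕ → ℕ} {f : ℕ → ℕ → ℕ} (hs : ∀ t < p, s t < b)
    (hf : ∀ t < p, ∀ j < n, f t j < b) : At WF b (selectBlock b p n s f) := by
  refine at_selectBlock.mpr fun j hj => ⟨fun t ht => wf_conj.mpr ?_, wf_orBlock fun i hi => by omega⟩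
  have := hs t ht
  have := hf t ht j hj
  omega

theorem holds_selectBlock {v : ℕ → Bool} {b p n : ℕ} {s : ℕ → ℕ} {f : ℕ → ℕ → ℕ}
    (h : At (Holds v) b (selectBlock b p n s f)) {j : ℕ} (hj : j < n) :
    v (b + j * (2 * p + 1) + 2 * p) = true ↔ ∃ t < p, v (s t) = true ∧ v (f t j) = true := by
  obtain ⟨h1, h2⟩ := at_selectBlock.mp h j hj
  rw [two_mul p, ← add_assoc, ← two_mul, holds_orBlock h2]
  refine exists_congr fun t => and_congr_right fun ht => ?_
  rw [holds_conj.mp (h1 t ht), Bool.and_eq_true]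

/-- Choose between two families of wires; the results are the wires `b + 3 * i + 2`. -/
def muxBlock (b K a a' : ℕ) (f g : ℕ → ℕ) : List (ℕ × ℕ × ℕ) :=
  (List.range K).flatMap fun i => [(3, a, f i), (3, a', g i), (4, b + 3 * i, b + 3 * i + 1)]

theorem length_muxBlock (b K a a' : ℕ) (f g : ℕ → ℕ) : (muxBlock b K a a' f g).length = K * 3 :=
  length_flatMap_range fun _ _ => rfl

theorem at_muxBlock {R : ℕ → ℕ × ℕ × ℕ → Prop} {b K a a' : ℕ} {f g : ℕ → ℕ} :
    At R b (muxBlock b K a a' f g) ↔ ∀ i < K, R (b + 3 * i) (3, a, f i) ∧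
      R (b + 3 * i + 1) (3, a', g i) ∧ R (b + 3 * i + 2) (4, b + 3 * i, b + 3 * i + 1) := by
  refine (at_flatMap_range (L := 3) fun _ _ => rfl).trans (forall₂_congr fun i hi => ?_)
  rw [at_cons, at_cons, at_singleton, mul_comm]

theorem wf_muxBlock {b K a a' : ℕ} {f g : ℕ → ℕ} (ha : a < b) (ha' : a' < b)
    (hf : ∀ i < K, f i < b) (hg : ∀ i < K, g i < b) : At WF b (muxBlock b K a a' f g) := by
  refine at_muxBlock.mpr fun i hi => ?_
  have := hf i hi
  have := hg i hi
  exact ⟨wf_conj.mpr (by omega), wf_conj.mpr (by omega), wf_disj.mpr (by omega)⟩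

theorem holds_muxBlock {v : ℕ → Bool} {b K a a' : ℕ} {f g : ℕ → ℕ}
    (h : At (Holds v) b (muxBlock b K a a' f g)) {i : ℕ} (hi : i < K) :
    v (b + 3 * i + 2) = ((v a && v (f i)) || (v a' && v (g i))) := by
  obtain ⟨h1, h2, h3⟩ := at_muxBlock.mp h i hi
  rw [holds_disj.mp h3, holds_conj.mp h1, holds_conj.mp h2]

end KneserTucker

namespace KneserTucker

open Code

/-! ### Counting zero entries and rounding up the quotient -/

/-- The predecessor of `i` modulo `d`. -/
def cycPred (d i : ℕ) : ℕ := if i = 0 then d - 1 else i - 1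

theorem succ_mod_eq_iff {d i z : ℕ} (hi : i < d) : (z + 1) % d = i ↔ z % d = cycPred d i := by
  have h := Nat.mod_lt z (by omega : 0 < d)
  rw [← Nat.mod_add_mod]
  unfold cycPred
  rcases Nat.lt_or_ge (z % d + 1) d with h1 | h1
  · rw [Nat.mod_eq_of_lt h1]
    split_ifs <;> omega
  · rw [show z % d + 1 = d by omega, Nat.mod_self]
    split_ifs <;> omega

/-- Rounding up the quotient. -/
def ceilQuot (z d : ℕ) : ℕ := (z + d - 1) / d

/-- Since the rounded quotient grows exactly when the old number is divisible by `d`, it is enough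
to track the residue in unary and to increment a binary counter whenever the residue was zero. -/
theorem ceilQuot_succ {z d : ℕ} (hd : 0 < d) :
    ceilQuot (z + 1) d = ceilQuot z d + if z % d = 0 then 1 else 0 := by
  unfold ceilQuot
  rw [show z + 1 + d - 1 = z + d - 1 + 1 by omega, Nat.succ_div,
    show z + d - 1 + 1 = z + d by omega]
  simp only [Nat.dvd_iff_mod_eq_zero, Nat.add_mod_right]

/-- The number with given binary digits. -/
def bitSum (c : ℕ → Bool) (K : ℕ) : ℕ := ∑ b ∈ Finset.range K, if c b = true then 2 ^ b else 0

/-- Here `y` is the carry of a ripple adder with carry-in `y 0`; the term `2 ^ K` accounts for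
overflow. -/
theorem bitSum_ripple {c c' y : ℕ → Bool} {K : ℕ} (hc : ∀ b < K, c' b = (c b ^^ y b))
    (hy : ∀ b < K, y (b + 1) = (c b && y b)) :
    bitSum c' K + (if y K = true then 2 ^ K else 0) = bitSum c K + if y 0 = true then 1 else 0 := by
  induction K with
  | zero => simp [bitSum]
  | succ K ih =>
    have ih := ih (fun b hb => hc b (by omega)) fun b hb => hy b (by omega)
    unfold bitSum at ih ⊢
    rw [Finset.sum_range_succ, Finset.sum_range_succ, hc K (by omega), hy K (by omega)]
    revert ih
    rw [pow_succ]
    cases c K <;> cases y K <;> simp <;> omega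

/-- The number of the first `j` entries that vanish. -/
def nones {X : Type*} (x : ℕ → Option X) : ℕ → ℕ
  | 0 => 0
  | j + 1 => nones x j + if x j = none then 1 else 0

theorem nones_le {X : Type*} (x : ℕ → Option X) (j : ℕ) : nones x j ≤ j := by
  induction j with
  | zero => exact le_rfl
  | succ j ih => rw [nones]; split_ifs <;> omega

/-- The length of `countStep`. -/
def countLen (p d K : ℕ) : ℕ := p + 2 + 3 * d + 1 + 5 * K

/-- Update the counters for the entry number `j`: given the previous counters in the block at
`q'`, compute new ones in the block at `q`. -/
def countStep (p d K q q' j : ℕ) : List (ℕ × ℕ × ℕ) :=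
  orBlock q p (fun t => j * p + t) ++ ((2, q + p, 0) ::
    ((List.range d).flatMap (fun i => [(3, q + p + 1, q' + p + 4 + 3 * cycPred d i),
        (3, q + p, q' + p + 4 + 3 * i), (4, q + p + 2 + 3 * i, q + p + 2 + 3 * i + 1)]) ++
      ((3, q + p + 1, q' + p + 4) :: (List.range K).flatMap fun b =>
        [(4, q' + p + 3 * d + 6 + 5 * b, q + p + 3 * d + 2 + 5 * b),
          (3, q' + p + 3 * d + 6 + 5 * b, q + p + 3 * d + 2 + 5 * b),
          (2, q + p + 3 * d + 2 + 5 * b + 2, 0),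
          (3, q + p + 3 * d + 2 + 5 * b + 1, q + p + 3 * d + 2 + 5 * b + 3),
          (3, q' + p + 3 * d + 6 + 5 * b, q + p + 3 * d + 2 + 5 * b)])))

/-- Count the zero entries of a signed set, modulo `d` in unary and divided by `d` in binary. -/
def countBlock (b p d N K : ℕ) : List (ℕ × ℕ × ℕ) :=
  (List.range (countLen p d K)).map (fun i =>
      if i - (p + 4) = 0 then (if p + 4 - i = 0 then (1, 0, 0) else (0, 0, 0)) else (0, 0, 0)) ++
    (List.range N).flatMap fun j => countStep p d K (b + countLen p d K + j * countLen p d K)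
      (b + j * countLen p d K) j

theorem length_countStep (p d K q q' j : ℕ) :
    (countStep p d K q q' j).length = countLen p d K := by
  rw [countStep, List.length_append, List.length_cons, List.length_append, List.length_cons,
    length_orBlock, length_flatMap_range (L := 3) fun _ _ => rfl,
    length_flatMap_range (L := 5) fun _ _ => rfl, countLen]
  omega

theorem length_countBlock (b p d N K : ℕ) :
    (countBlock b p d N K).length = countLen p d K + N * countLen p d K := by
  rw [countBlock, List.length_append, List.length_map, List.length_range,
    length_flatMap_range fun _ _ => length_countStep _ _ _ _ _ _]

/-- Wires `q + p` and `q + p + 1` say that the entry is non-zero or zero. Three wires per residue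
follow, the third being the new indicator. The incrementer starts with its carry-in, "the entry is
zero and the old residue was zero", and spends five wires per bit: or, and, negated and, new bit
(their exclusive or), next carry. -/
theorem at_countStep {R : ℕ → ℕ × ℕ × ℕ → Prop} {p d K q q' j : ℕ} :
    At R q (countStep p d K q q' j) ↔ At R q (orBlock q p fun t => j * p + t) ∧
      R (q + p + 1) (2, q + p, 0) ∧
      (∀ i < d, R (q + p + 2 + 3 * i) (3, q + p + 1, q' + p + 4 + 3 * cycPred d i) ∧
        R (q + p + 2 + 3 * i + 1) (3, q + p, q' + p + 4 + 3 * i) ∧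
        R (q + p + 4 + 3 * i) (4, q + p + 2 + 3 * i, q + p + 2 + 3 * i + 1)) ∧
      R (q + p + 3 * d + 2) (3, q + p + 1, q' + p + 4) ∧
      ∀ b < K, R (q + p + 3 * d + 2 + 5 * b + 1)
          (4, q' + p + 3 * d + 6 + 5 * b, q + p + 3 * d + 2 + 5 * b) ∧
        R (q + p + 3 * d + 2 + 5 * b + 2)
          (3, q' + p + 3 * d + 6 + 5 * b, q + p + 3 * d + 2 + 5 * b) ∧
        R (q + p + 3 * d + 2 + 5 * b + 3) (2, q + p + 3 * d + 2 + 5 * b + 2, 0) ∧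
        R (q + p + 3 * d + 6 + 5 * b)
          (3, q + p + 3 * d + 2 + 5 * b + 1, q + p + 3 * d + 2 + 5 * b + 3) ∧
        R (q + p + 3 * d + 2 + 5 * (b + 1))
          (3, q' + p + 3 * d + 6 + 5 * b, q + p + 3 * d + 2 + 5 * b) := by
  have e1 : ∀ i, q + p + 1 + 1 + i * 3 = q + p + 2 + 3 * i := fun i => by omega
  have e2 : ∀ i, q + p + 2 + 3 * i + 1 + 1 = q + p + 4 + 3 * i := fun i => by omega
  have e3 : ∀ b, q + p + 2 + 3 * d + 1 + b * 5 = q + p + 3 * d + 2 + 5 * b + 1 := fun b => by omega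
  have e4 : ∀ b, q + p + 3 * d + 2 + 5 * b + 1 + 1 = q + p + 3 * d + 2 + 5 * b + 2 := fun b => by omega
  have e5 : ∀ b, q + p + 3 * d + 2 + 5 * b + 2 + 1 = q + p + 3 * d + 2 + 5 * b + 3 := fun b => by omega
  have e6 : ∀ b, q + p + 3 * d + 2 + 5 * b + 3 + 1 = q + p + 3 * d + 6 + 5 * b := fun b => by omega
  have e7 : ∀ b, q + p + 3 * d + 6 + 5 * b + 1 = q + p + 3 * d + 2 + 5 * (b + 1) := fun b => by omega
  rw [countStep, at_append, at_cons, at_append, at_cons, at_flatMap_range (L := 3) fun _ _ => rfl,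
    at_flatMap_range (L := 5) fun _ _ => rfl, length_orBlock,
    length_flatMap_range (L := 3) fun _ _ => rfl, ← add_assoc q p 1]
  simp only [at_cons, at_nil, and_true, e1, e2, e3, e4, e5, e6, e7]
  rw [show q + p + 2 + 3 * d = q + p + 3 * d + 2 by omega]

theorem at_countBlock {R : ℕ → ℕ × ℕ × ℕ → Prop} {b p d N K : ℕ} :
    At R b (countBlock b p d N K) ↔ (∀ i < countLen p d K, R (b + i)
        (if i - (p + 4) = 0 then (if p + 4 - i = 0 then (1, 0, 0) else (0, 0, 0)) else (0, 0, 0))) ∧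
      ∀ j < N, At R (b + countLen p d K + j * countLen p d K)
        (countStep p d K (b + countLen p d K + j * countLen p d K) (b + j * countLen p d K) j) := by
  rw [countBlock, at_append, at_map_range, at_flatMap_range fun _ _ => length_countStep _ _ _ _ _ _,
    List.length_map, List.length_range]

theorem wf_countBlock {b p d N K : ℕ} (hd : 0 < d) (hb : N * p ≤ b) :
    At WF b (countBlock b p d N K) := by
  refine at_countBlock.mpr ⟨fun i hi => ?_, fun j hj => at_countStep.mpr ?_⟩
  · split_ifs
    exacts [wf_true, wf_false, wf_false]
  · have hL : countLen p d K = p + 2 + 3 * d + 1 + 5 * K := rfl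
    have hc : ∀ i < d, cycPred d i < d := fun i hi => by unfold cycPred; split_ifs <;> omega
    refine ⟨wf_orBlock fun t ht => ?_, wf_neg.mpr (by omega), fun i hi => ?_, ?_, fun c hc => ?_⟩
    · have := mul_add_lt hj ht
      omega
    · have := hc i hi
      exact ⟨wf_conj.mpr (by omega), wf_conj.mpr (by omega), wf_disj.mpr (by omega)⟩
    · exact wf_conj.mpr (by omega)
    · exact ⟨wf_disj.mpr (by omega), wf_conj.mpr (by omega), wf_neg.mpr (by omega),
        wf_conj.mpr (by omega), wf_conj.mpr (by omega)⟩

theorem ceilQuot_mono {z z' d : ℕ} (h : z ≤ z') : ceilQuot z d ≤ ceilQuot z' d :=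
  Nat.div_le_div_right (by omega)

/-- By induction over the entries, the residue wires and the binary counter describe the zeros seen
so far. The bound `hK` excludes overflow throughout, because the count only grows towards its
maximum `N`. -/
theorem holds_countBlock {v : ℕ → Bool} {b p d N K : ℕ} [NeZero p] (hd : 0 < d)
    (h : At (Holds v) b (countBlock b p d N K)) {x : ℕ → Option (ZMod p)}
    (hx : ∀ j < N, ∀ t < p, v (j * p + t) = decide (x j = some ((t : ℕ) : ZMod p)))
    (hK : ceilQuot N d < 2 ^ K) :
    bitSum (fun i => v (b + N * countLen p d K + p + 3 * d + 6 + 5 * i)) K =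
      ceilQuot (nones x N) d := by
  obtain ⟨h0, h1⟩ := at_countBlock.mp h
  set L := countLen p d K with hLdef
  have hL : L = p + 2 + 3 * d + 1 + 5 * K := rfl
  have : ∀ j ≤ N,
      (∀ i < d, (v (b + j * L + p + 4 + 3 * i) = true ↔ nones x j % d = i)) ∧
      bitSum (fun i => v (b + j * L + p + 3 * d + 6 + 5 * i)) K = ceilQuot (nones x j) d := by
    intro j
    induction j with
    | zero =>
      intro _
      constructor
      · intro i hi
        -- In the initial block only the wire at offset `p + 4`, the indicator of residue zero, is
        -- set to true.
        have h2 := h0 (p + 4 + 3 * i) (by omega)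
        rw [zero_mul, add_zero, add_assoc, add_assoc, ← add_assoc p, nones, Nat.zero_mod]
        by_cases h : i = 0
        · subst h
          simp only [mul_zero, add_zero, Nat.sub_self, if_true] at h2 ⊢
          exact iff_of_true h2 trivial
        · rw [if_neg (by omega)] at h2
          exact iff_of_false (Bool.eq_false_iff.mp h2) (Ne.symm h)
      · have hq : ceilQuot 0 d = 0 := Nat.div_eq_of_lt (by omega)
        rw [nones, hq]
        refine Finset.sum_eq_zero fun i hi => if_neg (Bool.eq_false_iff.mp ?_)
        have hi := Finset.mem_range.mp hi
        have h2 := h0 (p + 3 * d + 6 + 5 * i) (by omega)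
        rw [if_neg (by omega)] at h2
        dsimp only
        rw [zero_mul, show b + 0 + p + 3 * d + 6 + 5 * i = b + (p + 3 * d + 6 + 5 * i) by omega]
        exact h2
    | succ j ih =>
      intro hj
      obtain ⟨ih1, ih2⟩ := ih (by omega)
      have g := h1 j (by omega)
      rw [show b + L + j * L = b + (j + 1) * L by rw [Nat.succ_mul]; omega] at g
      obtain ⟨g1, g2, g3, g4, g5⟩ := at_countStep.mp g
      set q := b + (j + 1) * L
      set q' := b + j * L
      have g1 := holds_orBlock g1
      rw [holds_neg] at g2
      have hp : v (q + p) = true ↔ x j ≠ none := by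
        rw [g1]
        constructor
        · rintro ⟨t, ht, h⟩ h'
          simp [hx j (by omega) t ht, h'] at h
        · intro h
          obtain ⟨s, hs⟩ := Option.ne_none_iff_exists'.mp h
          exact ⟨s.val, s.val_lt, by rw [hx j (by omega) _ s.val_lt, hs]; simp⟩
      have g3 : ∀ i < d, v (q + p + 4 + 3 * i) = ((!v (q + p) && v (q' + p + 4 + 3 * cycPred d i)) ||
          (v (q + p) && v (q' + p + 4 + 3 * i))) := fun i hi => by
        obtain ⟨f1, f2, f3⟩ := g3 i hi
        rw [holds_disj.mp f3, holds_conj.mp f1, holds_conj.mp f2, g2]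
      have g4 := holds_conj.mp g4
      have hr0 := ih1 0 hd
      rw [mul_zero, add_zero] at hr0
      have hsum := bitSum_ripple (c := fun i => v (q' + p + 3 * d + 6 + 5 * i))
        (c' := fun i => v (q + p + 3 * d + 6 + 5 * i))
        (y := fun i => v (q + p + 3 * d + 2 + 5 * i)) (K := K) (fun i hi => by
          obtain ⟨f1, f2, f3, f4, f5⟩ := g5 i hi
          rw [holds_conj.mp f4, holds_neg.mp f3, holds_conj.mp f2, holds_disj.mp f1]
          cases v (q' + p + 3 * d + 6 + 5 * i) <;> cases v (q + p + 3 * d + 2 + 5 * i) <;> rfl)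
        (fun i hi => holds_conj.mp (g5 i hi).2.2.2.2)
      rw [ih2] at hsum
      simp only [mul_zero, add_zero] at hsum
      rw [g4, g2] at hsum
      have hbound : ceilQuot (nones x (j + 1)) d < 2 ^ K :=
        (ceilQuot_mono ((nones_le x (j + 1)).trans hj)).trans_lt hK
      have hc : ∀ i < d, cycPred d i < d := fun i hi => by unfold cycPred; split_ifs <;> omega
      rw [nones] at hbound ⊢
      by_cases h : x j = none
      · have hz : v (q + p) = false := Bool.eq_false_iff.mpr fun h' => hp.mp h' h
        rw [if_pos h] at hbound ⊢
        refine ⟨fun i hi => ?_, ?_⟩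
        · rw [g3 i hi, hz]
          simp only [Bool.not_false, Bool.true_and, Bool.false_and, Bool.or_false]
          rw [ih1 _ (hc i hi), succ_mod_eq_iff hi]
        · rw [ceilQuot_succ hd] at hbound ⊢
          rw [hz, Bool.not_false, Bool.true_and] at hsum
          simp only [hr0] at hsum
          -- A true top carry would contribute `2 ^ K`, more than the whole right-hand side.
          have : ∀ P : Prop, [Decidable P] → (if P then 2 ^ K else 0) = 0 ∨
            2 ^ K ≤ (if P then 2 ^ K else 0) := fun P _ => by split_ifs <;> simp
          rcases this (v (q + p + 3 * d + 2 + 5 * K) = true) with h2 | h2 <;> omega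
      · have hz := hp.mpr h
        rw [if_neg h, add_zero] at hbound ⊢
        refine ⟨fun i hi => ?_, ?_⟩
        · rw [g3 i hi, hz]
          simp only [Bool.not_true, Bool.true_and, Bool.false_and, Bool.false_or]
          exact ih1 i hi
        · rw [hz] at hsum
          simp only [Bool.not_true, Bool.false_and, Bool.false_eq_true, if_false, add_zero] at hsum
          have : ∀ P : Prop, [Decidable P] → (if P then 2 ^ K else 0) = 0 ∨
            2 ^ K ≤ (if P then 2 ^ K else 0) := fun P _ => by split_ifs <;> simp
          rcases this (v (q + p + 3 * d + 2 + 5 * K) = true) with h2 | h2 <;> omega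
  exact (this N le_rfl).2

end KneserTucker

namespace KneserTucker

open Code

/-! ### The circuit of the reduction -/

section Addresses

variable (p n N L : ℕ)

/-- Address of the part of the circuit that tests the selected sets for emptiness. -/
def testBase : ℕ := N * p + p * L

/-- Address of the part that determines the eligible signs. -/
def eligBase : ℕ := testBase p N L + p * (n + 1)

/-- Address of the part that finds the first eligible sign. -/
def scanBase : ℕ := eligBase p n N L + (2 * p + 2)

/-- Address of the part that selects the set of the first eligible sign. -/
def selectBase : ℕ := scanBase p n N L + (p + N * (4 * p + 2))

/-- Address of the part that computes the color of this set. -/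
def colorBase : ℕ := selectBase p n N L + n * (2 * p + 1)

/-- The wire saying that the leading sign is `t`. -/
def leadWire (t : ℕ) : ℕ := scanBase p n N L + N * (4 * p + 2) + t

/-- The wire saying that `j` is in the set selected for the leading sign. -/
def setWire (j : ℕ) : ℕ := selectBase p n N L + j * (2 * p + 1) + 2 * p

end Addresses

/-- The first part of the circuit, which determines the leading sign and its set. -/
def leadGates (p n N : ℕ) (gs : List (ℕ × ℕ × ℕ)) (os : List ℕ) : List (ℕ × ℕ × ℕ) :=
  callsBlock (N * p) p n (fun t i => i * p + t) gs os ++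
  (orsBlock (testBase p N (n + (gs.length + os.length))) p n
    (fun t j => N * p + t * (n + (gs.length + os.length)) + (n + gs.length) + j) ++
  (eligBlock (eligBase p n N (n + (gs.length + os.length))) p
    (fun t => testBase p N (n + (gs.length + os.length)) + t * (n + 1) + n) ++
  (scanBlock (scanBase p n N (n + (gs.length + os.length))) p N
    (fun t => eligBase p n N (n + (gs.length + os.length)) + p + 2 + t) ++
  selectBlock (selectBase p n N (n + (gs.length + os.length))) p n
    (leadWire p n N (n + (gs.length + os.length)))
    (fun t j => N * p + t * (n + (gs.length + os.length)) + (n + gs.length) + j))))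

theorem at_leadGates {R : ℕ → ℕ × ℕ × ℕ → Prop} {p n N : ℕ} {gs : List (ℕ × ℕ × ℕ)} {os : List ℕ}
    {L : ℕ} (hL : n + (gs.length + os.length) = L) :
    At R (N * p) (leadGates p n N gs os) ↔
      At R (N * p) (callsBlock (N * p) p n (fun t i => i * p + t) gs os) ∧
      At R (testBase p N L) (orsBlock (testBase p N L) p n
        fun t j => N * p + t * L + (n + gs.length) + j) ∧
      At R (eligBase p n N L) (eligBlock (eligBase p n N L) p
        fun t => testBase p N L + t * (n + 1) + n) ∧
      At R (scanBase p n N L) (scanBlock (scanBase p n N L) p N fun t => eligBase p n N L + p + 2 + t) ∧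
      At R (selectBase p n N L) (selectBlock (selectBase p n N L) p n (leadWire p n N L)
        fun t j => N * p + t * L + (n + gs.length) + j) := by
  rw [leadGates, at_append, at_append, at_append, at_append, length_callsBlock, length_orsBlock,
    length_eligBlock, length_scanBlock, hL]
  rfl

theorem length_leadGates {p n N : ℕ} {gs : List (ℕ × ℕ × ℕ)} {os : List ℕ}
    {L : ℕ} (hL : n + (gs.length + os.length) = L) :
    N * p + (leadGates p n N gs os).length = colorBase p n N L := by
  rw [leadGates, List.length_append, List.length_append, List.length_append, List.length_append,
    length_callsBlock, length_orsBlock, length_eligBlock, length_scanBlock, length_selectBlock, hL]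
  unfold colorBase selectBase scanBase eligBase testBase
  omega

/-- The set that `φ` selects from the elements of sign `t`. -/
def part {n : ℕ} {X : Type*} [DecidableEq X] (φ : (Fin n → Bool) → Fin n → Bool)
    (x : ℕ → Option X) (t : X) : Fin n → Bool := φ fun i => decide (x i = some t)

/-- Some selected set is non-empty. -/
def HasPart {n : ℕ} {X : Type*} [DecidableEq X] (φ : (Fin n → Bool) → Fin n → Bool)
    (x : ℕ → Option X) : Prop := ∃ t, ∃ j, part φ x t j = true

open Classical in
/-- A sign is eligible if its selected set is non-empty, or if all of these sets are empty. -/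
noncomputable def elig {n : ℕ} {X : Type*} [DecidableEq X] (φ : (Fin n → Bool) → Fin n → Bool)
    (x : ℕ → Option X) (t : X) : Bool := decide (HasPart φ x → ∃ j, part φ x t j = true)

theorem elig_eq_true_iff {n : ℕ} {X : Type*} [DecidableEq X] {φ : (Fin n → Bool) → Fin n → Bool}
    {x : ℕ → Option X} {t : X} :
    elig φ x t = true ↔ (HasPart φ x → ∃ j, part φ x t j = true) := by
  classical
  exact decide_eq_true_iff

/-- The leading sign. -/
noncomputable def lead {n : ℕ} {X : Type*} [DecidableEq X] (φ : (Fin n → Bool) → Fin n → Bool)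
    (x : ℕ → Option X) (N : ℕ) : Option X := scan (elig φ x) x N

section

variable {p n N : ℕ} {gs : List (ℕ × ℕ × ℕ)} (C : Circuit n n)

theorem setAddr_lt {t j g L : ℕ} (hL : n + (g + n) = L) (ht : t < p) (hj : j < n) :
    N * p + t * L + (n + g) + j < testBase p N L := by
  have := add_mul_succ_le (b := N * p) (L := L) ht
  unfold testBase
  omega

theorem leadWire_lt {t L : ℕ} (ht : t < p) : leadWire p n N L t < selectBase p n N L := by
  unfold leadWire selectBase
  omega

theorem setWire_lt {j L : ℕ} (hj : j < n) : setWire p n N L j < colorBase p n N L := by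
  have := add_mul_succ_le (b := selectBase p n N L) (L := 2 * p + 1) hj
  unfold setWire colorBase
  omega

theorem wf_leadGates (hg : C.gates = gs.map toGate) (hn : n ≤ N) :
    At WF (N * p) (leadGates p n N gs (List.ofFn C.outputs)) := by
  have hL : n + (gs.length + (List.ofFn C.outputs).length) = n + (gs.length + n) := by simp
  refine (at_leadGates hL).mpr ⟨wf_callsBlock C hg fun t ht i hi => mul_add_lt (by omega) ht,
    wf_orsBlock fun t ht j hj => setAddr_lt rfl ht hj, wf_eligBlock fun t ht => ?_,
    wf_scanBlock ?_ fun t ht => ?_, wf_selectBlock (fun t ht => leadWire_lt ht) fun t ht j hj => ?_⟩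
  · have := add_mul_succ_le (b := testBase p N (n + (gs.length + n))) (L := n + 1) ht
    unfold eligBase
    omega
  · unfold scanBase eligBase testBase
    omega
  · unfold scanBase
    omega
  · have := setAddr_lt (N := N) (p := p) (t := t) (j := j) (g := gs.length) rfl ht hj
    unfold selectBase scanBase eligBase
    omega

/-- The valuation is arbitrary because these gates are used twice: within the circuit of the
reduction, and run on their own by the algorithm that translates solutions back. -/
theorem holds_leadGates [NeZero p] (hg : C.gates = gs.map toGate) {v : ℕ → Bool}
    (h : At (Holds v) (N * p) (leadGates p n N gs (List.ofFn C.outputs))) (hn : n ≤ N)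
    {x : ℕ → Option (ZMod p)}
    (hx : ∀ j < N, ∀ t < p, v (j * p + t) = decide (x j = some ((t : ℕ) : ZMod p))) :
    (v (eligBase p n N (n + (gs.length + n)) + p) = true ↔ HasPart C.eval x) ∧
    v (eligBase p n N (n + (gs.length + n)) + p + 1) =
      !v (eligBase p n N (n + (gs.length + n)) + p) ∧
    (∀ t < p, v (leadWire p n N (n + (gs.length + n)) t) =
      decide (lead C.eval x N = some ((t : ℕ) : ZMod p))) ∧
    ∀ j : Fin n, v (setWire p n N (n + (gs.length + n)) j) = true ↔
      ∃ t, lead C.eval x N = some t ∧ part C.eval x t j = true := by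
  have hL : n + (gs.length + (List.ofFn C.outputs).length) = n + (gs.length + n) := by simp
  obtain ⟨h1, h2, h3, h4, h5⟩ := (at_leadGates hL).mp h
  have g1 : ∀ t < p, ∀ j : Fin n,
      v (N * p + t * (n + (gs.length + n)) + (n + gs.length) + j) = part C.eval x t j := by
    intro t ht j
    have := holds_callsBlock C hg h1 ht j
    rw [hL] at this
    rw [this, part]
    refine congrFun (congrArg C.eval (funext fun i => ?_)) j
    exact hx i (by omega) t ht
  have g2 : ∀ t < p, (v (testBase p N (n + (gs.length + n)) + t * (n + 1) + n) = true ↔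
      ∃ j, part C.eval x (t : ZMod p) j = true) := by
    intro t ht
    rw [holds_orsBlock h2 ht]
    constructor
    · rintro ⟨j, hj, h⟩
      exact ⟨⟨j, hj⟩, (g1 t ht ⟨j, hj⟩).symm.trans h⟩
    · rintro ⟨j, h⟩
      exact ⟨j, j.2, (g1 t ht j).trans h⟩
  obtain ⟨h3a, h3b, h3c⟩ := holds_eligBlock h3
  have g3 : v (eligBase p n N (n + (gs.length + n)) + p) = true ↔ HasPart C.eval x := by
    rw [h3a, HasPart, ← exists_val_iff]
    exact exists_congr fun t => and_congr_right fun ht => g2 t ht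
  have g4 := fun t (ht : t < p) => holds_scanBlock h4 (E := elig C.eval x) hx (fun t ht => by
    rw [h3c t ht, Bool.eq_iff_iff, elig_eq_true_iff, Bool.or_eq_true, g2 t ht,
      Bool.not_eq_true', ← Bool.not_eq_true, g3]
    tauto) ht
  refine ⟨g3, h3b, g4, fun j => ?_⟩
  rw [setWire, holds_selectBlock h5 j.2, ← exists_val_iff]
  refine exists_congr fun t => and_congr_right fun ht => ?_
  rw [g1 t ht, leadWire, g4 t ht, decide_eq_true_iff]
  rfl

end

/-- Address of the part of the circuit that counts zero entries. -/
def countBase (p n N L M : ℕ) : ℕ := colorBase p n N L + (M + n)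

/-- Address of the last part of the circuit. -/
def muxBase (p n N L M K : ℕ) : ℕ :=
  countBase p n N L M + (countLen p (p - 1) K + N * countLen p (p - 1) K)

/-- The gates of the circuit of the reduction. -/
def reductionGates (p n N : ℕ) (gs : List (ℕ × ℕ × ℕ)) (os : List ℕ) (gs' : List (ℕ × ℕ × ℕ))
    (os' : List ℕ) : List (ℕ × ℕ × ℕ) :=
  leadGates p n N gs os ++
  (callBlock (colorBase p n N (n + (gs.length + os.length))) n
    (setWire p n N (n + (gs.length + os.length))) gs' os' ++
  ((List.range n).map (fun _ => (0, 0, 0)) ++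
  (countBlock (countBase p n N (n + (gs.length + os.length)) (n + (gs'.length + os'.length))) p (p - 1)
    N (n + os'.length) ++
  muxBlock (muxBase p n N (n + (gs.length + os.length)) (n + (gs'.length + os'.length))
      (n + os'.length)) (n + os'.length)
    (eligBase p n N (n + (gs.length + os.length)) + p)
    (eligBase p n N (n + (gs.length + os.length)) + p + 1)
    (fun i => colorBase p n N (n + (gs.length + os.length)) + (n + gs'.length) + i)
    (fun i => countBase p n N (n + (gs.length + os.length)) (n + (gs'.length + os'.length)) +
      N * countLen p (p - 1) (n + os'.length) + p + 3 * (p - 1) + 6 + 5 * i))))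

section

variable {p n N k : ℕ} {gs gs' : List (ℕ × ℕ × ℕ)}

theorem at_reductionGates {R : ℕ → ℕ × ℕ × ℕ → Prop} {os os' : List ℕ} {L M K : ℕ}
    (hL : n + (gs.length + os.length) = L) (hM : n + (gs'.length + os'.length) = M)
    (hK : n + os'.length = K) :
    At R (N * p) (reductionGates p n N gs os gs' os') ↔ At R (N * p) (leadGates p n N gs os) ∧
      At R (colorBase p n N L) (callBlock (colorBase p n N L) n (setWire p n N L) gs' os') ∧
      (∀ i < n, R (colorBase p n N L + M + i) (0, 0, 0)) ∧
      At R (countBase p n N L M) (countBlock (countBase p n N L M) p (p - 1) N K) ∧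
      At R (muxBase p n N L M K) (muxBlock (muxBase p n N L M K) K (eligBase p n N L + p)
        (eligBase p n N L + p + 1) (fun i => colorBase p n N L + (n + gs'.length) + i)
        (fun i => countBase p n N L M + N * countLen p (p - 1) K + p + 3 * (p - 1) + 6 + 5 * i)) := by
  rw [reductionGates, at_append, at_append, at_append, at_append, at_map_range, length_leadGates hL,
    length_callBlock, List.length_map, List.length_range, length_countBlock, hL, hM, hK,
    add_assoc _ M n]
  rfl

variable (C : Circuit n n) (D : Circuit n k)

theorem eligBase_lt {L : ℕ} : eligBase p n N L + p + 1 < scanBase p n N L := by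
  unfold scanBase
  omega

theorem wf_reductionGates (hp : 2 ≤ p) (hg : C.gates = gs.map toGate) (hg' : D.gates = gs'.map toGate)
    (hn : n ≤ N) :
    At WF (N * p) (reductionGates p n N gs (List.ofFn C.outputs) gs' (List.ofFn D.outputs)) := by
  have hL : n + (gs.length + (List.ofFn C.outputs).length) = n + (gs.length + n) := by simp
  have hM : n + (gs'.length + (List.ofFn D.outputs).length) = n + (gs'.length + k) := by simp
  have hK : n + (List.ofFn D.outputs).length = n + k := by simp
  have h0 : N * p ≤ scanBase p n N (n + (gs.length + n)) := by
    unfold scanBase eligBase testBase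
    omega
  have h1 : scanBase p n N (n + (gs.length + n)) ≤ colorBase p n N (n + (gs.length + n)) := by
    unfold colorBase selectBase
    omega
  have h2 := eligBase_lt (p := p) (n := n) (N := N) (L := n + (gs.length + n))
  refine (at_reductionGates hL hM hK).mpr ⟨wf_leadGates C hg hn,
    wf_callBlock D hg' fun j hj => setWire_lt hj, fun _ _ => wf_false,
    wf_countBlock (by omega) ?_, wf_muxBlock ?_ ?_ (fun i hi => ?_) fun i hi => ?_⟩
  · unfold countBase
    omega
  · unfold muxBase countBase
    omega
  · unfold muxBase countBase
    omega
  · unfold muxBase countBase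
    omega
  · unfold muxBase
    have : countLen p (p - 1) (n + k) = p + 2 + 3 * (p - 1) + 1 + 5 * (n + k) := rfl
    omega

theorem length_reductionGates {os os' : List ℕ} {L M K : ℕ}
    (hL : n + (gs.length + os.length) = L) (hM : n + (gs'.length + os'.length) = M)
    (hK : n + os'.length = K) :
    N * p + (reductionGates p n N gs os gs' os').length = muxBase p n N L M K + K * 3 := by
  rw [reductionGates, List.length_append, List.length_append, List.length_append, List.length_append,
    length_callBlock, length_countBlock, length_muxBlock, List.length_map, List.length_range,
    ← add_assoc, length_leadGates hL, hM, hK]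
  unfold muxBase countBase
  omega

open Classical in
/-- The absolute value of the label. -/
noncomputable def absLabel (p : ℕ) [NeZero p] (φ : (Fin n → Bool) → Fin n → Bool)
    (χ : (Fin n → Bool) → ℕ) (x : ℕ → Option (ZMod p)) (N : ℕ) : ℕ :=
  if HasPart φ x then χ (part φ x ((lead φ x N).getD 0)) else ceilQuot (nones x N) (p - 1)

theorem binValue_eq_bitSum {k : ℕ} {f : Fin k → Bool} {g : ℕ → Bool} (h : ∀ i, f i = g i) :
    binValue f = bitSum g k := by
  unfold binValue bitSum
  rw [← Fin.sum_univ_eq_sum_range fun i => if g i = true then 2 ^ i else 0]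
  exact Finset.sum_congr rfl fun i _ => by rw [h]

theorem bitSum_add_of_false {c : ℕ → Bool} {k n : ℕ} (h : ∀ i < n, c (k + i) = false) :
    bitSum c (n + k) = bitSum c k := by
  unfold bitSum
  rw [add_comm, Finset.sum_range_add]
  refine Nat.add_eq_left.mpr (Finset.sum_eq_zero fun i hi => ?_)
  rw [h i (Finset.mem_range.mp hi)]
  rfl

theorem bitSum_congr {c c' : ℕ → Bool} {k : ℕ} (h : ∀ i < k, c i = c' i) : bitSum c k = bitSum c' k :=
  Finset.sum_congr rfl fun i hi => by rw [h i (Finset.mem_range.mp hi)]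

/-- Both candidates for the absolute value are presented with `n + k` bits, and the final block
chooses between them according to `HasPart`. The color has `k` bits only and is padded by `n` zeros;
the counter uses the full width so as not to overflow. -/
theorem holds_reductionGates [NeZero p] (hp : 2 ≤ p) (hg : C.gates = gs.map toGate)
    (hg' : D.gates = gs'.map toGate) {v : ℕ → Bool}
    (h : At (Holds v) (N * p)
      (reductionGates p n N gs (List.ofFn C.outputs) gs' (List.ofFn D.outputs)))
    (hn : n ≤ N) (hk : ceilQuot N (p - 1) < 2 ^ (n + k)) {x : ℕ → Option (ZMod p)}
    (hx : ∀ j < N, ∀ t < p, v (j * p + t) = decide (x j = some ((t : ℕ) : ZMod p)))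
    (hlead : lead C.eval x N ≠ none) :
    bitSum (fun i => v (muxBase p n N (n + (gs.length + n)) (n + (gs'.length + k)) (n + k) + 3 * i + 2))
      (n + k) = absLabel p C.eval (fun y => binValue (D.eval y)) x N := by
  have hL : n + (gs.length + (List.ofFn C.outputs).length) = n + (gs.length + n) := by simp
  have hM : n + (gs'.length + (List.ofFn D.outputs).length) = n + (gs'.length + k) := by simp
  have hK : n + (List.ofFn D.outputs).length = n + k := by simp
  obtain ⟨h1, h2, h3, h4, h5⟩ := (at_reductionGates hL hM hK).mp h
  obtain ⟨g1, g2, -, g4⟩ := holds_leadGates C hg h1 hn hx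
  have g5 := fun i hi => holds_muxBlock h5 (i := i) hi
  refine (bitSum_congr g5).trans ?_
  rw [g2]
  unfold absLabel
  split_ifs with hH
  · rw [g1.mpr hH]
    simp only [Bool.true_and, Bool.not_true, Bool.false_and, Bool.or_false]
    -- The constant wires directly follow the outputs of the color circuit, so they are read as its
    -- higher bits.
    rw [bitSum_add_of_false]
    · symm
      refine binValue_eq_bitSum fun i => ?_
      rw [holds_callBlock D hg' h2 i]
      refine congrFun (congrArg D.eval (funext fun j => ?_)) i
      obtain ⟨t, ht⟩ := Option.ne_none_iff_exists'.mp hlead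
      rw [Bool.eq_iff_iff, g4 j, ht]
      simp
    · intro i hi
      have := h3 i hi
      rw [holds_false] at this
      rw [← this]
      congr 1
      omega
  · rw [Bool.eq_false_iff.mpr fun h' => hH (g1.mp h')]
    simp only [Bool.true_and, Bool.not_false, Bool.false_and, Bool.false_or]
    exact holds_countBlock (by omega) h4 hx hk

end

end KneserTucker

namespace KneserTucker

open Code

/-! ### Correctness of the labelling -/

section Scan

variable {X : Type*} {E : X → Bool} {x : ℕ → Option X}

theorem scan_eq_some {N : ℕ} {t : X} (h : scan E x N = some t) : E t = true ∧ ∃ j < N, x j = some t := by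
  induction N with
  | zero => simp [scan] at h
  | succ N ih =>
    rw [scan, Option.or_eq_some_iff] at h
    rcases h with h | ⟨-, h⟩
    · obtain ⟨h1, j, hj, h2⟩ := ih h
      exact ⟨h1, j, by omega, h2⟩
    · obtain ⟨h1, h2⟩ := Option.filter_eq_some_iff.mp h
      exact ⟨h2, N, by omega, h1⟩

theorem scan_ne_none {N j : ℕ} {t : X} (hj : j < N) (hx : x j = some t) (ht : E t = true) :
    scan E x N ≠ none := by
  induction N with
  | zero => omega
  | succ N ih =>
    rw [scan, Ne, Option.or_eq_none_iff]
    rintro ⟨h1, h2⟩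
    rcases Nat.lt_succ_iff_lt_or_eq.mp hj with h | rfl
    · exact ih h h1
    · rw [hx, Option.filter_some, if_pos ht] at h2
      cases h2

theorem scan_map {E' : X → Bool} {f : X → X} (h : ∀ t, E' (f t) = E t) (N : ℕ) :
    scan E' (fun j => (x j).map f) N = (scan E x N).map f := by
  induction N with
  | zero => rfl
  | succ N ih =>
    rw [scan, scan, ih, Option.map_or]
    congr 1
    cases x N with
    | none => rfl
    | some t =>
      rw [Option.map_some, Option.filter_some, Option.filter_some, h]
      split_ifs <;> rfl

theorem nones_map (f : X → X) (N : ℕ) : nones (fun j => (x j).map f) N = nones x N := by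
  induction N with
  | zero => rfl
  | succ N ih => rw [nones, nones, ih]; simp only [Option.map_eq_none_iff]

theorem nones_eq_card [DecidableEq X] (N : ℕ) :
    nones x N = ((Finset.range N).filter fun j => x j = none).card := by
  induction N with
  | zero => rfl
  | succ N ih =>
    rw [nones, Finset.range_add_one, Finset.filter_insert, ih]
    split_ifs with h
    · rw [Finset.card_insert_of_notMem (by simp)]
    · rfl

end Scan

section Rotate

variable {n N p : ℕ} {φ : (Fin n → Bool) → Fin n → Bool} {x : ℕ → Option (ZMod p)} (s : ZMod p)

/-- The positions of sign `s + t` after rotation are those of sign `t` before, so `φ` receives the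
same input. All other equivariance statements reduce to this. -/
theorem part_rotate (t : ZMod p) : part φ (fun j => (x j).map (s + ·)) (s + t) = part φ x t := by
  unfold part
  congr 1
  funext i
  have h : ∀ y : Option (ZMod p), y.map (s + ·) = some (s + t) ↔ y = some t := by
    intro y
    cases y <;> simp
  exact decide_eq_decide.mpr (h _)

theorem hasPart_rotate : HasPart φ (fun j => (x j).map (s + ·)) ↔ HasPart φ x := by
  unfold HasPart
  constructor
  · rintro ⟨t, ht⟩
    refine ⟨t - s, ?_⟩
    rwa [← add_sub_cancel s t, part_rotate] at ht
  · rintro ⟨t, ht⟩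
    exact ⟨s + t, by rwa [part_rotate]⟩

theorem elig_rotate (t : ZMod p) : elig φ (fun j => (x j).map (s + ·)) (s + t) = elig φ x t := by
  rw [Bool.eq_iff_iff, elig_eq_true_iff, elig_eq_true_iff, hasPart_rotate, part_rotate]

theorem lead_rotate : lead φ (fun j => (x j).map (s + ·)) N = (lead φ x N).map (s + ·) :=
  scan_map (elig_rotate s) N

/-- The hypothesis keeps the default in `getD 0` out of play; the default itself is not equivariant.
-/
theorem absLabel_rotate [NeZero p] {χ : (Fin n → Bool) → ℕ} (h : lead φ x N ≠ none) :
    absLabel p φ χ (fun j => (x j).map (s + ·)) N = absLabel p φ χ x N := by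
  unfold absLabel
  obtain ⟨t, ht⟩ := Option.ne_none_iff_exists'.mp h
  rw [lead_rotate, ht, nones_map, Option.map_some, Option.getD_some, Option.getD_some, part_rotate]
  by_cases hH : HasPart φ x
  · rw [if_pos hH, if_pos ((hasPart_rotate s).mpr hH)]
  · rw [if_neg hH, if_neg fun h' => hH ((hasPart_rotate s).mp h')]

end Rotate

/-- For each set `D`, `φ D` is a member of `E` contained in `D`, or empty if there is none. -/
def IsSelector {n : ℕ} (φ : (Fin n → Bool) → Fin n → Bool) (E : Finset (Finset (Fin n))) : Prop :=
  ∀ D : Fin n → Bool, (∃ B ∈ E, (∀ i ∈ B, D i = true) ∧ φ D = charVec B) ∨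
    ((∀ B ∈ E, ¬ ∀ i ∈ B, D i = true) ∧ φ D = charVec ∅)

/-- The members inside `D` form a finite set, so if there is one then there is a least one. Only the
existence of a determined choice matters later, not its minimality. -/
theorem isSelector_of_linearOrder {n : ℕ} {φ : (Fin n → Bool) → Fin n → Bool}
    {E : Finset (Finset (Fin n))} (ord : LinearOrder {B : Finset (Fin n) // B ∈ E})
    (h : ∀ D : Finset (Fin n),
      (∀ B : {B : Finset (Fin n) // B ∈ E}, B.1 ⊆ D →
        (∀ B' : {B : Finset (Fin n) // B ∈ E}, B'.1 ⊆ D → ord.le B B') →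
          φ (charVec D) = charVec B.1) ∧
      ((∀ B ∈ E, ¬ B ⊆ D) → φ (charVec D) = charVec ∅)) : IsSelector φ E := by
  intro D
  obtain ⟨h1, h2⟩ := h (Finset.univ.filter fun i => D i = true)
  have hD : charVec (Finset.univ.filter fun i => D i = true) = D := by
    funext i
    rw [charVec, Bool.eq_iff_iff]
    simp
  have hs : ∀ B : Finset (Fin n), B ⊆ (Finset.univ.filter fun i => D i = true) ↔
      ∀ i ∈ B, D i = true := fun B => by simp [Finset.subset_iff]
  simp only [hD, hs] at h1 h2
  by_cases hE : ∀ B ∈ E, ¬ ∀ i ∈ B, D i = true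
  · exact Or.inr ⟨hE, h2 hE⟩
  · push Not at hE
    obtain ⟨B, hB, hBD⟩ := hE
    obtain ⟨B', hB', hmin⟩ := Finset.exists_min_image
      (Finset.univ.filter fun B : {B : Finset (Fin n) // B ∈ E} => ∀ i ∈ B.1, D i = true) id
      ⟨⟨B, hB⟩, by simpa using hBD⟩
    rw [Finset.mem_filter] at hB'
    refine Or.inl ⟨B'.1, B'.2, hB'.2, h1 B' hB'.2 fun B'' h'' => hmin B'' ?_⟩
    simpa using h''

theorem colorabilityDefect_le {n p : ℕ} [NeZero p] {E : Finset (Finset (Fin n))}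
    (hE : ∀ B ∈ E, B.Nonempty) : colorabilityDefect p E ≤ n := by
  refine Nat.sInf_le ⟨Finset.univ, by simp, fun _ => 0, fun e he hd => ?_⟩
  have := hE e he
  rw [← Finset.top_eq_univ, disjoint_top] at hd
  exact absurd hd this.ne_empty

section Selector

variable {n N p : ℕ} {φ : (Fin n → Bool) → Fin n → Bool} {E : Finset (Finset (Fin n))}
  {x : ℕ → Option (ZMod p)}

theorem IsSelector.le (hφ : IsSelector φ E) {t : ZMod p} {j : Fin n} (h : part φ x t j = true) :
    x j = some t := by
  rcases hφ fun i => decide (x i = some t) with ⟨B, -, h1, h2⟩ | ⟨-, h2⟩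
  · rw [part, h2] at h
    simpa using h1 j (by simpa [charVec] using h)
  · rw [part, h2] at h
    simp [charVec] at h

theorem IsSelector.exists_mem (hφ : IsSelector φ E) {t : ZMod p} (h : ∃ j, part φ x t j = true) :
    ∃ B ∈ E, part φ x t = charVec B := by
  rcases hφ fun i => decide (x i = some t) with ⟨B, h1, -, h2⟩ | ⟨-, h2⟩
  · exact ⟨B, h1, h2⟩
  · obtain ⟨j, h⟩ := h
    rw [part, h2] at h
    simp [charVec] at h

/-- If some selected set is non-empty, each of its elements is an entry with an eligible sign;
otherwise all signs are eligible and any non-zero entry will do. -/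
theorem IsSelector.lead_ne_none (hφ : IsSelector φ E) (hn : n ≤ N) {j : ℕ} (hj : j < N)
    (hx : x j ≠ none) : lead φ x N ≠ none := by
  by_cases h : HasPart φ x
  · obtain ⟨t, i, h1⟩ := h
    exact scan_ne_none (by omega) (hφ.le h1) (elig_eq_true_iff.mpr fun _ => ⟨i, h1⟩)
  · obtain ⟨t, ht⟩ := Option.ne_none_iff_exists'.mp hx
    exact scan_ne_none hj ht (elig_eq_true_iff.mpr fun h' => absurd h' h)

/-- Delete the zero positions and color the others by their signs. A monochromatic member would lie
in one sign class, and then `φ` would have found a member there. Positions beyond `n` can only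
increase the number of zeros. -/
theorem IsSelector.defect_le [NeZero p] (hφ : IsSelector φ E) (hE : ∀ B ∈ E, B.Nonempty) (hn : n ≤ N)
    (h : ¬ HasPart φ x) : colorabilityDefect p E ≤ nones x N := by
  have h1 : (Finset.univ.filter fun i : Fin n => x i = none).card ≤ nones x N := by
    rw [nones_eq_card]
    refine Finset.card_le_card_of_injOn (fun i => (i : ℕ)) (fun i hi => ?_)
      Fin.val_injective.injOn
    have hi' : x i = none := by simpa using hi
    simpa [hi'] using i.2.trans_le hn
  -- The default color of zero entries is irrelevant, since only members that avoid these entries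
  -- are tested.
  refine le_trans (Nat.sInf_le ⟨_, rfl, fun i => ⟨((x i).getD 0).val, ZMod.val_lt _⟩, ?_⟩) h1
  rintro e he hd ⟨c, hc⟩
  refine h ⟨((c : ℕ) : ZMod p), ?_⟩
  have h2 : ∀ i ∈ e, x i = some ((c : ℕ) : ZMod p) := by
    intro i hi
    have h3 : x i ≠ none := fun h' => Finset.disjoint_left.mp hd hi (by simpa using h')
    obtain ⟨t, ht⟩ := Option.ne_none_iff_exists'.mp h3
    rw [← hc i hi]
    simp [ht]
  rcases hφ fun i => decide (x i = some ((c : ℕ) : ZMod p)) with ⟨B, h3, -, h4⟩ | ⟨h3, -⟩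
  · obtain ⟨j, hj⟩ := hE B h3
    refine ⟨j, ?_⟩
    rw [part, h4]
    simpa [charVec] using hj
  · exact absurd (fun i hi => by simpa using h2 i hi) (h3 e he)

end Selector

theorem ceilQuot_bounds {z d : ℕ} (hd : 0 < d) :
    z ≤ ceilQuot z d * d ∧ ceilQuot z d * d < z + d := by
  unfold ceilQuot
  have h1 := Nat.div_add_mod (z + d - 1) d
  have h2 := Nat.mod_lt (z + d - 1) hd
  rw [mul_comm] at h1
  omega

theorem ceilQuot_le_iff {z d c : ℕ} (hd : 0 < d) : ceilQuot z d ≤ c ↔ z ≤ c * d := by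
  obtain ⟨h1, h2⟩ := ceilQuot_bounds (z := z) hd
  constructor
  · exact fun h => h1.trans (Nat.mul_le_mul_right d h)
  · intro h
    by_contra! h3
    have := Nat.mul_le_mul_right d (Nat.succ_le_of_lt h3)
    rw [Nat.succ_mul] at this
    omega

/-- The entries of a signed set, followed by zeros. -/
def entries {p N : ℕ} (X : SignedSet p N) (j : ℕ) : Option (ZMod p) :=
  if h : j < N then X ⟨j, h⟩ else none

section Entries

variable {p N : ℕ} {X Y : SignedSet p N}

theorem entries_fin (j : Fin N) : entries X j = X j := dif_pos j.2

theorem entries_rotate (s : ZMod p) :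
    entries (X.rotate s) = fun j => (entries X j).map (s + ·) := by
  funext j
  unfold entries
  split_ifs <;> rfl

theorem exists_entries_ne_none (h : X ≠ SignedSet.zero p N) : ∃ j < N, entries X j ≠ none := by
  by_contra! h1
  exact h (funext fun j => (entries_fin j).symm.trans (h1 j j.2))

theorem nones_lt (h : X ≠ SignedSet.zero p N) : nones (entries X) N < N := by
  obtain ⟨j, hj, h1⟩ := exists_entries_ne_none h
  rw [nones_eq_card]
  refine (Finset.card_lt_card ?_).trans_eq (Finset.card_range N)
  refine (Finset.filter_ssubset).mpr ⟨j, Finset.mem_range.mpr hj, h1⟩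

/-- The zeros of the larger signed set are among those of the smaller one; equal cardinality forces
equality, and the remaining entries agree anyway. -/
theorem eq_of_below_of_nones_eq (h : X.Below Y) (h' : nones (entries X) N = nones (entries Y) N) :
    X = Y := by
  rw [nones_eq_card, nones_eq_card] at h'
  have hsub : ((Finset.range N).filter fun j => entries Y j = none) ⊆
      (Finset.range N).filter fun j => entries X j = none := by
    intro j hj
    rw [Finset.mem_filter, Finset.mem_range] at hj ⊢
    refine ⟨hj.1, ?_⟩
    by_contra h1
    have h2 := h ⟨j, hj.1⟩ fun h0 => h1 ((entries_fin (X := X) ⟨j, hj.1⟩).trans h0)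
    exact h1 ((entries_fin (X := X) ⟨j, hj.1⟩).trans (h2.trans
      ((entries_fin (X := Y) ⟨j, hj.1⟩).symm.trans hj.2)))
  have heq := Finset.eq_of_subset_of_card_le hsub h'.le
  funext j
  by_cases h1 : X j = none
  · have : (j : ℕ) ∈ (Finset.range N).filter fun j => entries Y j = none := by
      rw [heq, Finset.mem_filter, Finset.mem_range, entries_fin]
      exact ⟨j.2, h1⟩
    rw [Finset.mem_filter, entries_fin] at this
    rw [h1, this.2]
  · exact h j h1

end Entries

/-- With truncated subtraction the inequality fails for defect `0`; the hypothesis that the palette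
is non-empty excludes this. -/
theorem defect_bounds {n p : ℕ} {E : Finset (Finset (Fin n))} (hp : 2 ≤ p) (h : 1 ≤ (colorabilityDefect p E - 1) / (p - 1)) :
    (colorabilityDefect p E - 1) / (p - 1) * (p - 1) < colorabilityDefect p E := by
  have h1 := Nat.div_mul_le_self (colorabilityDefect p E - 1) (p - 1)
  have h2 := Nat.mul_le_mul_right (p - 1) h
  omega

section Main

variable {n p : ℕ} [NeZero p] {φ : (Fin n → Bool) → Fin n → Bool} {E : Finset (Finset (Fin n))}
  {χ : (Fin n → Bool) → ℕ}

/-- This separates the two kinds of labels: counts of zeros lie strictly above all colors. -/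
theorem lt_absLabel (hp : 2 ≤ p) (hφ : IsSelector φ E) (hE : ∀ B ∈ E, B.Nonempty)
    {N : ℕ} (hn : n ≤ N) (hm : 1 ≤ (colorabilityDefect p E - 1) / (p - 1)) {x : ℕ → Option (ZMod p)}
    (h : ¬ HasPart φ x) : (colorabilityDefect p E - 1) / (p - 1) < absLabel p φ χ x N := by
  rw [absLabel, if_neg h, ← not_le, ceilQuot_le_iff (by omega), not_le]
  exact (defect_bounds hp hm).trans_le (hφ.defect_le hE hn h)

theorem absLabel_le (hχ : ∀ y, χ y ∈ Finset.Icc 1 ((colorabilityDefect p E - 1) / (p - 1)))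
    {N : ℕ} {x : ℕ → Option (ZMod p)} (h : HasPart φ x) :
    absLabel p φ χ x N ∈ Finset.Icc 1 ((colorabilityDefect p E - 1) / (p - 1)) := by
  rw [absLabel, if_pos h]
  exact hχ _

/-- Here the length of the signed sets is decisive: a non-zero one has at most `(p - 1) * n` zeros,
so the rounded quotient is at most `n`. Colors fit as well, because the defect is at most `n`. -/
theorem absLabel_mem (hp : 2 ≤ p) (hφ : IsSelector φ E) (hE : ∀ B ∈ E, B.Nonempty)
    (hχ : ∀ y, χ y ∈ Finset.Icc 1 ((colorabilityDefect p E - 1) / (p - 1)))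
    {X : SignedSet p ((p - 1) * n + 1)} (hX : X ≠ SignedSet.zero p ((p - 1) * n + 1)) :
    absLabel p φ χ (entries X) ((p - 1) * n + 1) ∈ Finset.Icc 1 n := by
  have hn : n ≤ (p - 1) * n + 1 := by
    have := Nat.mul_le_mul_right n (by omega : 1 ≤ p - 1)
    omega
  -- Coloring any one vector shows that the palette is non-empty.
  have hm := (Finset.mem_Icc.mp (hχ 0)).1.trans (Finset.mem_Icc.mp (hχ 0)).2
  by_cases h : HasPart φ (entries X)
  · refine Finset.Icc_subset_Icc_right ?_ (absLabel_le hχ h)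
    have := colorabilityDefect_le (p := p) hE
    exact (Nat.div_le_self _ _).trans (by omega)
  · refine Finset.mem_Icc.mpr ⟨by have := lt_absLabel (χ := χ) hp hφ hE hn hm h; omega, ?_⟩
    rw [absLabel, if_neg h, ceilQuot_le_iff (by omega), mul_comm n]
    exact Nat.lt_succ_iff.mp (nones_lt hX)

/-- A label above the palette would make every member of the chain a count of zeros. Then `p` counts
share `p - 1` values, two signed sets of the chain coincide, and so do their signs, against the
injectivity of `π`. -/
theorem hasPart_of_chain (hp : 2 ≤ p) (hφ : IsSelector φ E) (hE : ∀ B ∈ E, B.Nonempty)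
    (hχ : ∀ y, χ y ∈ Finset.Icc 1 ((colorabilityDefect p E - 1) / (p - 1))) {N : ℕ} (hn : n ≤ N)
    {X : Fin p → SignedSet p N} {π : Fin p ≃ ZMod p} {l : ℕ}
    (hb : ∀ i j, i ≤ j → (X i).Below (X j)) (h1 : ∀ i, lead φ (entries (X i)) N = some (π i))
    (h2 : ∀ i, absLabel p φ χ (entries (X i)) N = l) (i : Fin p) : HasPart φ (entries (X i)) := by
  by_contra hi
  have hm := (Finset.mem_Icc.mp (hχ 0)).1.trans (Finset.mem_Icc.mp (hχ 0)).2
  have hl := lt_absLabel (χ := χ) hp hφ hE hn hm hi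
  rw [h2 i] at hl
  have hno : ∀ j, ¬ HasPart φ (entries (X j)) := by
    intro j hj
    have := (Finset.mem_Icc.mp (absLabel_le (N := N) hχ hj)).2
    rw [h2 j] at this
    omega
  -- A rounded quotient `l` confines the count to the `p - 1` integers up to `l * (p - 1)`.
  have hz : ∀ j, nones (entries (X j)) N ∈ Finset.Ioc (l * (p - 1) - (p - 1)) (l * (p - 1)) := by
    intro j
    have h3 := h2 j
    rw [absLabel, if_neg (hno j)] at h3
    have h4 := ceilQuot_bounds (z := nones (entries (X j)) N) (d := p - 1) (by omega)
    rw [h3] at h4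
    have h5 : 1 * (p - 1) ≤ l * (p - 1) := Nat.mul_le_mul_right _ (by omega)
    rw [Finset.mem_Ioc]
    omega
  obtain ⟨a, -, b, -, hab, hzz⟩ := Finset.exists_ne_map_eq_of_card_lt_of_maps_to
    (s := (Finset.univ : Finset (Fin p))) (t := Finset.Ioc (l * (p - 1) - (p - 1)) (l * (p - 1)))
    (by rw [Nat.card_Ioc, Finset.card_univ, Fintype.card_fin]; omega) (fun j _ => hz j)
  have hXX : X a = X b := by
    rcases le_total a b with h | h
    · exact eq_of_below_of_nones_eq (hb a b h) hzz
    · exact (eq_of_below_of_nones_eq (hb b a h) hzz.symm).symm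
  have := h1 a
  rw [hXX, h1 b, Option.some_inj] at this
  exact hab (π.injective this.symm)

/-- A chain on which the labelling is constant up to the sign gives disjoint sets. -/
theorem exists_sets_of_chain (hp : 2 ≤ p) (hφ : IsSelector φ E) (hE : ∀ B ∈ E, B.Nonempty)
    (hχ : ∀ y, χ y ∈ Finset.Icc 1 ((colorabilityDefect p E - 1) / (p - 1))) {N : ℕ} (hn : n ≤ N)
    {X : Fin p → SignedSet p N} {π : Fin p ≃ ZMod p} {l : ℕ}
    (hb : ∀ i j, i ≤ j → (X i).Below (X j)) (h1 : ∀ i, lead φ (entries (X i)) N = some (π i))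
    (h2 : ∀ i, absLabel p φ χ (entries (X i)) N = l) :
    ∃ B : Fin p → Finset (Fin n), (∀ i, B i ∈ E) ∧ (∀ i j, i ≠ j → Disjoint (B i) (B j)) ∧
      ∀ i, part φ (entries (X i)) (π i) = charVec (B i) ∧ χ (charVec (B i)) = l := by
  have hH := hasPart_of_chain hp hφ hE hχ hn hb h1 h2
  have hB : ∀ i, ∃ B ∈ E, part φ (entries (X i)) (π i) = charVec B := fun i =>
    hφ.exists_mem (elig_eq_true_iff.mp (scan_eq_some (h1 i)).1 (hH i))
  choose B hBE hB using hB
  refine ⟨B, hBE, fun i j hij => ?_, fun i => ⟨hB i, ?_⟩⟩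
  · have key : ∀ i k, i ≤ k → ∀ a ∈ B i, entries (X k) a = some (π i) := by
      intro i k hik a ha
      have h3 : entries (X i) a = some (π i) := hφ.le (by rw [hB i]; simpa [charVec] using ha)
      have h4 := (entries_fin (X := X i) ⟨a, a.2.trans_le hn⟩).symm.trans h3
      rw [← h4, hb i k hik ⟨a, a.2.trans_le hn⟩ (by simp [h4])]
      exact entries_fin (X := X k) ⟨a, a.2.trans_le hn⟩
    rw [Finset.disjoint_left]
    intro a hi hj
    have h3 := key i (max i j) (le_max_left _ _) a hi
    rw [key j (max i j) (le_max_right _ _) a hj, Option.some_inj] at h3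
    exact hij (π.injective h3.symm)
  · have h3 := h2 i
    rw [absLabel, if_pos (hH i), h1 i, Option.getD_some, hB i] at h3
    exact h3

end Main

end KneserTucker

namespace KneserTucker

open Code

/-! ### The reduction -/

section

variable {p n N k : ℕ} (C : Circuit n n) (D : Circuit n k)

/-- The output wires of the circuit of the reduction. -/
def reductionOuts (p n N L M K : ℕ) : List ℕ :=
  (List.range p).map (leadWire p n N L) ++
    (List.range K).map fun i => muxBase p n N L M K + 3 * i + 2

/-- The circuit of the reduction. -/
def reductionCircuit (hp : 2 ≤ p) (hn : n ≤ N) : Circuit (N * p) (p + (n + k)) where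
  gates := (reductionGates p n N (C.gates.map ofGate) (List.ofFn C.outputs) (D.gates.map ofGate)
    (List.ofFn D.outputs)).map toGate
  gates_wf i hi j hj := by
    rw [List.length_map] at hi
    refine wf_reductionGates (p := p) (N := N) C D hp C.map_toGate_ofGate.symm
      D.map_toGate_ofGate.symm hn i _ (List.getElem?_eq_getElem hi) j ?_
    rwa [List.getElem_map] at hj
  outputs := Fin.append
    (fun t : Fin p => leadWire p n N (n + ((C.gates.map ofGate).length + n)) t)
    (fun i : Fin (n + k) => muxBase p n N (n + ((C.gates.map ofGate).length + n))
      (n + ((D.gates.map ofGate).length + k)) (n + k) + 3 * i + 2)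
  outputs_wf i := by
    have hlen := length_reductionGates (p := p) (n := n) (N := N) (gs := C.gates.map ofGate)
      (gs' := D.gates.map ofGate) (os := List.ofFn C.outputs) (os' := List.ofFn D.outputs)
      (L := n + ((C.gates.map ofGate).length + n)) (M := n + ((D.gates.map ofGate).length + k))
      (K := n + k) (by simp) (by simp) (by simp)
    refine lt_of_lt_of_eq ?_ ((congrArg (N * p + ·) (List.length_map toGate)).trans hlen).symm
    refine Fin.addCases (fun t => ?_) (fun i => ?_) i
    · rw [Fin.append_left]
      refine (leadWire_lt t.2).trans_le ?_
      unfold muxBase countBase colorBase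
      omega
    · rw [Fin.append_right]
      omega

theorem reductionCircuit_outputs (hp : 2 ≤ p) (hn : n ≤ N) :
    (reductionCircuit C D hp hn).outputs = Fin.append
      (fun t : Fin p => leadWire p n N (n + ((C.gates.map ofGate).length + n)) t)
      (fun i : Fin (n + k) => muxBase p n N (n + ((C.gates.map ofGate).length + n))
        (n + ((D.gates.map ofGate).length + k)) (n + k) + 3 * i + 2) := rfl

theorem ofFn_eq_map_range {X : Type*} (m : ℕ) (f : ℕ → X) :
    (List.ofFn fun i : Fin m => f i) = (List.range m).map f :=
  List.ext_getElem (by simp) fun i h1 h2 => by simp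

theorem ofFn_outputs_reductionCircuit (hp : 2 ≤ p) (hn : n ≤ N) :
    List.ofFn (reductionCircuit C D hp hn).outputs =
      reductionOuts p n N (n + ((C.gates.map ofGate).length + n))
        (n + ((D.gates.map ofGate).length + k)) (n + k) := by
  rw [reductionCircuit_outputs, List.ofFn_fin_append, reductionOuts]
  exact congrArg₂ _ (ofFn_eq_map_range p _) (ofFn_eq_map_range (n + k) fun i =>
    muxBase p n N (n + ((C.gates.map ofGate).length + n))
        (n + ((D.gates.map ofGate).length + k)) (n + k) + 3 * i + 2)

theorem bits_apply [NeZero p] (X : SignedSet p N) {j t : ℕ} (hj : j < N) (ht : t < p) :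
    X.bits ⟨j * p + t, mul_add_lt hj ht⟩ = decide (entries X j = some ((t : ℕ) : ZMod p)) := by
  have h : (⟨j * p + t, mul_add_lt hj ht⟩ : Fin (N * p)) = finProdFinEquiv (⟨j, hj⟩, ⟨t, ht⟩) :=
    Fin.ext (by simp [add_comm, mul_comm])
  have h' : entries X j = X ⟨j, hj⟩ := entries_fin (X := X) ⟨j, hj⟩
  rw [h, h', SignedSet.bits, Equiv.symm_apply_apply]
  rfl

theorem signBits_some_injective [NeZero p] {a b : ZMod p}
    (h : ∀ t : Fin p, signBits (some a) t = signBits (some b) t) : a = b := by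
  have h1 := h ⟨a.val, a.val_lt⟩
  simp only [signBits, ZMod.natCast_zmod_val, Option.some_inj] at h1
  rw [decide_eq_decide] at h1
  exact (h1.mp trivial).symm

variable [NeZero p] {E : Finset (Finset (Fin n))}

theorem labels_reductionCircuit (hp : 2 ≤ p) (hn : n ≤ N) (hk : ceilQuot N (p - 1) < 2 ^ (n + k))
    (hC : IsSelector C.eval E) {X : SignedSet p N} (hX : X ≠ SignedSet.zero p N) :
    Labels (reductionCircuit C D hp hn) X ((lead C.eval (entries X) N).getD 0,
      absLabel p C.eval (fun y => binValue (D.eval y)) (entries X) N) := by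
  obtain ⟨j, hj, h1⟩ := exists_entries_ne_none hX
  have hlead := hC.lead_ne_none hn hj h1
  have hv := (reductionCircuit C D hp hn).holds_wire rfl X.bits
  have hx : ∀ j < N, ∀ t < p, (reductionCircuit C D hp hn).wire X.bits (j * p + t) =
      decide (entries X j = some ((t : ℕ) : ZMod p)) := fun j hj t ht =>
    ((reductionCircuit C D hp hn).wire_input X.bits ⟨j * p + t, mul_add_lt hj ht⟩).trans
      (bits_apply X hj ht)
  constructor
  · intro t
    have h2 := (holds_leadGates C C.map_toGate_ofGate.symm ((at_reductionGates rfl rfl rfl).mp hv).1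
      hn hx).2.2.1 t t.2
    obtain ⟨s, hs⟩ := Option.ne_none_iff_exists'.mp hlead
    rw [Circuit.eval, reductionCircuit_outputs, Fin.append_left]
    refine h2.trans ?_
    rw [hs]
    rfl
  · have h2 := holds_reductionGates C D hp C.map_toGate_ofGate.symm D.map_toGate_ofGate.symm hv hn
      hk hx hlead
    refine Eq.trans (binValue_eq_bitSum fun i => ?_) h2
    rw [Circuit.eval, reductionCircuit_outputs, Fin.append_right]
    rfl

/-- The output bits determine sign and absolute value, so the labels claimed by a solution must be
those computed by the circuit. -/
theorem lead_of_labels (hp : 2 ≤ p) (hn : n ≤ N) (hk : ceilQuot N (p - 1) < 2 ^ (n + k))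
    (hC : IsSelector C.eval E) {X : SignedSet p N} (hX : X ≠ SignedSet.zero p N) {y : ZMod p × ℕ}
    (h : Labels (reductionCircuit C D hp hn) X y) :
    lead C.eval (entries X) N = some y.1 ∧
      absLabel p C.eval (fun y => binValue (D.eval y)) (entries X) N = y.2 := by
  obtain ⟨h1, h2⟩ := labels_reductionCircuit C D hp hn hk hC hX
  obtain ⟨j, hj, h3⟩ := exists_entries_ne_none hX
  obtain ⟨s, hs⟩ := Option.ne_none_iff_exists'.mp (hC.lead_ne_none hn hj h3)
  refine ⟨?_, h2.symm.trans h.2⟩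
  rw [hs] at h1 ⊢
  exact congrArg some (signBits_some_injective fun t => (h1 t).symm.trans (h.1 t))

/-- The instance of the Tucker problem constructed by the reduction. -/
def reductionInstance (hp : 2 ≤ p) (hC : IsSelector C.eval E) (hE : ∀ B ∈ E, B.Nonempty)
    (hn : n ≤ (p - 1) * n + 1) (hk : ceilQuot ((p - 1) * n + 1) (p - 1) < 2 ^ (n + k))
    (hD : ∀ y, binValue (D.eval y) ∈ Finset.Icc 1 ((colorabilityDefect p E - 1) / (p - 1))) :
    TuckerInstance p where
  n := (p - 1) * n + 1
  s := n
  -- Equality holds, by the choice of the length.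
  s_le := by
    rw [Int.le_ediv_iff_mul_le (by omega)]
    push_cast [show 1 ≤ p by omega]
    apply le_of_eq
    ring
  k := n + k
  C := reductionCircuit C D hp hn
  equivariant := by
    refine ⟨fun X => ((lead C.eval (entries X) ((p - 1) * n + 1)).getD 0,
      absLabel p C.eval (fun y => binValue (D.eval y)) (entries X) ((p - 1) * n + 1)),
      fun X hX => ⟨labels_reductionCircuit C D hp hn hk hC hX, absLabel_mem hp hC hE hD hX,
        fun t => ?_⟩⟩
    obtain ⟨j, hj, h1⟩ := exists_entries_ne_none hX
    have hlead := hC.lead_ne_none hn hj h1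
    obtain ⟨s, hs⟩ := Option.ne_none_iff_exists'.mp hlead
    dsimp only
    rw [entries_rotate, absLabel_rotate t hlead, lead_rotate, hs]
    rfl

end

/-! ### Algorithms -/

/-- The output of the first algorithm, given two parsed circuits. -/
def reductionOutput (p : ℕ) (c c' : ℕ × List (ℕ × ℕ × ℕ) × List ℕ) : List Bool :=
  (((p - 1) * c.1 + 1) :: c.1 :: circuitNats (((p - 1) * c.1 + 1) * p)
    (reductionGates p c.1 ((p - 1) * c.1 + 1) c.2.1 c.2.2 c'.2.1 c'.2.2)
    (reductionOuts p c.1 ((p - 1) * c.1 + 1) (c.1 + (c.2.1.length + c.2.2.length))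
      (c.1 + (c'.2.1.length + c'.2.2.length)) (c.1 + c'.2.2.length))).flatMap encNat

/-- The bits of the set selected by a parsed circuit for the leading sign. -/
def leadSet (p : ℕ) (c : ℕ × List (ℕ × ℕ × ℕ) × List ℕ) (w : List Bool) : List Bool :=
  (List.range c.1).map fun j => (runGates (leadGates p c.1 ((p - 1) * c.1 + 1) c.2.1 c.2.2) w).getD
    (setWire p c.1 ((p - 1) * c.1 + 1) (c.1 + (c.2.1.length + c.2.2.length)) j) false

/-- The output of the second algorithm, given a parsed circuit and a solution. -/
def solutionOutput (p : ℕ) (c : ℕ × List (ℕ × ℕ × ℕ) × List ℕ) (w : List Bool) : List Bool :=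
  (List.range p).flatMap fun i => leadSet p c
    ((w.drop (i * (((p - 1) * c.1 + 1) * p))).take (((p - 1) * c.1 + 1) * p))

/-- A circuit as a number of inputs, a list of gates, and a list of outputs. -/
abbrev GateLists : Type := (ℕ × List (ℕ × ℕ × ℕ) × List ℕ)

/-- After unfolding, only list operations and arithmetic on addresses remain, with `p` a constant.
Addresses are unary and stay polynomially large. -/
theorem PT.leadGates (p : ℕ) : PT fun c : GateLists =>
    leadGates p c.1 ((p - 1) * c.1 + 1) c.2.1 c.2.2 := by
  unfold KneserTucker.leadGates callsBlock orsBlock eligBlock scanBlock selectBlock scanStep callBlock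
    orBlock leadWire selectBase scanBase eligBase testBase shiftGate
  fun_prop

theorem PT.setWire (p : ℕ) : PT fun c : GateLists × ℕ =>
    setWire p c.1.1 ((p - 1) * c.1.1 + 1) (c.1.1 + (c.1.2.1.length + c.1.2.2.length)) c.2 := by
  unfold KneserTucker.setWire selectBase scanBase eligBase testBase
  fun_prop

theorem PT.leadSet (p : ℕ) : PT fun x : GateLists × List Bool => leadSet p x.1 x.2 := by
  have h1 : PT fun x : GateLists × List Bool =>
      KneserTucker.leadGates p x.1.1 ((p - 1) * x.1.1 + 1) x.1.2.1 x.1.2.2 :=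
    (PT.leadGates p).comp PT.fst
  have h2 : PT fun x : GateLists × List Bool =>
      KneserTucker.runGates (KneserTucker.leadGates p x.1.1 ((p - 1) * x.1.1 + 1) x.1.2.1 x.1.2.2) x.2 :=
    h1.runGates PT.snd
  refine PT.map (PT.fst.comp PT.fst).range (PT.getD ((PT.setWire p).comp
    (f := fun x : (GateLists × List Bool) × ℕ => (x.1.1, x.2)) (by fun_prop)) (h2.comp PT.fst)
    (PT.const _))

theorem PT.countStep (p d : ℕ) : PT fun x : (ℕ × ℕ) × ℕ × ℕ =>
    countStep p d x.1.1 x.1.2 x.2.1 x.2.2 := by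
  unfold KneserTucker.countStep orBlock cycPred
  fun_prop

theorem PT.countBlock (p d : ℕ) : PT fun x : ℕ × ℕ × ℕ => countBlock x.1 p d x.2.1 x.2.2 := by
  refine PT.append ?_ (PT.flatMap (PT.range (by fun_prop)) ((PT.countStep p d).comp
    (f := fun x : (ℕ × ℕ × ℕ) × ℕ => ((x.1.2.2, _), _, _)) ?_))
  · unfold countLen
    fun_prop
  · unfold countLen
    fun_prop

section

variable (p : ℕ)

theorem PT.eligBase : PT fun c : GateLists =>
    eligBase p c.1 ((p - 1) * c.1 + 1) (c.1 + (c.2.1.length + c.2.2.length)) := by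
  unfold KneserTucker.eligBase testBase
  fun_prop

theorem PT.colorBase : PT fun c : GateLists =>
    colorBase p c.1 ((p - 1) * c.1 + 1) (c.1 + (c.2.1.length + c.2.2.length)) := by
  unfold KneserTucker.colorBase selectBase scanBase KneserTucker.eligBase testBase
  fun_prop

theorem PT.countBase : PT fun x : GateLists × GateLists =>
    countBase p x.1.1 ((p - 1) * x.1.1 + 1) (x.1.1 + (x.1.2.1.length + x.1.2.2.length))
      (x.1.1 + (x.2.2.1.length + x.2.2.2.length)) :=
  ((PT.colorBase p).comp PT.fst).add (by fun_prop)

theorem PT.muxBase : PT fun x : GateLists × GateLists =>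
    muxBase p x.1.1 ((p - 1) * x.1.1 + 1) (x.1.1 + (x.1.2.1.length + x.1.2.2.length))
      (x.1.1 + (x.2.2.1.length + x.2.2.2.length)) (x.1.1 + x.2.2.2.length) :=
  (PT.countBase p).add (by unfold countLen; fun_prop)

theorem PT.reductionGates : PT fun x : GateLists × GateLists =>
    reductionGates p x.1.1 ((p - 1) * x.1.1 + 1) x.1.2.1 x.1.2.2 x.2.2.1 x.2.2.2 := by
  have h1 := (PT.colorBase p).comp (PT.fst (α := GateLists) (β := GateLists))
  have h2 := (PT.eligBase p).comp (PT.fst (α := GateLists) (β := GateLists))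
  have h3 := PT.countBase p
  have h4 := PT.muxBase p
  refine ((PT.leadGates p).comp PT.fst).append (PT.append ?_ (PT.append (by fun_prop)
    (PT.append ?_ ?_)))
  · have hs : PT fun x : (GateLists × GateLists) × ℕ => KneserTucker.setWire p x.1.1.1
        ((p - 1) * x.1.1.1 + 1) (x.1.1.1 + (x.1.1.2.1.length + x.1.1.2.2.length)) x.2 :=
      (PT.setWire p).comp (f := fun x : (GateLists × GateLists) × ℕ => (x.1.1, x.2)) (by fun_prop)
    refine PT.append (PT.map (by fun_prop) ((PT.const 3).pair (hs.pair hs))) (PT.append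
      (PT.map (by fun_prop) ?_) (PT.map (by fun_prop) ?_))
    · have h5 := h1.comp (PT.fst (α := GateLists × GateLists) (β := ℕ × ℕ × ℕ))
      exact PT.pair (by fun_prop) ((h5.add (by fun_prop)).pair (h5.add (by fun_prop)))
    · have h5 := h1.comp (PT.fst (α := GateLists × GateLists) (β := ℕ))
      exact (PT.const 3).pair ((h5.add (by fun_prop)).pair (h5.add (by fun_prop)))
  · have h5 : PT fun x : GateLists × GateLists =>
        ((p - 1) * x.1.1 + 1, x.1.1 + x.2.2.2.length) := by fun_prop
    exact (PT.countBlock p (p - 1)).comp (h3.pair h5)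
  · have h1 := h1.comp (PT.fst (α := GateLists × GateLists) (β := ℕ))
    have h2 := h2.comp (PT.fst (α := GateLists × GateLists) (β := ℕ))
    have h3 := h3.comp (PT.fst (α := GateLists × GateLists) (β := ℕ))
    have h4 := h4.comp (PT.fst (α := GateLists × GateLists) (β := ℕ))
    refine PT.flatMap (by fun_prop) (PT.cons ?_ (PT.cons ?_ (PT.cons ?_ (PT.const []))))
    · exact (PT.const 3).pair ((h2.add (PT.const _)).pair ((h1.add (by fun_prop)).add (by fun_prop)))
    · have h5 : PT fun x : (GateLists × GateLists) × ℕ => ((p - 1) * x.1.1.1 + 1) *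
          countLen p (p - 1) (x.1.1.1 + x.1.2.2.2.length) := by
        unfold countLen
        fun_prop
      have h6 : PT fun x : (GateLists × GateLists) × ℕ => 5 * x.2 := by fun_prop
      have h7 := ((((h3.add h5).add (PT.const p)).add (PT.const (3 * (p - 1)))).add
        (PT.const 6)).add h6
      exact (PT.const 3).pair (((h2.add (PT.const p)).succ).pair h7)
    · exact (PT.const 4).pair ((h4.add (by fun_prop)).pair ((h4.add (by fun_prop)).succ))

theorem PT.reductionOuts : PT fun x : GateLists × GateLists =>
    reductionOuts p x.1.1 ((p - 1) * x.1.1 + 1) (x.1.1 + (x.1.2.1.length + x.1.2.2.length))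
      (x.1.1 + (x.2.2.1.length + x.2.2.2.length)) (x.1.1 + x.2.2.2.length) := by
  refine PT.append ?_ (PT.map (by fun_prop) ((((PT.muxBase p).comp PT.fst).add (by fun_prop)).add
    (PT.const 2)))
  unfold leadWire scanBase KneserTucker.eligBase testBase
  fun_prop

theorem PT.reductionOutput :
    PT fun x : GateLists × GateLists => reductionOutput p x.1 x.2 :=
  PT.flatMap (PT.cons (by fun_prop) (PT.cons (by fun_prop) (PT.circuitNats (by fun_prop)
    (PT.reductionGates p) (PT.reductionOuts p)))) (by fun_prop)

end

theorem PT.solutionOutput (p : ℕ) :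
    PT fun x : GateLists × List Bool => solutionOutput p x.1 x.2 := by
  refine PT.flatMap (PT.const _) ((PT.leadSet p).comp
    (f := fun x : (GateLists × List Bool) × ℕ => (x.1.1, _)) ?_)
  fun_prop

end KneserTucker

namespace KneserTucker

open Code

/-! ### The algorithms on encoded instances, and the conclusion -/

theorem OutputsWithin.mono {M : TM2ComputableAux Bool Bool} {x y : List Bool} {s t : ℕ}
    (h : OutputsWithin M x y s) (hst : s ≤ t) : OutputsWithin M x y t := by
  obtain ⟨c, ⟨e⟩, h1, h2⟩ := h
  exact ⟨c, ⟨⟨e.toEvalsTo, e.steps_le_m.trans hst⟩⟩, h1, h2⟩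

theorem length_encPair (x y : List Bool) : (encPair x y).length = 2 * x.length + 1 + y.length := by
  have h : ∀ x : List Bool, (x.flatMap fun b => [true, b]).length = 2 * x.length := by
    intro x
    induction x with
    | nil => rfl
    | cons b x ih => rw [List.flatMap_cons, List.length_append, ih, List.length_cons]; simp; omega
  rw [encPair, List.length_append, h, List.length_cons]
  omega

/-- The number of inputs is encoded in unary; a running time polynomial in `n` is therefore
polynomial in the length of the instance. -/
theorem Circuit.le_length_enc {n m : ℕ} (C : Circuit n m) : n ≤ C.enc.length := by
  simp only [Circuit.enc, encNat, List.length_append, List.length_replicate]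
  omega

theorem take_drop_flatten {X : Type*} {m : ℕ} (l : List (List X)) (h : ∀ a ∈ l, a.length = m) {i : ℕ}
    (hi : i < l.length) : (l.flatten.drop (i * m)).take m = l[i] := by
  induction l generalizing i with
  | nil => simp at hi
  | cons a l ih =>
    have ha := h a (by simp)
    cases i with
    | zero => simp [← ha]
    | succ i =>
      rw [List.flatten_cons, Nat.succ_mul, add_comm, ← List.drop_drop, List.getElem_cons_succ,
        ← ih (fun b hb => h b (List.mem_cons_of_mem _ hb)) (by simpa using hi), ← ha, List.drop_left]

section

variable {p n k : ℕ} [NeZero p] (C : Circuit n n) (D : Circuit n k) {E : Finset (Finset (Fin n))}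

/-- The circuit as read by the algorithms. -/
def parsed {n m : ℕ} (C : Circuit n m) : GateLists :=
  (n, C.gates.map ofGate, List.ofFn C.outputs)

theorem reductionOutput_parsed (hp : 2 ≤ p) (hC : IsSelector C.eval E) (hE : ∀ B ∈ E, B.Nonempty)
    (hn : n ≤ (p - 1) * n + 1) (hk : ceilQuot ((p - 1) * n + 1) (p - 1) < 2 ^ (n + k))
    (hD : ∀ y, binValue (D.eval y) ∈ Finset.Icc 1 ((colorabilityDefect p E - 1) / (p - 1))) :
    reductionOutput p (parsed C) (parsed D) =
      (tuckerProblem p).enc (reductionInstance C D hp hC hE hn hk hD) := by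
  change _ = encNat ((p - 1) * n + 1) ++ encNat n ++ (reductionCircuit C D hp hn).enc
  rw [← flatMap_circuitNats (reductionCircuit C D hp hn) _ rfl, ofFn_outputs_reductionCircuit]
  simp only [reductionOutput, parsed, List.flatMap_cons, List.append_assoc, List.length_ofFn]

/-- The wires of `leadGates` run on `X` satisfy the gate equations, so `holds_leadGates` identifies
the selected set without any reference to the full circuit. -/
theorem leadSet_parsed (hn : n ≤ (p - 1) * n + 1) {X : SignedSet p ((p - 1) * n + 1)} {t : ZMod p}
    (h : lead C.eval (entries X) ((p - 1) * n + 1) = some t) :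
    leadSet p (parsed C) (List.ofFn X.bits) = List.ofFn (part C.eval (entries X) t) := by
  have hwf := wf_leadGates (p := p) C C.map_toGate_ofGate.symm hn
  have hv := holds_runGates (gs := leadGates p n ((p - 1) * n + 1) (C.gates.map ofGate)
    (List.ofFn C.outputs)) (w := List.ofFn X.bits) (by rwa [List.length_ofFn])
  rw [List.length_ofFn] at hv
  have hx : ∀ j < (p - 1) * n + 1, ∀ t < p, (runGates (leadGates p n ((p - 1) * n + 1)
      (C.gates.map ofGate) (List.ofFn C.outputs)) (List.ofFn X.bits)).getD (j * p + t) false =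
        decide (entries X j = some ((t : ℕ) : ZMod p)) := by
    intro j hj t ht
    have h1 : j * p + t < (List.ofFn X.bits).length := by
      rw [List.length_ofFn]
      exact mul_add_lt hj ht
    rw [runGates_getD _ h1, List.getD_eq_getElem _ _ h1, List.getElem_ofFn]
    exact bits_apply X hj ht
  have h1 := (holds_leadGates C C.map_toGate_ofGate.symm hv hn hx).2.2.2
  refine List.ext_getElem (by simp [leadSet, parsed]) fun j hj hj' => ?_
  have hjn : j < n := by simpa using hj'
  have h2 := h1 ⟨j, hjn⟩
  rw [h] at h2
  simp only [leadSet, parsed, List.getElem_map, List.getElem_range, List.getElem_ofFn,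
    List.length_ofFn]
  rw [Bool.eq_iff_iff, h2]
  simp

theorem solutionOutput_parsed (hn : n ≤ (p - 1) * n + 1) {X : Fin p → SignedSet p ((p - 1) * n + 1)}
    {π : Fin p → ZMod p} (h : ∀ i, lead C.eval (entries (X i)) ((p - 1) * n + 1) = some (π i)) :
    solutionOutput p (parsed C) (List.ofFn fun i => List.ofFn (X i).bits).flatten =
      (List.ofFn fun i => List.ofFn (part C.eval (entries (X i)) (π i))).flatten := by
  rw [solutionOutput, List.flatMap_def]
  congr 1
  refine List.ext_getElem (by simp) fun i hi hi' => ?_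
  have hip : i < p := by simpa using hi'
  rw [List.getElem_map, List.getElem_range, List.getElem_ofFn]
  have h1 := take_drop_flatten (m := ((p - 1) * n + 1) * p)
    (List.ofFn fun i => List.ofFn (X i).bits) (by simp [List.mem_ofFn]) (i := i) (by simpa using hip)
  rw [List.getElem_ofFn] at h1
  refine (congrArg (leadSet p (parsed C)) h1).trans (leadSet_parsed C hn (h ⟨i, hip⟩))

end

/-- The quotient is at most `n + 1`, and one additional bit is needed for this: without `hk` the
bound fails, for instance at `n = 1`, `k = 0`. -/
theorem ceilQuot_lt {p n k : ℕ} (hp : 2 ≤ p) (hk : 1 ≤ k) :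
    ceilQuot ((p - 1) * n + 1) (p - 1) < 2 ^ (n + k) := by
  have h1 : ceilQuot ((p - 1) * n + 1) (p - 1) ≤ n + 1 := by
    rw [ceilQuot_le_iff (by omega), Nat.succ_mul, mul_comm n]
    omega
  have h2 : n + 1 < 2 ^ (n + 1) := Nat.lt_two_pow_self
  have h3 : 2 ^ (n + 1) ≤ 2 ^ (n + k) := Nat.pow_le_pow_right (by omega) (by omega)
  omega

/-- The machine and its polynomial depend on `p`, `M` and `q` alone. The index `x` is extracted from
the instance and handed to `M`, whose answer is parsed along with the color circuit. -/
theorem exists_reduction_machine (p : ℕ) (M : TM2ComputableAux Bool Bool) (q : Polynomial ℕ) :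
    ∃ (f : TM2ComputableAux Bool Bool) (Q : Polynomial ℕ), ∀ (x : List Bool) (n k : ℕ)
      (C : Circuit n n) (D : Circuit n k), OutputsWithin M x C.enc (q.eval n) →
        OutputsWithin f (encPair x D.enc) (reductionOutput p (parsed C) (parsed D))
          (Q.eval (encPair x D.enc).length) := by
  have hpre : PT fun z : List Bool => (unpair z).1 := PT.fst' (PT.unpair PT.id')
  have h0 : PT fun z : List Bool × List Bool =>
      (parseCircuit (decodeNats z.1), parseCircuit (decodeNats (unpair z.2).2)) :=
    PT.pair (PT.parseCircuit (PT.decodeNats PT.fst))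
      (PT.parseCircuit (PT.decodeNats (PT.snd' (PT.unpair PT.snd))))
  obtain ⟨f, Q, h⟩ := exists_machine M hpre ((PT.reductionOutput p).comp h0)
  refine ⟨f, Q.comp (Polynomial.X + q), fun x n k C D hM => ?_⟩
  have hn : n ≤ (encPair x D.enc).length := by
    rw [length_encPair]
    exact D.le_length_enc.trans (Nat.le_add_left _ _)
  have hx : (unpair (encPair x D.enc)).1 = x := by rw [unpair_encPair]
  have h1 := h (encPair x D.enc) C.enc (q.eval (encPair x D.enc).length)
    (hx.symm ▸ hM.mono (eval_mono q hn))
  dsimp only at h1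
  rw [unpair_encPair, parseCircuit_decodeNats, parseCircuit_decodeNats] at h1
  rw [Polynomial.eval_comp, Polynomial.eval_add, Polynomial.eval_X]
  exact h1

theorem exists_solution_machine (p : ℕ) (M : TM2ComputableAux Bool Bool) (q : Polynomial ℕ) :
    ∃ (g : TM2ComputableAux Bool Bool) (Q : Polynomial ℕ), ∀ (x : List Bool) (n k : ℕ)
      (C : Circuit n n) (D : Circuit n k) (w : List Bool), OutputsWithin M x C.enc (q.eval n) →
        OutputsWithin g (encPair (encPair x D.enc) w) (solutionOutput p (parsed C) w)
          (Q.eval (encPair (encPair x D.enc) w).length) := by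
  have h0 : PT fun z : List Bool × List Bool => (parseCircuit (decodeNats z.1), (unpair z.2).2) :=
    PT.pair (PT.parseCircuit (PT.decodeNats PT.fst)) (PT.snd' (PT.unpair PT.snd))
  have hpre : PT fun z : List Bool => (unpair (unpair z).1).1 :=
    PT.fst' (PT.unpair (PT.fst' (PT.unpair PT.id')))
  obtain ⟨g, Q, h⟩ := exists_machine M hpre ((PT.solutionOutput p).comp h0)
  refine ⟨g, Q.comp (Polynomial.X + q), fun x n k C D w hM => ?_⟩
  have hn : n ≤ (encPair (encPair x D.enc) w).length := by
    rw [length_encPair, length_encPair]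
    have := D.le_length_enc
    omega
  have hx : (unpair (unpair (encPair (encPair x D.enc) w)).1).1 = x := by
    rw [unpair_encPair, unpair_encPair]
  have h1 := h (encPair (encPair x D.enc) w) C.enc (q.eval (encPair (encPair x D.enc) w).length)
    (hx.symm ▸ hM.mono (eval_mono q hn))
  dsimp only at h1
  rw [unpair_encPair, parseCircuit_decodeNats] at h1
  rw [Polynomial.eval_comp, Polynomial.eval_add, Polynomial.eval_X]
  exact h1

end KneserTucker

open KneserTucker in
theorem mainTheorem5 (p : ℕ) (hp : p.Prime) {A : Type*} (F : KneserTucker.SetFamilySequence A)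
    (hF : F.StronglyPolyComputable) :
    (KneserTucker.kneserProblem p F
        (fun α => (KneserTucker.colorabilityDefect p (F.fam α) - 1) / (p - 1))).PolyTimeReducible
      (KneserTucker.tuckerProblem p) := by
  obtain ⟨ord, -, q, -, -, ⟨M, hM⟩, -⟩ := hF
  -- One circuit is fixed for each index, and both algorithms obtain it by running `M`; solutions
  -- are thus decoded with the very selector that was used for the instance.
  choose C hMC hC using hM
  have hC : ∀ α, IsSelector (C α).eval (F.fam α) := fun α => isSelector_of_linearOrder (ord α) (hC α)
  have hp2 := hp.two_le
  have : NeZero p := ⟨hp.ne_zero⟩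
  obtain ⟨f, qf, hf⟩ := exists_reduction_machine p M q
  obtain ⟨g, qg, hg⟩ := exists_solution_machine p M q
  refine ⟨f, g, qf, qg, fun I => ?_⟩
  have hn : F.n I.α ≤ (p - 1) * F.n I.α + 1 := by
    have := Nat.mul_le_mul_right (F.n I.α) (by omega : 1 ≤ p - 1)
    omega
  -- A circuit without outputs would give the value `0`, which is not a color.
  have hk : 1 ≤ I.k := by
    have h1 := (Finset.mem_Icc.mp (I.color_mem fun _ => false)).1
    rw [Nat.one_le_iff_ne_zero]
    intro h0
    have : IsEmpty (Fin I.k) := by rw [h0]; infer_instance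
    rw [binValue, Finset.univ_eq_empty, Finset.sum_empty] at h1
    omega
  have hE := F.nonempty_of_mem I.α
  refine ⟨reductionInstance (C I.α) I.C hp2 (hC I.α) hE hn (ceilQuot_lt hp2 hk) I.color_mem, ?_, ?_⟩
  · rw [← reductionOutput_parsed]
    exact hf _ _ _ _ _ (hMC I.α)
  · rintro w ⟨X, π, l, hX, hb, -, hl, rfl⟩
    have h1 := fun i => lead_of_labels (C I.α) I.C hp2 hn (ceilQuot_lt hp2 hk) (hC I.α) (hX i) (hl i)
    obtain ⟨B, hB1, hB2, hB3⟩ := exists_sets_of_chain hp2 (hC I.α) hE I.color_mem hn hb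
      (fun i => (h1 i).1) fun i => (h1 i).2
    refine ⟨_, ⟨B, hB1, hB2, fun i j => (hB3 i).2.trans (hB3 j).2.symm, rfl⟩, ?_⟩
    -- The output of the second algorithm is the list of selected sets, which are the characteristic
    -- vectors of the sets `B i`.
    have h2 := solutionOutput_parsed (C I.α) hn fun i => (h1 i).1
    simp only [(hB3 _).1] at h2
    rw [← h2]
    exact hg _ _ _ _ _ _ (hMC I.α)
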